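/- **Setting.** Let $(Z_t)_{t\in\mathbb Z}$ be i.i.d. real random variables on a probability space with $\mathbb E Z_0=0$, $\mathbb E Z_0^2=1$, and let $\mathcal F_t=\sigma(Z_k;\,k\le t)$. Let $\{g_\theta:\theta\in\Theta\}$, $\Theta\subset\mathbb R^d$, be a family of nonnegative functions $g_\theta(x,u)$ on $\mathbb R^p\times[0,\infty)^q$, measurable in $x$. Suppose that for some $\theta_0\in\Theta$ the model $$X_t=\sigma_tZ_t,\qquad \sigma_t^2=g_{\theta_0}(X_{t-1},\dots,X_{t-p};\sigma_{t-1}^2,\dots,\sigma_{t-q}^2),\qquad t\in\mathbb Z,$$ with $\sigma_t\ge 0$ being $\mathcal F_{t-1}$-measurable, has a unique stationary ergodic solution $((X_t,\sigma_t))$, and put $\mathbf X_t=(X_t,\dots,X_{t-p+1})$. Let $K\subset\mathbb R^d$ be compact and $\|v\|_K=\sup_{\theta\in K}|v(\theta)|$. For a map $\phi$ of a metric space into itself let $\Lambda(\phi)=\sup_{x\ne y}d(\phi(x),\phi(y))/d(x,y)$. A function on a set $S\subset\mathbb R^n$ which is the closure of its interior is called continuously differentiable on $S$ if it is continuous on $S$,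 differentiable in the interior of $S$, and its derivative extends continuously to $S$; derivatives on $S$ denote this extension. Put $$\psi_t(\theta,u)=(g_\theta(\mathbf X_t,u),u_1,\dots,u_{q-1}),\qquad[\Phi_t(s)](\theta)=\psi_t(\theta,s(\theta)),\quad s\in\mathbb C(K,[0,\infty)^q),$$ and $\Phi_t^{(r)}=\Phi_t\circ\Phi_{t-1}\circ\dots\circ\Phi_{t-r+1}$. Fix $\varsigma\in[0,\infty)^q$ and put $\hat h_0\equiv\varsigma$, $\hat h_{t+1}=\Phi_t(\hat h_t)$, $t\in\mathbb N$. Let $\partial_j^k\psi_t$ be the partial derivative of the $j$-th component of $\psi_t$ with respect to the $k$-th of the $d+q$ coordinates of $(\theta,u)$. **Condition D.1.** $K$ is contained in the interior of $\Theta$ and is the closure of its interior; for every $x\in\mathbb R^p$ the function $(\theta,u)\mapsto g_\theta(x,u)$ is continuously differentiable on $K\times[0,\infty)^q$; $\mathbb E[\log^+\|\Phi_0(\varsigma)\|_K]<\infty$ and $\mathbb E[\log^+\Lambda(\Phi_0)]<\infty$; and $\mathbb E[\log\Lambda(\Phi_0^{(r)})]<0$ (possibly $-\infty$) for some integer $r\ge1$.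 **Condition D.2**, for a stationary solution $(h_t)_{t\in\mathbb Z}$ of the stochastic recurrence equation $h_{t+1}=\Phi_t(h_t)$ on $\mathbb C(K,[0,\infty)^q)$. For all $j\in\{1,\dots,q\}$ and $k\in\{1,\dots,d+q\}$, $$\mathbb E\Big[\log^+\sup_{\theta\in K}|\partial_j^k\psi_0(\theta,h_0(\theta))|\Big]<\infty,$$ and there are a stationary sequence $(\bar C_1(t))_{t\in\mathbb Z}$ with $\mathbb E[\log^+\bar C_1(0)]<\infty$ and $\kappa\in(0,1]$ such that a.s., for all $t\in\mathbb Z$, all such $j,k$ and all $u,\tilde u\in[0,\infty)^q$, $$\sup_{\theta\in K}|\partial_j^k\psi_t(\theta,u)-\partial_j^k\psi_t(\theta,\tilde u)|\le\bar C_1(t)|u-\tilde u|^\kappa .$$ **Proposition 6.1.** Assume D.1. Then the equation $h_{t+1}=\Phi_t(h_t)$, $t\in\mathbb Z$, has a stationary solution $(h_t)$. If D.2 holds for $(h_t)$, then the linear stochastic recurrence equation on $\mathbb C(K,\mathbb R^{dq})$ $$[d_{t+1}(\theta)]_{(j-1)d+k}=\partial_j^k\psi_t(\theta,h_t(\theta))+\sum_{i=1}^q\partial_j^{d+i}\psi_t(\theta,h_t(\theta))\,[d_t(\theta)]_{(i-1)d+k},\qquad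 1\le j\le q,\ 1\le k\le d,\ t\in\mathbb Z,$$ has a stationary solution $(d_t)$, unique up to almost sure equality; it is ergodic and (in a suitable version) $d_t$ is $\mathcal F_{t-1}$-measurable for every $t$. For every $t\in\mathbb Z$, almost surely $h_t$ is continuously differentiable on $K$ with $h_t'=d_t$, where $f'=(\partial f_j/\partial\theta_k)_{j,k}\in\mathbb R^{dq}$. Moreover, the functions $\hat h_t$ are continuously differentiable on $K$, and $\|\hat h_t'-d_t\|_K\to0$ exponentially fast a.s. as $t\to\infty$: there is a constant $\gamma>1$ with $\gamma^t\|\hat h_t'-d_t\|_K\to0$ a.s. -/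

import Mathlib

open MeasureTheory ProbabilityTheory Filter Topology
open scoped ENNReal NNReal

noncomputable section

/-! ### Random elements and stationary ergodic sequences -/

/-- The Borel `σ`-algebra of the sup-norm topology (compact-open topology) on `C(X, Y)`. -/
instance instMeasurableSpaceContinuousMap {X Y : Type*} [TopologicalSpace X]
    [TopologicalSpace Y] : MeasurableSpace C(X, Y) := borel _

instance instBorelSpaceContinuousMap {X Y : Type*} [TopologicalSpace X]
    [TopologicalSpace Y] : BorelSpace C(X, Y) := ⟨rfl⟩

/-- The left shift on two-sided sequences. -/
def shiftSeq {E : Type*} (x : ℤ → E) : ℤ → E := fun t => x (t + 1)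

/-- The law of the process `v` on the path space `ℤ → E` with the product `σ`-algebra. -/
def processLaw {Ω E : Type*} [MeasurableSpace Ω] [MeasurableSpace E] (P : Measure Ω)
    (v : ℤ → Ω → E) : Measure (ℤ → E) :=
  P.map (fun ω t => v t ω)

/-- `v` is a (strictly) stationary sequence of random elements. -/
structure IsStationarySeq {Ω E : Type*} [MeasurableSpace Ω] [MeasurableSpace E]
    (P : Measure Ω) (v : ℤ → Ω → E) : Prop where
  aemeasurable : ∀ t, AEMeasurable (v t) P
  map_shift : (processLaw P v).map shiftSeq = processLaw P v

/-- `v` is a stationary ergodic sequence: the shift preserves the law of `v` and is ergodic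
with respect to it. -/
structure IsStationaryErgodicSeq {Ω E : Type*} [MeasurableSpace Ω] [MeasurableSpace E]
    (P : Measure Ω) (v : ℤ → Ω → E) : Prop where
  aemeasurable : ∀ t, AEMeasurable (v t) P
  ergodic : Ergodic shiftSeq (processLaw P v)

/-- Exponentially fast almost sure convergence to zero of a sequence of norms: there is a
deterministic `γ > 1` with `γ ^ t * u t → 0` almost surely. -/
def ExpFastAS {Ω : Type*} [MeasurableSpace Ω] (P : Measure Ω) (u : ℕ → Ω → ℝ≥0∞) : Prop :=
  ∃ γ : ℝ≥0, 1 < γ ∧ ∀ᵐ ω ∂P, Tendsto (fun t : ℕ => (γ : ℝ≥0∞) ^ t * u t ω) atTop (𝓝 0)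

/-! ### Logarithmic moments, Lipschitz constants, iterates -/

/-- `log⁺ y = max (log y) 0`, for `y ∈ [0, ∞]`. -/
def logPlus (y : ℝ≥0∞) : ℝ≥0∞ := (ENNReal.log y).toENNReal

/-- `log⁻ y = max (-log y) 0`, for `y ∈ [0, ∞]`; the value at `0` is `∞`. -/
def logMinus (y : ℝ≥0∞) : ℝ≥0∞ := (-ENNReal.log y).toENNReal

/-- `E[log⁺ Y] < ∞`. -/
def FiniteLogPlusMoment {Ω : Type*} [MeasurableSpace Ω] (P : Measure Ω) (Y : Ω → ℝ≥0∞) : Prop :=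
  ∫⁻ ω, logPlus (Y ω) ∂P < ∞

/-- `E[log Y] < 0`: the expectation `E[log⁺ Y] - E[log⁻ Y]` is well defined in `[-∞, ∞)` and
negative; the value `-∞` is allowed. -/
def NegativeLogMean {Ω : Type*} [MeasurableSpace Ω] (P : Measure Ω) (Y : Ω → ℝ≥0∞) : Prop :=
  ∫⁻ ω, logPlus (Y ω) ∂P < ∫⁻ ω, logMinus (Y ω) ∂P

/-- The Lipschitz constant `Λ(φ) = sup_{x ≠ y} d(φ x, φ y) / d(x, y)`. -/
def lipConst {E : Type*} [MetricSpace E] (φ : E → E) : ℝ≥0∞ :=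
  ⨆ (x : E) (y : E) (_ : x ≠ y), edist (φ x) (φ y) / edist x y

/-- `φ_t^{(r)} = φ_t ∘ φ_{t-1} ∘ ⋯ ∘ φ_{t-r+1}`, with `φ_t^{(0)} = id`. -/
def pastIterate {E : Type*} (φ : ℤ → E → E) : ℤ → ℕ → E → E
  | _, 0 => id
  | t, r + 1 => φ t ∘ pastIterate φ (t - 1) r

/-! ### Function spaces and continuous differentiability on closed sets -/

/-- `ℝⁿ` with the Euclidean norm. -/
abbrev Vec (n : ℕ) : Type := EuclideanSpace ℝ (Fin n)

/-- `ℝ^{dq}`, the space of first derivatives of maps `ℝᵈ → ℝ^q`; the coordinate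
`(j - 1) d + k` is indexed by the pair `(j, k)`. -/
abbrev DerivVec (d q : ℕ) : Type := EuclideanSpace ℝ (Fin q × Fin d)

/-- `[0, ∞)^q`. -/
def orthant (q : ℕ) : Set (Vec q) := {u | ∀ j, 0 ≤ u j}

/-- `C(K, [0, ∞)^q)` with the metric of the sup norm. -/
abbrev NonnegFun {d : ℕ} (K : TopologicalSpace.Compacts (Vec d)) (q : ℕ) : Type :=
  {s : C(K, Vec q) // ∀ θ, s θ ∈ orthant q}

/-- The constant function with value `ς`. -/
def constFun {d q : ℕ} (K : TopologicalSpace.Compacts (Vec d)) (ς : orthant q) : NonnegFun K q :=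
  ⟨ContinuousMap.const K (ς : Vec q), fun _ => ς.2⟩

/-- The sup norm `‖f‖_K` with values in `[0, ∞]`. -/
def supNorm {d : ℕ} (K : TopologicalSpace.Compacts (Vec d)) {F : Type*} [NormedAddCommGroup F]
    (f : K → F) : ℝ≥0∞ :=
  ⨆ θ : K, ‖f θ‖ₑ

/-- `f` is continuously differentiable on a set `S` that is the closure of its interior: `f` is
continuous on `S`, differentiable in the interior of `S`, and the derivative extends continuously
from the interior to `S`. -/
def C1On {E F : Type*} [NormedAddCommGroup E] [NormedSpace ℝ E] [NormedAddCommGroup F]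
    [NormedSpace ℝ F] (S : Set E) (f : E → F) : Prop :=
  ContinuousOn f S ∧
    ∃ D : E → E →L[ℝ] F, ContinuousOn D S ∧ ∀ x ∈ interior S, HasFDerivAt f (D x) x

/-- The derivative on `S` of a function that is continuously differentiable on `S`: the continuous
extension to `S` of the derivative in the interior of `S`. -/
def derivOn {E F : Type*} [NormedAddCommGroup E] [NormedSpace ℝ E] [NormedAddCommGroup F]
    [NormedSpace ℝ F] (S : Set E) (f : E → F) : E → E →L[ℝ] F :=
  extendFrom (interior S) (fderiv ℝ f)

open Classical in
/-- A function on `K` as a function on `ℝᵈ`, with value `0` outside `K`. -/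
def zeroExt {d q : ℕ} (K : TopologicalSpace.Compacts (Vec d)) (f : K → Vec q) : Vec d → Vec q :=
  fun θ => if h : θ ∈ K then f ⟨θ, h⟩ else 0

/-- `f : K → ℝ^q` is continuously differentiable on `K`. -/
def IsC1 {d q : ℕ} (K : TopologicalSpace.Compacts (Vec d)) (f : K → Vec q) : Prop :=
  C1On (K : Set (Vec d)) (zeroExt K f)

/-- The vector `f'(θ)` of the first partial derivatives `∂ f_j / ∂ θ_k` of `f : K → ℝ^q`. -/
def firstDeriv {d q : ℕ} (K : TopologicalSpace.Compacts (Vec d)) (f : K → Vec q) (θ : K) :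
    DerivVec d q :=
  WithLp.toLp 2 fun jk =>
    (derivOn (K : Set (Vec d)) (zeroExt K f) θ (EuclideanSpace.single jk.2 1)) jk.1

/-! ### The conditionally heteroscedastic model -/

/-- A parametric family `{g_θ : θ ∈ Θ}` of nonnegative functions `g_θ(x, u)` on
`ℝᵖ × [0, ∞)^q`, measurable in `x`. The values of `g` outside `Θ × ℝᵖ × [0, ∞)^q` play no role. -/
structure VolatilityFamily (d p q : ℕ) where
  Θ : Set (Vec d)
  g : Vec d → (Fin p → ℝ) → Vec q → ℝ
  nonneg : ∀ θ ∈ Θ, ∀ x, ∀ u ∈ orthant q, 0 ≤ g θ x u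
  measurable : ∀ θ ∈ Θ, ∀ u ∈ orthant q, Measurable fun x => g θ x u

/-- `(Z_t)` is i.i.d. with mean zero and second moment one. -/
structure IsNoise {Ω : Type*} [MeasurableSpace Ω] (P : Measure Ω) (Z : ℤ → Ω → ℝ) : Prop where
  measurable : ∀ t, Measurable (Z t)
  indep : iIndepFun Z P
  identDistrib : ∀ t, IdentDistrib (Z t) (Z 0) P P
  memLp : MemLp (Z 0) 2 P
  mean : ∫ ω, Z 0 ω ∂P = 0
  second_moment : ∫ ω, Z 0 ω ^ 2 ∂P = 1

/-- `ℱ_t = σ(Z_k ; k ≤ t)`. -/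
@[reducible] def pastField {Ω : Type*} (Z : ℤ → Ω → ℝ) (t : ℤ) : MeasurableSpace Ω :=
  ⨆ k : ℤ, ⨆ _ : k ≤ t, MeasurableSpace.comap (Z k) inferInstance

/-- The vector `(Y_t, Y_{t-1}, …, Y_{t-n+1})`. -/
def lagVec {Ω : Type*} (n : ℕ) (Y : ℤ → Ω → ℝ) (t : ℤ) (ω : Ω) : Fin n → ℝ :=
  fun i => Y (t - (i : ℕ)) ω

namespace VolatilityFamily

variable {d p q : ℕ} (M : VolatilityFamily d p q)

/-- `((X_t, σ_t))` solves `X_t = σ_t Z_t`,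
`σ_t² = g_θ(X_{t-1}, …, X_{t-p}; σ_{t-1}², …, σ_{t-q}²)`, where `σ_t` is nonnegative and
`ℱ_{t-1}`-measurable. -/
structure IsSolution {Ω : Type*} [MeasurableSpace Ω] (P : Measure Ω) (Z : ℤ → Ω → ℝ)
    (θ : Vec d) (X σ : ℤ → Ω → ℝ) : Prop where
  measurable : ∀ t, Measurable[pastField Z (t - 1)] (σ t)
  nonneg : ∀ t, ∀ᵐ ω ∂P, 0 ≤ σ t ω
  obs : ∀ t, ∀ᵐ ω ∂P, X t ω = σ t ω * Z t ω
  vol : ∀ t, ∀ᵐ ω ∂P, σ t ω ^ 2 =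
    M.g θ (lagVec p X (t - 1) ω) (WithLp.toLp 2 fun i => lagVec q σ (t - 1) ω i ^ 2)

/-- `((X_t, σ_t))` is the unique stationary ergodic solution of the model with parameter `θ`. -/
structure IsUniqueStationaryErgodicSolution {Ω : Type*} [MeasurableSpace Ω] (P : Measure Ω)
    (Z : ℤ → Ω → ℝ) (θ : Vec d) (X σ : ℤ → Ω → ℝ) : Prop where
  isSolution : M.IsSolution P Z θ X σ
  stationaryErgodic : IsStationaryErgodicSeq P fun t ω => (X t ω, σ t ω)
  unique : ∀ X' σ' : ℤ → Ω → ℝ, M.IsSolution P Z θ X' σ' →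
    IsStationaryErgodicSeq P (fun t ω => (X' t ω, σ' t ω)) →
      ∀ t, ∀ᵐ ω ∂P, X' t ω = X t ω ∧ σ' t ω = σ t ω

/-- The map `(θ, u) ↦ (g_θ(x, u), u_1, …, u_{q-1})`; with `x = (X_t, …, X_{t-p+1})` this is
`ψ_{t,1}`. -/
def psi (x : Fin p → ℝ) (z : Vec d × Vec q) : Vec q :=
  WithLp.toLp 2 fun j : Fin q =>
    if (j : ℕ) = 0 then M.g z.1 x z.2 else z.2 ⟨(j : ℕ) - 1, by omega⟩

/-- The regularity of the family on the compact set `K`: `K` lies in the interior of `Θ`, `K` is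
the closure of its interior, and `(θ, u) ↦ g_θ(x, u)` is continuously differentiable on
`K × [0, ∞)^q` for every `x`. -/
structure IsRegularOn (K : TopologicalSpace.Compacts (Vec d)) : Prop where
  subset_interior : (K : Set (Vec d)) ⊆ interior M.Θ
  closure_interior : closure (interior (K : Set (Vec d))) = K
  c1 : ∀ x, C1On ((K : Set (Vec d)) ×ˢ orthant q) fun z => M.g z.1 x z.2

variable {M} {K : TopologicalSpace.Compacts (Vec d)}

/-- The map `Φ` on `C(K, [0, ∞)^q)` given by
`[Φ(s)](θ) = (g_θ(x, s(θ)), s_1(θ), …, s_{q-1}(θ))`; with `x = (X_t, …, X_{t-p+1})` this is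
`Φ_t`. -/
def IsRegularOn.Phi (hM : M.IsRegularOn K) (x : Fin p → ℝ) (s : NonnegFun K q) : NonnegFun K q :=
  ⟨⟨fun θ => M.psi x (θ, s.1 θ), by
      have h1 : Continuous fun θ : K => M.g θ x (s.1 θ) :=
        (hM.c1 x).1.comp_continuous (f := fun θ : K => ((θ : Vec d), s.1 θ))
          (by fun_prop) (fun θ => ⟨θ.2, s.2 θ⟩)
      refine (PiLp.continuous_toLp 2 _).comp (continuous_pi fun j => ?_)
      by_cases hj : (j : ℕ) = 0
      · simpa only [hj, if_true] using h1
      · simp only [hj, if_false]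
        fun_prop⟩, by
      intro θ j
      by_cases hj : (j : ℕ) = 0
      · simpa [psi, hj] using
          M.nonneg θ (interior_subset (hM.subset_interior θ.2)) x (s.1 θ) (s.2 θ)
      · simpa [psi, hj] using s.2 θ ⟨(j : ℕ) - 1, by omega⟩⟩

/-- The random map `Φ_t`. -/
def IsRegularOn.randomPhi (hM : M.IsRegularOn K) {Ω : Type*} (X : ℤ → Ω → ℝ) (ω : Ω) (t : ℤ) :
    NonnegFun K q → NonnegFun K q :=
  hM.Phi (lagVec p X t ω)

/-- `ĥ_0 = ς`, `ĥ_{t+1} = Φ_t(ĥ_t)`. -/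
def IsRegularOn.hHat (hM : M.IsRegularOn K) {Ω : Type*} (X : ℤ → Ω → ℝ) (ς : orthant q) :
    ℕ → Ω → NonnegFun K q
  | 0, _ => constFun K ς
  | t + 1, ω => hM.randomPhi X ω (t : ℤ) (hM.hHat X ς t ω)

/-- The contraction-on-average conditions on `(Φ_t)`. -/
structure IsRegularOn.IsContractiveOnAverage (hM : M.IsRegularOn K) {Ω : Type*}
    [MeasurableSpace Ω] (P : Measure Ω) (X : ℤ → Ω → ℝ) (ς : orthant q) : Prop where
  init : FiniteLogPlusMoment P fun ω => ‖(hM.randomPhi X ω 0 (constFun K ς)).1‖ₑ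
  lip : FiniteLogPlusMoment P fun ω => lipConst (hM.randomPhi X ω 0)
  contr : ∃ r : ℕ, 1 ≤ r ∧
    NegativeLogMean P fun ω => lipConst (pastIterate (hM.randomPhi X ω) 0 r)

/-- `h` is a stationary solution of the SRE `s_{t+1} = Φ_t(s_t)`, `t ∈ ℤ`, on
`C(K, [0, ∞)^q)`. -/
structure IsRegularOn.IsStationarySolution (hM : M.IsRegularOn K) {Ω : Type*}
    [MeasurableSpace Ω] (P : Measure Ω) (X : ℤ → Ω → ℝ) (h : ℤ → Ω → NonnegFun K q) : Prop where
  stationary : IsStationarySeq P h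
  sre : ∀ t, ∀ᵐ ω ∂P, h (t + 1) ω = hM.randomPhi X ω t (h t ω)

variable (M K)

/-- The unit directions of `ℝᵈ × ℝ^q`: the first `d` coordinates are the parameter coordinates,
the last `q` are the coordinates of `u`. -/
def direction : Fin d ⊕ Fin q → Vec d × Vec q :=
  Sum.elim (fun k => (EuclideanSpace.single k 1, 0)) (fun i => (0, EuclideanSpace.single i 1))

/-- The partial derivative `∂_j^k ψ(θ, u)` on `K × [0, ∞)^q`. -/
def dpsi (x : Fin p → ℝ) (j : Fin q) (k : Fin d ⊕ Fin q) (θ : Vec d) (u : Vec q) : ℝ :=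
  (derivOn ((K : Set (Vec d)) ×ˢ orthant q) (M.psi x) (θ, u) (direction k)) j

/-- The moment and Hölder conditions on the partial derivatives of `ψ_{t,1}`. -/
structure DerivCondition {Ω : Type*} [MeasurableSpace Ω] (P : Measure Ω) (X : ℤ → Ω → ℝ)
    (h : ℤ → Ω → NonnegFun K q) : Prop where
  moment : ∀ (j : Fin q) (k : Fin d ⊕ Fin q), FiniteLogPlusMoment P fun ω =>
    supNorm K fun θ => M.dpsi K (lagVec p X 0 ω) j k θ ((h 0 ω).1 θ)
  holder : ∃ (C : ℤ → Ω → ℝ) (κ : ℝ), IsStationarySeq P C ∧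
    (FiniteLogPlusMoment P fun ω => ENNReal.ofReal (C 0 ω)) ∧ 0 < κ ∧ κ ≤ 1 ∧
    ∀ t, ∀ᵐ ω ∂P, ∀ (j : Fin q) (k : Fin d ⊕ Fin q), ∀ u ∈ orthant q, ∀ u' ∈ orthant q,
      ∀ θ ∈ K, |M.dpsi K (lagVec p X t ω) j k θ u - M.dpsi K (lagVec p X t ω) j k θ u'| ≤
        C t ω * ‖u - u'‖ ^ κ

/-- `(d_t)` solves the linear SRE on `C(K, ℝ^{dq})`
`[d_{t+1}(θ)]_{(j,k)} = ∂_j^k ψ_{t,1}(θ, h_t(θ))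
  + ∑_i ∂_j^{d+i} ψ_{t,1}(θ, h_t(θ)) [d_t(θ)]_{(i,k)}`, `t ∈ ℤ`. -/
def SolvesDerivSRE {Ω : Type*} [MeasurableSpace Ω] (P : Measure Ω) (X : ℤ → Ω → ℝ)
    (h : ℤ → Ω → NonnegFun K q) (D : ℤ → Ω → C(K, DerivVec d q)) : Prop :=
  ∀ t, ∀ᵐ ω ∂P, ∀ (θ : K) (j : Fin q) (k : Fin d),
    D (t + 1) ω θ (j, k) =
      M.dpsi K (lagVec p X t ω) j (Sum.inl k) θ ((h t ω).1 θ) +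
        ∑ i : Fin q, M.dpsi K (lagVec p X t ω) j (Sum.inr i) θ ((h t ω).1 θ) * D t ω θ (i, k)

end VolatilityFamily

end

/-!
Since `E log Λ(Φ_0^{(r)}) < 0`, averaging the ergodic theorem for `r`-step Lipschitz constants over
the residue classes modulo `r` shows that the maps `Φ_t` contract exponentially along almost every
path, with constants that grow subexponentially in the starting time. Hence the backward iterates
of `Φ` converge, and their limit is the only stationary solution `h`.

By the chain rule the derivative of an orbit of `Φ` obeys a linear recursion. Its linear part at
`(θ, h_t(θ))` is the derivative of `Φ_t` in the state, so a Lipschitz bound for the iterates of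
`Φ` bounds the iterated linear parts: the derivative recursion inherits the contraction, and its
backward iterates converge to the stationary solution `d`. The recursion along the orbit of `ς`
differs from the recursion along `h` by the Hölder modulus of the partial derivatives at an
exponentially small distance. Therefore the derivatives of the orbits converge to `d` exponentially
fast, and `h` is differentiable with derivative `d` as a `C¹` limit.
-/

/-! ### Iterates of a sequence of maps -/

/-- The composition `φ_{i+n-1} ∘ ⋯ ∘ φ_{i+1} ∘ φ_i`, that is `pastIterate` indexed by the time at
which the orbit starts instead of the time at which it ends. -/
def forwardIterate {E : Type*} (φ : ℤ → E → E) (i : ℤ) : ℕ → E → E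
  | 0 => id
  | n + 1 => φ (i + n) ∘ forwardIterate φ i n

section ForwardIterate

variable {E : Type*} (φ : ℤ → E → E)

@[simp] theorem forwardIterate_zero (i : ℤ) : forwardIterate φ i 0 = id := rfl

theorem forwardIterate_succ (i : ℤ) (n : ℕ) :
    forwardIterate φ i (n + 1) = φ (i + n) ∘ forwardIterate φ i n := rfl

theorem forwardIterate_one (i : ℤ) : forwardIterate φ i 1 = φ i := by
  simp [forwardIterate_succ]

theorem forwardIterate_add (i : ℤ) (m n : ℕ) :
    forwardIterate φ i (m + n) = forwardIterate φ (i + m) n ∘ forwardIterate φ i m := by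
  induction n with
  | zero => rfl
  | succ n ih =>
    rw [← add_assoc, forwardIterate_succ, ih, forwardIterate_succ, Function.comp_assoc]
    push_cast
    rw [add_assoc]

theorem forwardIterate_succ' (i : ℤ) (n : ℕ) :
    forwardIterate φ i (n + 1) = forwardIterate φ (i + 1) n ∘ φ i := by
  rw [add_comm n 1, forwardIterate_add, forwardIterate_one, Nat.cast_one]

theorem forwardIterate_sub_succ (t : ℤ) (n : ℕ) :
    forwardIterate φ (t - (n + 1 : ℕ)) (n + 1) =
      forwardIterate φ (t - n) n ∘ φ (t - (n + 1 : ℕ)) := by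
  rw [forwardIterate_succ']
  congr 2
  push_cast
  ring

theorem forwardIterate_succ_sub (t : ℤ) (n : ℕ) :
    forwardIterate φ (t + 1 - (n + 1 : ℕ)) (n + 1) = φ t ∘ forwardIterate φ (t - n) n := by
  rw [show t + 1 - ((n + 1 : ℕ) : ℤ) = t - n by push_cast; ring, forwardIterate_succ,
    sub_add_cancel]

theorem pastIterate_eq_forwardIterate (t : ℤ) (n : ℕ) :
    pastIterate φ t n = forwardIterate φ (t - n + 1) n := by
  induction n generalizing t with
  | zero => rfl
  | succ n ih =>
    rw [pastIterate, ih, forwardIterate_succ]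
    congr 2 <;> push_cast <;> ring

theorem forwardIterate_shift (i k : ℤ) (n : ℕ) :
    forwardIterate (fun t => φ (t + k)) i n = forwardIterate φ (i + k) n := by
  induction n with
  | zero => rfl
  | succ n ih => rw [forwardIterate_succ, forwardIterate_succ, ih, add_right_comm]

theorem forwardIterate_eq_of_solves {φ : ℤ → E → E} {h : ℤ → E} {i : ℤ}
    (hh : ∀ m : ℕ, h (i + m + 1) = φ (i + m) (h (i + m))) (n : ℕ) :
    forwardIterate φ i n (h i) = h (i + n) := by
  induction n with
  | zero => simp
  | succ n ih =>
    rw [forwardIterate_succ, Function.comp_apply, ih, ← hh]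
    push_cast
    rw [add_assoc]

end ForwardIterate

/-- The two-sided sequence `a` is bounded above by `C exp(δ |i|)` for every `δ > 0`. -/
def Subexponential (a : ℤ → ℝ) : Prop :=
  ∀ δ > 0, ∃ C > 0, ∀ i : ℤ, a i ≤ C * Real.exp (δ * |(i : ℝ)|)

namespace Subexponential

variable {a b : ℤ → ℝ}

theorem mono (hb : Subexponential b) (h : ∀ i, a i ≤ b i) : Subexponential a := fun δ hδ => by
  obtain ⟨C, hC, hCb⟩ := hb δ hδ
  exact ⟨C, hC, fun i => (h i).trans (hCb i)⟩

theorem add (ha : Subexponential a) (hb : Subexponential b) :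
    Subexponential fun i => a i + b i := fun δ hδ => by
  obtain ⟨C, hC, hCa⟩ := ha δ hδ
  obtain ⟨C', hC', hCb⟩ := hb δ hδ
  exact ⟨C + C', by positivity, fun i => by rw [add_mul]; exact add_le_add (hCa i) (hCb i)⟩

theorem const (c : ℝ) : Subexponential fun _ => c := fun δ hδ =>
  ⟨|c| + 1, by positivity, fun i =>
    calc c ≤ (|c| + 1) * 1 := by linarith [le_abs_self c]
      _ ≤ (|c| + 1) * Real.exp (δ * |(i : ℝ)|) := by
          gcongr
          exact Real.one_le_exp (by positivity)⟩

theorem sum {ι : Type*} (s : Finset ι) {a : ι → ℤ → ℝ} (ha : ∀ j, Subexponential (a j)) :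
    Subexponential fun i => ∑ j ∈ s, a j i := by
  classical
  induction s using Finset.induction_on with
  | empty => simpa using Subexponential.const 0
  | insert j s hj ih => simpa only [Finset.sum_insert hj] using (ha j).add ih

theorem mul (ha : Subexponential a) (hb : Subexponential b) (hb0 : ∀ i, 0 ≤ b i) :
    Subexponential fun i => a i * b i := fun δ hδ => by
  obtain ⟨C, hC, hCa⟩ := ha (δ / 2) (half_pos hδ)
  obtain ⟨C', hC', hCb⟩ := hb (δ / 2) (half_pos hδ)
  refine ⟨C * C', by positivity, fun i => ?_⟩
  calc a i * b i ≤ (C * Real.exp (δ / 2 * |(i : ℝ)|)) * (C' * Real.exp (δ / 2 * |(i : ℝ)|)) :=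
        mul_le_mul (hCa i) (hCb i) (hb0 i) (by positivity)
    _ = C * C' * Real.exp (δ * |(i : ℝ)|) := by
        rw [mul_mul_mul_comm, ← Real.exp_add]
        ring_nf

theorem shift (ha : Subexponential a) (k : ℤ) : Subexponential fun i => a (i + k) := fun δ hδ => by
  obtain ⟨C, hC, hCa⟩ := ha δ hδ
  refine ⟨C * Real.exp (δ * |(k : ℝ)|), by positivity, fun i => (hCa (i + k)).trans ?_⟩
  rw [mul_assoc, ← Real.exp_add, ← mul_add, add_comm |(k : ℝ)|]
  push_cast
  gcongr
  exact abs_add_le _ _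

end Subexponential

theorem abs_add_natCast_le (i : ℤ) (n : ℕ) : |((i + n : ℤ) : ℝ)| ≤ |(i : ℝ)| + n := by
  push_cast
  exact (abs_add_le _ _).trans (by simp)

theorem abs_sub_natCast_le (i : ℤ) (n : ℕ) : |((i - n : ℤ) : ℝ)| ≤ |(i : ℝ)| + n := by
  push_cast
  exact (abs_sub _ _).trans (by simp)

theorem tendsto_exp_neg_mul_natCast {η : ℝ} (hη : 0 < η) :
    Tendsto (fun n : ℕ => Real.exp (-η * n)) atTop (𝓝 0) :=
  Real.tendsto_exp_atBot.comp
    (tendsto_natCast_atTop_atTop.const_mul_atTop_of_neg (neg_lt_zero.2 hη))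

/-- The iterates of `φ` contract at the exponential rate `ε`, up to a factor that is subexponential
in the starting time. -/
def ContractsExp {E : Type*} [PseudoMetricSpace E] (φ : ℤ → E → E) (ε : ℝ) : Prop :=
  ∀ δ > 0, ∃ C > 0, ∀ (i : ℤ) (n : ℕ) (u v : E),
    dist (forwardIterate φ i n u) (forwardIterate φ i n v) ≤
      C * Real.exp (-ε * n + δ * |(i : ℝ)|) * dist u v

namespace ContractsExp

section PseudoMetric

variable {E : Type*} [PseudoMetricSpace E] {φ : ℤ → E → E} {ε : ℝ} {o : E}

theorem continuous (hφ : ContractsExp φ ε) (t : ℤ) : Continuous (φ t) := by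
  obtain ⟨C, hC, hCφ⟩ := hφ 1 one_pos
  refine (LipschitzWith.of_dist_le_mul (K := Real.toNNReal
    (C * Real.exp (-ε * (1 : ℕ) + 1 * |(t : ℝ)|))) fun u v => ?_).continuous
  rw [Real.coe_toNNReal _ (by positivity), ← forwardIterate_one φ t]
  exact hCφ t 1 u v

theorem exists_dist_backward_le (hφ : ContractsExp φ ε)
    (ho : Subexponential fun i => dist (φ i o) o) {δ : ℝ} (hδ : 0 < δ) :
    ∃ C > 0, ∀ (t : ℤ) (n : ℕ),
      dist (forwardIterate φ (t - n) n o) (forwardIterate φ (t - (n + 1 : ℕ)) (n + 1) o) ≤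
        C * Real.exp (δ * |(t : ℝ)|) * Real.exp (δ - ε) ^ n := by
  obtain ⟨C, hC, hCφ⟩ := hφ (δ / 2) (half_pos hδ)
  obtain ⟨C', hC', hCo⟩ := ho (δ / 2) (half_pos hδ)
  refine ⟨C * C' * Real.exp (δ / 2), by positivity, fun t n => ?_⟩
  rw [forwardIterate_sub_succ, Function.comp_apply]
  calc dist (forwardIterate φ (t - n) n o) (forwardIterate φ (t - n) n (φ (t - (n + 1 : ℕ)) o))
      ≤ C * Real.exp (-ε * n + δ / 2 * |((t - n : ℤ) : ℝ)|) *
          dist (φ (t - (n + 1 : ℕ)) o) o := by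
        rw [dist_comm _ o]
        exact hCφ (t - n) n o _
    _ ≤ C * Real.exp (-ε * n + δ / 2 * |((t - n : ℤ) : ℝ)|) *
          (C' * Real.exp (δ / 2 * |((t - (n + 1 : ℕ) : ℤ) : ℝ)|)) := by
        gcongr
        exact hCo _
    _ ≤ C * Real.exp (-ε * n + δ / 2 * (|(t : ℝ)| + n)) *
          (C' * Real.exp (δ / 2 * (|(t : ℝ)| + (n + 1 : ℕ)))) := by
        gcongr
        exacts [abs_sub_natCast_le t n, abs_sub_natCast_le t (n + 1)]
    _ = C * C' * Real.exp (δ / 2) * Real.exp (δ * |(t : ℝ)|) * Real.exp (δ - ε) ^ n := by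
        rw [← Real.exp_nat_mul, mul_mul_mul_comm, ← Real.exp_add, mul_assoc (C * C'),
          ← Real.exp_add, mul_assoc (C * C'), ← Real.exp_add]
        push_cast
        congr 2
        ring

theorem exists_tendsto_backward [CompleteSpace E] (hφ : ContractsExp φ ε) (hε : 0 < ε)
    (ho : Subexponential fun i => dist (φ i o) o) (t : ℤ) :
    ∃ a, Tendsto (fun n : ℕ => forwardIterate φ (t - n) n o) atTop (𝓝 a) := by
  obtain ⟨C, -, hCb⟩ := hφ.exists_dist_backward_le ho (half_pos hε)
  exact cauchySeq_tendsto_of_complete <|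
    cauchySeq_of_le_geometric _ _ (Real.exp_lt_one_iff.2 (by linarith)) (hCb t)

theorem subexponential_dist_of_tendsto_backward (hφ : ContractsExp φ ε) (hε : 0 < ε)
    (ho : Subexponential fun i => dist (φ i o) o) {h : ℤ → E}
    (hh : ∀ t : ℤ, Tendsto (fun n : ℕ => forwardIterate φ (t - n) n o) atTop (𝓝 (h t))) :
    Subexponential fun t => dist (h t) o := by
  intro δ hδ
  set δ' := min δ (ε / 2)
  have hδ' : 0 < δ' := lt_min hδ (half_pos hε)
  have hδδ' : δ' ≤ δ := min_le_left _ _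
  have hr : Real.exp (δ' - ε) < 1 := Real.exp_lt_one_iff.2 (by linarith [min_le_right δ (ε / 2)])
  have hr' : 0 < 1 - Real.exp (δ' - ε) := sub_pos.2 hr
  obtain ⟨C, hC, hCb⟩ := hφ.exists_dist_backward_le ho hδ'
  refine ⟨C / (1 - Real.exp (δ' - ε)), div_pos hC hr', fun t => ?_⟩
  calc dist (h t) o ≤ C * Real.exp (δ' * |(t : ℝ)|) / (1 - Real.exp (δ' - ε)) := by
        simpa [dist_comm] using dist_le_of_le_geometric_of_tendsto₀ _ _ hr (hCb t) (hh t)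
    _ ≤ C / (1 - Real.exp (δ' - ε)) * Real.exp (δ * |(t : ℝ)|) := by
        rw [mul_div_right_comm]
        gcongr

theorem exists_dist_forwardIterate_le (hφ : ContractsExp φ ε) {h : ℤ → E}
    (hh : ∀ t, h (t + 1) = φ t (h t)) (ho : Subexponential fun t => dist (h t) o)
    {δ : ℝ} (hδ : 0 < δ) :
    ∃ C > 0, ∀ (i : ℤ) (n : ℕ), dist (forwardIterate φ i n o) (h (i + n)) ≤
      C * Real.exp (-ε * n + δ * |(i : ℝ)|) := by
  obtain ⟨C, hC, hCφ⟩ := hφ (δ / 2) (half_pos hδ)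
  obtain ⟨C', hC', hCo⟩ := ho (δ / 2) (half_pos hδ)
  refine ⟨C * C', by positivity, fun i n => ?_⟩
  rw [← forwardIterate_eq_of_solves fun _ => hh _]
  calc dist (forwardIterate φ i n o) (forwardIterate φ i n (h i))
      ≤ C * Real.exp (-ε * n + δ / 2 * |(i : ℝ)|) * dist (h i) o := by
        rw [dist_comm (h i)]
        exact hCφ i n _ _
    _ ≤ C * Real.exp (-ε * n + δ / 2 * |(i : ℝ)|) * (C' * Real.exp (δ / 2 * |(i : ℝ)|)) := by
        gcongr
        exact hCo i
    _ = C * C' * Real.exp (-ε * n + δ * |(i : ℝ)|) := by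
        rw [mul_mul_mul_comm, ← Real.exp_add]
        congr 2
        ring

end PseudoMetric

theorem solves_of_tendsto_backward {E : Type*} [MetricSpace E] {φ : ℤ → E → E} {ε : ℝ} {o : E}
    (hφ : ContractsExp φ ε) {h : ℤ → E}
    (hh : ∀ t : ℤ, Tendsto (fun n : ℕ => forwardIterate φ (t - n) n o) atTop (𝓝 (h t))) (t : ℤ) :
    h (t + 1) = φ t (h t) := by
  refine tendsto_nhds_unique ((hh (t + 1)).comp (tendsto_add_atTop_nat 1)) <|
    (((hφ.continuous t).tendsto _).comp (hh t)).congr fun n => ?_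
  simp only [Function.comp_apply, forwardIterate_succ_sub]

end ContractsExp

section Perturbation

variable {E : Type*} [PseudoMetricSpace E] (χ : ℤ → E → E) (i : ℤ) (d : ℤ → E)

-- Telescope along `m ↦ χ_{i+n-1} ∘ ⋯ ∘ χ_{i+m} (d_{i+m})`.
theorem dist_forwardIterate_le_sum {L : ℕ → ℕ → ℝ}
    (hL : ∀ (m n : ℕ) (u v : E), dist (forwardIterate χ (i + m) n u)
      (forwardIterate χ (i + m) n v) ≤ L m n * dist u v) (n : ℕ) (u : E) :
    dist (forwardIterate χ i n u) (d (i + n)) ≤ L 0 n * dist u (d i) +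
      ∑ m ∈ Finset.range n,
        L (m + 1) (n - 1 - m) * dist (χ (i + m) (d (i + m))) (d (i + m + 1)) := by
  have hstart : dist (forwardIterate χ i n u) (forwardIterate χ i n (d i)) ≤
      L 0 n * dist u (d i) := by
    simpa using hL 0 n u (d i)
  have htele := dist_le_range_sum_dist
    (fun m : ℕ => forwardIterate χ (i + m) (n - m) (d (i + m))) n
  simp only [Nat.cast_zero, add_zero, Nat.sub_zero, Nat.sub_self, forwardIterate_zero, id] at htele
  refine (dist_triangle _ (forwardIterate χ i n (d i)) _).trans
    (add_le_add hstart (htele.trans (Finset.sum_le_sum fun m hm => ?_)))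
  have hm' : n - m = n - 1 - m + 1 := by have := Finset.mem_range.1 hm; omega
  have hm'' : n - (m + 1) = n - 1 - m := by omega
  rw [hm', hm'', forwardIterate_succ', Function.comp_apply]
  have := hL (m + 1) (n - 1 - m) (χ (i + m) (d (i + m))) (d (i + m + 1))
  push_cast at this ⊢
  rwa [← add_assoc] at this ⊢

theorem natCast_mul_exp_neg_le {δ : ℝ} (hδ : 0 < δ) (η : ℝ) (n : ℕ) :
    n * Real.exp (-(η - δ) * n) ≤ Real.exp (-(η - 2 * δ) * n) / δ :=
  calc n * Real.exp (-(η - δ) * n) ≤ Real.exp (δ * n) / δ * Real.exp (-(η - δ) * n) := by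
        gcongr
        rw [le_div_iff₀ hδ]
        linarith [Real.add_one_le_exp (δ * n)]
    _ = Real.exp (-(η - 2 * δ) * n) / δ := by
        rw [div_mul_eq_mul_div, ← Real.exp_add]
        ring_nf

theorem sum_exp_mul_exp_le {ε η δ c : ℝ} (hη : η ≤ ε) (hδ : 0 < δ) (n : ℕ) :
    ∑ m ∈ Finset.range n, Real.exp (-ε * (n - 1 - m : ℕ) + δ * (c + (m + 1 : ℕ))) *
        Real.exp (-η * m + δ * c) ≤
      Real.exp η / δ * Real.exp (-(η - 2 * δ) * n + 2 * δ * c) := by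
  have hterm : ∀ m ∈ Finset.range n,
      Real.exp (-ε * (n - 1 - m : ℕ) + δ * (c + (m + 1 : ℕ))) * Real.exp (-η * m + δ * c) ≤
        Real.exp (η + 2 * δ * c) * Real.exp (-(η - δ) * n) := by
    intro m hm
    obtain ⟨k, rfl⟩ := Nat.exists_eq_add_of_lt (Finset.mem_range.1 hm)
    rw [add_tsub_cancel_right, add_tsub_cancel_left, ← Real.exp_add, ← Real.exp_add,
      Real.exp_le_exp]
    push_cast
    nlinarith [(Nat.cast_nonneg k : (0 : ℝ) ≤ k)]
  calc _ ≤ ∑ _m ∈ Finset.range n, Real.exp (η + 2 * δ * c) * Real.exp (-(η - δ) * n) :=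
        Finset.sum_le_sum hterm
    _ = Real.exp (η + 2 * δ * c) * (n * Real.exp (-(η - δ) * n)) := by
        rw [Finset.sum_const, Finset.card_range, nsmul_eq_mul]
        ring
    _ ≤ Real.exp (η + 2 * δ * c) * (Real.exp (-(η - 2 * δ) * n) / δ) := by
        gcongr
        exact natCast_mul_exp_neg_le hδ η n
    _ = _ := by
        rw [Real.exp_add, Real.exp_add]
        ring

theorem dist_forwardIterate_le_exp {u : E} {ε η δ C₁ C₂ C₃ : ℝ} (hη : η ≤ ε) (hδ : 0 < δ)
    (hC₁ : 0 ≤ C₁) (hC₂ : 0 ≤ C₂)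
    (hL : ∀ (m n : ℕ) (u v : E), dist (forwardIterate χ (i + m) n u)
      (forwardIterate χ (i + m) n v) ≤
        C₁ * Real.exp (-ε * n + δ * |((i + m : ℤ) : ℝ)|) * dist u v)
    (hd : ∀ m : ℕ, dist (χ (i + m) (d (i + m))) (d (i + m + 1)) ≤
      C₂ * Real.exp (-η * m + δ * |(i : ℝ)|))
    (hu : dist u (d i) ≤ C₃ * Real.exp (δ * |(i : ℝ)|)) (n : ℕ) :
    dist (forwardIterate χ i n u) (d (i + n)) ≤
      (C₁ * C₃ + C₁ * C₂ * Real.exp η / δ) *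
        Real.exp (-(η - 2 * δ) * n + 2 * δ * |(i : ℝ)|) := by
  set c := |(i : ℝ)|
  have hC₃ : 0 ≤ C₃ := nonneg_of_mul_nonneg_left (dist_nonneg.trans hu) (Real.exp_pos _)
  refine (dist_forwardIterate_le_sum χ i d hL n u).trans ?_
  rw [add_mul]
  refine add_le_add ?_ ?_
  · calc _ ≤ C₁ * Real.exp (-ε * n + δ * c) * (C₃ * Real.exp (δ * c)) := by
          simp only [Nat.cast_zero, add_zero]
          gcongr
      _ = C₁ * C₃ * Real.exp (-ε * n + 2 * δ * c) := by
          rw [mul_mul_mul_comm, ← Real.exp_add]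
          ring_nf
      _ ≤ C₁ * C₃ * Real.exp (-(η - 2 * δ) * n + 2 * δ * c) := by
          gcongr
          nlinarith [(Nat.cast_nonneg n : (0 : ℝ) ≤ n)]
  · calc _ ≤ ∑ m ∈ Finset.range n, C₁ * Real.exp (-ε * (n - 1 - m : ℕ) + δ * (c + (m + 1 : ℕ))) *
            (C₂ * Real.exp (-η * m + δ * c)) := by
          refine Finset.sum_le_sum fun m _ => ?_
          gcongr
          exacts [abs_add_natCast_le i (m + 1), hd m]
      _ = C₁ * C₂ * ∑ m ∈ Finset.range n,
            Real.exp (-ε * (n - 1 - m : ℕ) + δ * (c + (m + 1 : ℕ))) *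
              Real.exp (-η * m + δ * c) := by
          rw [Finset.mul_sum]
          exact Finset.sum_congr rfl fun m _ => mul_mul_mul_comm _ _ _ _
      _ ≤ C₁ * C₂ * (Real.exp η / δ * Real.exp (-(η - 2 * δ) * n + 2 * δ * c)) := by
          gcongr
          exact sum_exp_mul_exp_le hη hδ n
      _ = _ := by ring

end Perturbation

section LipConst

variable {E : Type*} [MetricSpace E]

theorem edist_le_lipConst_mul (φ : E → E) (x y : E) :
    edist (φ x) (φ y) ≤ lipConst φ * edist x y := by
  by_cases hxy : x = y
  · simp [hxy]
  · rw [← ENNReal.div_le_iff (by simpa using hxy) (edist_ne_top x y)]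
    exact le_iSup₂_of_le x y (le_iSup_of_le hxy le_rfl)

theorem edist_div_edist_le {φ : E → E} {c : ℝ≥0∞} {x y : E}
    (h : edist (φ x) (φ y) ≤ c * edist x y) : edist (φ x) (φ y) / edist x y ≤ c := by
  by_cases hxy : x = y
  · simp [hxy]
  · exact (ENNReal.div_le_iff (by simpa using hxy) (edist_ne_top x y)).2 h

theorem lipConst_le {φ : E → E} {c : ℝ≥0∞} (h : ∀ x y, edist (φ x) (φ y) ≤ c * edist x y) :
    lipConst φ ≤ c :=
  iSup₂_le fun x y => iSup_le fun _ => edist_div_edist_le (h x y)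

theorem lipConst_comp_le (φ ψ : E → E) : lipConst (φ ∘ ψ) ≤ lipConst φ * lipConst ψ :=
  lipConst_le fun x y => by
    rw [mul_assoc]
    exact (edist_le_lipConst_mul φ _ _).trans (by gcongr; exact edist_le_lipConst_mul ψ x y)

theorem lipConst_id_le : lipConst (id : E → E) ≤ 1 := lipConst_le fun x y => by simp

theorem lipConst_forwardIterate_add_le (φ : ℤ → E → E) (i : ℤ) (m n : ℕ) :
    lipConst (forwardIterate φ i (m + n)) ≤
      lipConst (forwardIterate φ (i + m) n) * lipConst (forwardIterate φ i m) := by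
  rw [forwardIterate_add]
  exact lipConst_comp_le _ _

theorem lipConst_eq_iSup_of_denseRange {ι : Type*} {e : ι → E} (he : DenseRange e) {φ : E → E}
    (hφ : Continuous φ) :
    lipConst φ = ⨆ mn : ι × ι, edist (φ (e mn.1)) (φ (e mn.2)) / edist (e mn.1) (e mn.2) := by
  set c := ⨆ mn : ι × ι, edist (φ (e mn.1)) (φ (e mn.2)) / edist (e mn.1) (e mn.2)
  refine le_antisymm (lipConst_le fun x y => ?_)
    (iSup_le fun mn => edist_div_edist_le (edist_le_lipConst_mul φ _ _))
  by_cases hct : c = ⊤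
  · by_cases hxy : x = y
    · simp [hxy]
    · rw [hct, ENNReal.top_mul (by simpa using hxy)]
      exact le_top
  have hclosed : IsClosed {z : E × E | edist (φ z.1) (φ z.2) ≤ c * edist z.1 z.2} :=
    isClosed_le (by fun_prop) ((ENNReal.continuous_const_mul hct).comp (by fun_prop))
  refine (he.prodMap he).induction_on
    (p := fun z : E × E => edist (φ z.1) (φ z.2) ≤ c * edist z.1 z.2) (x, y) hclosed
    fun mn => ?_
  by_cases hmn : e mn.1 = e mn.2
  · simp [hmn]
  · rw [← ENNReal.div_le_iff (by simpa using hmn) (edist_ne_top _ _)]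
    exact le_iSup_of_le mn le_rfl

end LipConst

/-! ### The ergodic theorem for two-sided sequences -/

section MaximalErgodic

variable {α : Type*}

/-- The maximum of `0` and the first `n` Birkhoff sums of `f`. -/
def birkhoffMax (T : α → α) (f : α → ℝ) : ℕ → α → ℝ
  | 0 => 0
  | n + 1 => fun x => max 0 (f x + birkhoffMax T f n (T x))

theorem birkhoffMax_succ (T : α → α) (f : α → ℝ) (n : ℕ) (x : α) :
    birkhoffMax T f (n + 1) x = max 0 (f x + birkhoffMax T f n (T x)) := rfl

theorem birkhoffMax_nonneg (T : α → α) (f : α → ℝ) (n : ℕ) (x : α) : 0 ≤ birkhoffMax T f n x := by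
  cases n with
  | zero => exact le_rfl
  | succ n => exact le_max_left _ _

theorem birkhoffMax_mono (T : α → α) (f : α → ℝ) (x : α) :
    Monotone fun n => birkhoffMax T f n x := by
  refine monotone_nat_of_le_succ fun n => ?_
  induction n generalizing x with
  | zero => exact birkhoffMax_nonneg T f 1 x
  | succ n ih => exact max_le_max le_rfl (by gcongr; exact ih (T x))

theorem birkhoffSum_le_birkhoffMax (T : α → α) (f : α → ℝ) (n : ℕ) (x : α) :
    birkhoffSum T f n x ≤ birkhoffMax T f n x := by
  induction n generalizing x with
  | zero => simp [birkhoffMax]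
  | succ n ih =>
    rw [birkhoffSum_succ']
    exact (by gcongr; exact ih (T x) : _ ≤ f x + birkhoffMax T f n (T x)).trans (le_max_right _ _)

theorem bddAbove_birkhoffMax_apply_iff (T : α → α) (f : α → ℝ) (x : α) :
    BddAbove (Set.range fun n => birkhoffMax T f n (T x)) ↔
      BddAbove (Set.range fun n => birkhoffMax T f n x) := by
  constructor
  · rintro ⟨B, hB⟩
    refine ⟨max 0 (f x + B), Set.forall_mem_range.2 fun n => ?_⟩
    calc birkhoffMax T f n x ≤ birkhoffMax T f (n + 1) x := birkhoffMax_mono T f x n.le_succ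
      _ ≤ max 0 (f x + B) := by
          rw [birkhoffMax_succ]
          gcongr
          exact hB ⟨n, rfl⟩
  · rintro ⟨B, hB⟩
    refine ⟨B - f x, Set.forall_mem_range.2 fun n => le_sub_iff_add_le'.2 ?_⟩
    calc f x + birkhoffMax T f n (T x) ≤ birkhoffMax T f (n + 1) x := le_max_right _ _
      _ ≤ B := hB ⟨n + 1, rfl⟩

theorem max_neg_birkhoffMax_eq_sub (T : α → α) (f : α → ℝ) (n : ℕ) (x : α) :
    max (-birkhoffMax T f n (T x)) (f x) =
      birkhoffMax T f (n + 1) x - birkhoffMax T f n (T x) := by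
  rw [birkhoffMax_succ, ← max_sub_sub_right, zero_sub, add_sub_cancel_right]

variable [MeasurableSpace α] {μ : Measure α} {T : α → α} {f : α → ℝ}

theorem measurable_birkhoffMax (hT : Measurable T) (hf : Measurable f) (n : ℕ) :
    Measurable (birkhoffMax T f n) := by
  induction n with
  | zero => exact measurable_const
  | succ n ih => exact measurable_const.max (hf.add (ih.comp hT))

theorem integrable_birkhoffMax [IsFiniteMeasure μ] (hT : MeasurePreserving T μ μ)
    (hf : Integrable f μ) (n : ℕ) : Integrable (birkhoffMax T f n) μ := by
  induction n with
  | zero => exact integrable_zero _ _ _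
  | succ n ih =>
    exact (integrable_const (0 : ℝ)).sup (hf.add (hT.integrable_comp_of_integrable ih))

theorem integral_max_neg_birkhoffMax_nonneg [IsFiniteMeasure μ] (hT : MeasurePreserving T μ μ)
    (hf : Integrable f μ) (n : ℕ) :
    0 ≤ ∫ x, max (-birkhoffMax T f n (T x)) (f x) ∂μ := by
  have hmax := integrable_birkhoffMax hT hf
  have hintT : Integrable (fun x => birkhoffMax T f n (T x)) μ :=
    hT.integrable_comp_of_integrable (hmax n)
  have hcomp : ∫ x, birkhoffMax T f n (T x) ∂μ = ∫ x, birkhoffMax T f n x ∂μ := by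
    rw [← integral_map hT.measurable.aemeasurable
      (by rw [hT.map_eq]; exact (hmax n).aestronglyMeasurable), hT.map_eq]
  simp_rw [max_neg_birkhoffMax_eq_sub]
  rw [integral_sub (hmax _) hintT, hcomp, sub_nonneg]
  exact integral_mono (hmax _) (hmax _) fun x => birkhoffMax_mono T f x n.le_succ

theorem tendsto_integral_max_neg_birkhoffMax [IsFiniteMeasure μ] (hT : MeasurePreserving T μ μ)
    (hf : Integrable f μ)
    (hunbdd : ∀ᵐ x ∂μ, ¬ BddAbove (Set.range fun n => birkhoffMax T f n x)) :
    Tendsto (fun n => ∫ x, max (-birkhoffMax T f n (T x)) (f x) ∂μ) atTop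
      (𝓝 (∫ x, f x ∂μ)) := by
  refine tendsto_integral_of_dominated_convergence (fun x => |f x|)
    (fun n => ?_) hf.abs (fun n => Eventually.of_forall fun x => ?_) ?_
  · exact ((hT.integrable_comp_of_integrable (integrable_birkhoffMax hT hf n)).neg.sup
      hf).aestronglyMeasurable
  · refine abs_le.2 ⟨(neg_abs_le _).trans (le_max_right _ _), max_le ?_ (le_abs_self _)⟩
    exact (neg_nonpos.2 (birkhoffMax_nonneg T f n (T x))).trans (abs_nonneg _)
  · filter_upwards [hunbdd] with x hx
    rw [← bddAbove_birkhoffMax_apply_iff, not_bddAbove_iff] at hx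
    obtain ⟨_, ⟨N, rfl⟩, hN⟩ := hx (-f x)
    refine tendsto_const_nhds.congr' ?_
    filter_upwards [eventually_ge_atTop N] with n hn
    exact (max_eq_right (neg_le.1 (hN.le.trans (birkhoffMax_mono T f (T x) hn)))).symm

-- Garsia's argument: were the maxima `M_n` unbounded, `∫ max (-M_n ∘ T) f ≥ 0` would tend to `∫ f`.
theorem ae_bddAbove_birkhoffMax [IsFiniteMeasure μ] (hT : Ergodic T μ) (hfm : Measurable f)
    (hf : Integrable f μ) (hneg : ∫ x, f x ∂μ < 0) :
    ∀ᵐ x ∂μ, BddAbove (Set.range fun n => birkhoffMax T f n x) := by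
  have hmeas : MeasurableSet {x | BddAbove (Set.range fun n => birkhoffMax T f n x)} :=
    measurableSet_bddAbove_range fun n => measurable_birkhoffMax hT.measurable hfm n
  refine (hT.toPreErgodic.ae_mem_or_ae_notMem hmeas
    (Set.ext fun x => bddAbove_birkhoffMax_apply_iff T f x)).resolve_right fun hunbdd => ?_
  exact hneg.not_ge <| ge_of_tendsto'
    (tendsto_integral_max_neg_birkhoffMax hT.toMeasurePreserving hf hunbdd)
    (integral_max_neg_birkhoffMax_nonneg hT.toMeasurePreserving hf)

theorem ae_exists_birkhoffSum_le [IsProbabilityMeasure μ] (hT : Ergodic T μ) (hfm : Measurable f)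
    (hf : Integrable f μ) {δ : ℝ} (hδ : 0 < δ) :
    ∀ᵐ x ∂μ, ∃ C, ∀ n : ℕ, birkhoffSum T f n x ≤ n * ∫ x, f x ∂μ + (C + δ * n) := by
  set c := ∫ x, f x ∂μ
  have hneg : ∫ x, (f x - (c + δ)) ∂μ < 0 := by
    rw [integral_sub hf (integrable_const _)]
    simp [c, hδ]
  filter_upwards [ae_bddAbove_birkhoffMax hT (hfm.sub_const _) (hf.sub (integrable_const _)) hneg]
    with x ⟨C, hC⟩
  refine ⟨C, fun n => ?_⟩
  have hle := (birkhoffSum_le_birkhoffMax T (fun x => f x - (c + δ)) n x).trans (hC ⟨n, rfl⟩)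
  simp only [birkhoffSum, Finset.sum_sub_distrib, Finset.sum_const, Finset.card_range,
    nsmul_eq_mul] at hle ⊢
  linarith

theorem ae_exists_abs_birkhoffSum_sub_le [IsProbabilityMeasure μ] (hT : Ergodic T μ)
    (hfm : Measurable f) (hf : Integrable f μ) :
    ∀ᵐ x ∂μ, ∀ δ > 0, ∃ C, ∀ n : ℕ, |birkhoffSum T f n x - n * ∫ x, f x ∂μ| ≤ C + δ * n := by
  have hrational : ∀ k : ℕ, ∀ᵐ x ∂μ, ∃ C, ∀ n : ℕ,
      |birkhoffSum T f n x - n * ∫ x, f x ∂μ| ≤ C + 1 / ((k : ℝ) + 1) * n := by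
    intro k
    have hk : (0 : ℝ) < 1 / ((k : ℝ) + 1) := by positivity
    filter_upwards [ae_exists_birkhoffSum_le hT hfm hf hk,
      ae_exists_birkhoffSum_le hT hfm.neg hf.neg hk] with x ⟨C, hC⟩ ⟨C', hC'⟩
    refine ⟨max C C', fun n => abs_le.2 ⟨?_, ?_⟩⟩
    · have := hC' n
      simp only [birkhoffSum, Pi.neg_apply, Finset.sum_neg_distrib, integral_neg] at this ⊢
      linarith [le_max_right C C']
    · linarith [hC n, le_max_left C C']
  filter_upwards [ae_all_iff.2 hrational] with x hx δ hδ
  obtain ⟨k, hk⟩ := exists_nat_one_div_lt hδ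
  obtain ⟨C, hC⟩ := hx k
  exact ⟨C, fun n => (hC n).trans (by gcongr)⟩

end MaximalErgodic

section Primitive

/-- The primitive of a two-sided sequence: `primitive a 0 = 0` and
`primitive a (k + 1) = primitive a k + a k` for all `k : ℤ`. -/
noncomputable def primitive (a : ℤ → ℝ) (k : ℤ) : ℝ :=
  ∑ i ∈ Finset.Ico 0 k, a i - ∑ i ∈ Finset.Ico k 0, a i

theorem primitive_zero (a : ℤ → ℝ) : primitive a 0 = 0 := by simp [primitive]

theorem primitive_add_one (a : ℤ → ℝ) (k : ℤ) : primitive a (k + 1) = primitive a k + a k := by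
  rcases le_or_gt 0 k with hk | hk
  · rw [primitive, primitive, ← Finset.insert_Ico_right_eq_Ico_add_one hk,
      Finset.sum_insert (by simp), Finset.Ico_eq_empty_of_le hk,
      Finset.Ico_eq_empty_of_le (hk.trans (Int.le_add_one le_rfl))]
    ring
  · rw [primitive, primitive, ← Finset.insert_Ico_add_one_left_eq_Ico hk,
      Finset.sum_insert (by simp), Finset.Ico_eq_empty_of_le hk.le,
      Finset.Ico_eq_empty_of_le (Int.add_one_le_iff.2 hk)]
    ring

theorem primitive_natCast (a : ℤ → ℝ) (n : ℕ) :
    primitive a n = ∑ i ∈ Finset.range n, a i := by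
  induction n with
  | zero => simp [primitive_zero]
  | succ n ih => rw [Nat.cast_succ, primitive_add_one, ih, Finset.sum_range_succ]

theorem primitive_neg_natCast (a : ℤ → ℝ) (n : ℕ) :
    primitive a (-n) = -∑ i ∈ Finset.range n, a (-1 + -i) := by
  induction n with
  | zero => simp [primitive_zero]
  | succ n ih =>
    have hstep := primitive_add_one a (-1 + -n)
    rw [show -1 + -(n : ℤ) + 1 = -n by ring, ih] at hstep
    rw [Finset.sum_range_succ, Nat.cast_succ, neg_add_rev, neg_add, hstep]
    ring

end Primitive

section Shift

variable {E : Type*}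

/-- The shift by `k` on two-sided sequences. -/
def shiftBy (k : ℤ) (x : ℤ → E) : ℤ → E := fun t => x (t + k)

@[simp] theorem shiftBy_zero (x : ℤ → E) : shiftBy 0 x = x :=
  funext fun t => congrArg x (add_zero t)

theorem shiftBy_shiftBy (k l : ℤ) (x : ℤ → E) : shiftBy k (shiftBy l x) = shiftBy (k + l) x :=
  funext fun t => congrArg x (by ring)

theorem shiftBy_iterate (k : ℤ) (n : ℕ) (x : ℤ → E) : (shiftBy k)^[n] x = shiftBy (n * k) x := by
  induction n with
  | zero => simp
  | succ n ih =>
    rw [Function.iterate_succ_apply', ih, shiftBy_shiftBy]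
    push_cast
    ring_nf

variable [MeasurableSpace E]

theorem measurable_shiftBy (k : ℤ) : Measurable (shiftBy k : (ℤ → E) → ℤ → E) :=
  measurable_pi_lambda _ fun t => measurable_pi_apply (t + k)

/-- The left shift as a measurable automorphism of the path space. -/
def shiftEquiv (E : Type*) [MeasurableSpace E] : (ℤ → E) ≃ᵐ (ℤ → E) where
  toFun := shiftSeq
  invFun := shiftBy (-1)
  left_inv x := (shiftBy_shiftBy (-1) 1 x).trans (shiftBy_zero x)
  right_inv x := (shiftBy_shiftBy 1 (-1) x).trans (shiftBy_zero x)
  measurable_toFun := measurable_shiftBy 1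
  measurable_invFun := measurable_shiftBy (-1)

variable {μ : Measure (ℤ → E)}

theorem ergodic_shiftBy_neg_one (h : Ergodic shiftSeq μ) : Ergodic (shiftBy (-1)) μ :=
  Ergodic.symm (e := shiftEquiv E) h

theorem measurePreserving_shiftBy (h : MeasurePreserving shiftSeq μ μ) (k : ℤ) :
    MeasurePreserving (shiftBy k) μ μ := by
  have hright : MeasurePreserving (shiftBy 1) μ μ := h
  have hleft : MeasurePreserving (shiftBy (-1)) μ μ := MeasurePreserving.symm (shiftEquiv E) h
  rcases Int.eq_nat_or_neg k with ⟨n, rfl | rfl⟩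
  · simpa only [funext (shiftBy_iterate 1 n), mul_one] using hright.iterate n
  · simpa only [funext (shiftBy_iterate (-1) n), mul_neg_one] using hleft.iterate n

theorem ae_exists_abs_primitive_sub_le [IsProbabilityMeasure μ] (h : Ergodic shiftSeq μ)
    {f : (ℤ → E) → ℝ} (hfm : Measurable f) (hf : Integrable f μ) :
    ∀ᵐ x ∂μ, ∀ δ > 0, ∃ C, ∀ k : ℤ,
      |primitive (fun i => f (shiftBy i x)) k - k * ∫ x, f x ∂μ| ≤ C + δ * |(k : ℝ)| := by
  have hpres := measurePreserving_shiftBy h.toMeasurePreserving (-1 : ℤ)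
  have hmean : ∫ x, f (shiftBy (-1) x) ∂μ = ∫ x, f x ∂μ := by
    rw [← integral_map hpres.measurable.aemeasurable hfm.aestronglyMeasurable, hpres.map_eq]
  have hforward := ae_exists_abs_birkhoffSum_sub_le (T := shiftBy 1) h hfm hf
  have hbackward := ae_exists_abs_birkhoffSum_sub_le (ergodic_shiftBy_neg_one h)
    (hfm.comp hpres.measurable) (hpres.integrable_comp_of_integrable hf)
  filter_upwards [hforward, hbackward] with x hx hx' δ hδ
  simp only [birkhoffSum, Function.comp_apply, shiftBy_iterate, mul_one, mul_neg_one,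
    shiftBy_shiftBy, hmean] at hx hx'
  obtain ⟨C, hC⟩ := hx δ hδ
  obtain ⟨C', hC'⟩ := hx' δ hδ
  refine ⟨max C C', fun k => ?_⟩
  rcases Int.eq_nat_or_neg k with ⟨n, rfl | rfl⟩
  · simpa only [primitive_natCast, Int.cast_natCast, Nat.abs_cast] using
      (hC n).trans (by gcongr; exact le_max_left C C')
  · rw [primitive_neg_natCast, Int.cast_neg, abs_neg, neg_mul, neg_sub_neg, abs_sub_comm]
    simpa only [Int.cast_natCast, Nat.abs_cast] using
      (hC' n).trans (by gcongr; exact le_max_right C C')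

end Shift

/-! ### Logarithmic moments and contraction on average -/

section LogMoments

theorem measurable_logPlus : Measurable logPlus :=
  EReal.continuous_toENNReal.measurable.comp ENNReal.measurable_log

theorem measurable_logMinus : Measurable logMinus :=
  EReal.continuous_toENNReal.measurable.comp ENNReal.measurable_log.neg

theorem logPlus_eq_top_iff {y : ℝ≥0∞} : logPlus y = ⊤ ↔ y = ⊤ := by
  simp [logPlus]

theorem logPlus_of_le_one {y : ℝ≥0∞} (h : y ≤ 1) : logPlus y = 0 := by
  simpa [logPlus, EReal.toENNReal_eq_zero_iff] using h

theorem logMinus_of_one_le {y : ℝ≥0∞} (h : 1 ≤ y) : logMinus y = 0 := by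
  simpa [logMinus, EReal.toENNReal_eq_zero_iff, EReal.neg_le] using h

theorem logPlus_of_one_le {y : ℝ≥0∞} (h : 1 ≤ y) (h' : y ≠ ⊤) :
    logPlus y = ENNReal.ofReal (Real.log y.toReal) := by
  rw [logPlus, ENNReal.log_pos_real (by rintro rfl; simp at h) h', EReal.real_coe_toENNReal]

theorem logMinus_of_ne {y : ℝ≥0∞} (h : y ≠ 0) (h' : y ≠ ⊤) :
    logMinus y = ENNReal.ofReal (-Real.log y.toReal) := by
  rw [logMinus, ENNReal.log_pos_real h h', ← EReal.coe_neg, EReal.real_coe_toENNReal]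

theorem toReal_le_exp_logPlus {y : ℝ≥0∞} (h : y ≠ ⊤) :
    y.toReal ≤ Real.exp (logPlus y).toReal := by
  rcases le_total y 1 with hy | hy
  · rw [logPlus_of_le_one hy]
    simpa using ENNReal.toReal_mono ENNReal.one_ne_top hy
  · have hy' : 1 ≤ y.toReal := by simpa using ENNReal.toReal_mono h hy
    rw [logPlus_of_one_le hy h, ENNReal.toReal_ofReal (Real.log_nonneg hy'),
      Real.exp_log (by linarith)]

theorem toReal_le_exp_logPlus_sub {y : ℝ≥0∞} (h : y ≠ ⊤) (N : ℕ) :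
    y.toReal ≤ Real.exp ((logPlus y).toReal - (min (logMinus y) N).toReal) := by
  rcases le_total 1 y with hy | hy
  · rw [logMinus_of_one_le hy]
    simpa using toReal_le_exp_logPlus h
  rw [logPlus_of_le_one hy, ENNReal.toReal_zero, zero_sub]
  rcases eq_or_ne y 0 with rfl | h0
  · simpa using (Real.exp_pos _).le
  have hpos := ENNReal.toReal_pos h0 h
  have hle : y.toReal ≤ 1 := by simpa using ENNReal.toReal_mono ENNReal.one_ne_top hy
  rw [← Real.log_le_iff_le_exp hpos, le_neg, logMinus_of_ne h0 h]
  exact (ENNReal.toReal_mono ENNReal.ofReal_ne_top (min_le_left _ _)).trans_eq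
    (ENNReal.toReal_ofReal (neg_nonneg.2 (Real.log_nonpos hpos.le hle)))

variable {α : Type*} [MeasurableSpace α] {μ : Measure α}

theorem FiniteLogPlusMoment.congr {Y Y' : α → ℝ≥0∞} (hm : FiniteLogPlusMoment μ Y)
    (h : Y =ᵐ[μ] Y') : FiniteLogPlusMoment μ Y' := by
  rwa [FiniteLogPlusMoment, ← lintegral_congr_ae (h.mono fun x => congrArg logPlus)]

theorem NegativeLogMean.congr {Y Y' : α → ℝ≥0∞} (hm : NegativeLogMean μ Y) (h : Y =ᵐ[μ] Y') :
    NegativeLogMean μ Y' := by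
  rwa [NegativeLogMean, ← lintegral_congr_ae (h.mono fun x => congrArg logPlus),
    ← lintegral_congr_ae (h.mono fun x => congrArg logMinus)]

theorem finiteLogPlusMoment_map_iff {β : Type*} [MeasurableSpace β] {ξ : α → β}
    (hξ : Measurable ξ) {Y : β → ℝ≥0∞} (hY : Measurable Y) :
    FiniteLogPlusMoment (μ.map ξ) Y ↔ FiniteLogPlusMoment μ fun x => Y (ξ x) := by
  rw [FiniteLogPlusMoment, FiniteLogPlusMoment,
    lintegral_map (f := fun b => logPlus (Y b)) (measurable_logPlus.comp hY) hξ]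

theorem negativeLogMean_map_iff {β : Type*} [MeasurableSpace β] {ξ : α → β}
    (hξ : Measurable ξ) {Y : β → ℝ≥0∞} (hY : Measurable Y) :
    NegativeLogMean (μ.map ξ) Y ↔ NegativeLogMean μ fun x => Y (ξ x) := by
  rw [NegativeLogMean, NegativeLogMean,
    lintegral_map (f := fun b => logPlus (Y b)) (measurable_logPlus.comp hY) hξ,
    lintegral_map (f := fun b => logMinus (Y b)) (measurable_logMinus.comp hY) hξ]

theorem lintegral_eq_iSup_lintegral_min {f : α → ℝ≥0∞} (hf : Measurable f) :
    ∫⁻ x, f x ∂μ = ⨆ N : ℕ, ∫⁻ x, min (f x) N ∂μ := by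
  rw [← lintegral_iSup (fun N => hf.min measurable_const) fun M N hMN x =>
    min_le_min le_rfl (Nat.cast_le.2 hMN)]
  refine lintegral_congr fun x => ?_
  have h := inf_iSup_eq (f x) fun N : ℕ => (N : ℝ≥0∞)
  rwa [ENNReal.iSup_natCast, inf_top_eq] at h

-- Truncating `log⁻` makes the mean of `log Y` finite without losing its sign.
theorem NegativeLogMean.exists_integrable {Y : α → ℝ≥0∞} [IsFiniteMeasure μ] (hY : Measurable Y)
    (h : NegativeLogMean μ Y) :
    ∃ f : α → ℝ, Measurable f ∧ Integrable f μ ∧ ∫ x, f x ∂μ < 0 ∧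
      ∀ᵐ x ∂μ, Y x ≤ ENNReal.ofReal (Real.exp (f x)) := by
  have hp : Measurable fun x => logPlus (Y x) := measurable_logPlus.comp hY
  have hpt : ∫⁻ x, logPlus (Y x) ∂μ ≠ ⊤ := (lt_of_lt_of_le h le_top).ne
  obtain ⟨N, hN⟩ := lt_iSup_iff.1
    (h.trans_eq (lintegral_eq_iSup_lintegral_min (measurable_logMinus.comp hY)))
  have hm : Measurable fun x => min (logMinus (Y x)) (N : ℝ≥0∞) :=
    (measurable_logMinus.comp hY).min measurable_const
  have hmt : ∫⁻ x, min (logMinus (Y x)) N ∂μ ≠ ⊤ := by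
    refine ((lintegral_mono fun x => min_le_right _ _).trans_lt ?_).ne
    rw [lintegral_const]
    exact ENNReal.mul_lt_top (ENNReal.natCast_lt_top N) (measure_lt_top μ _)
  have hpi := integrable_toReal_of_lintegral_ne_top hp.aemeasurable hpt
  have hmi := integrable_toReal_of_lintegral_ne_top hm.aemeasurable hmt
  have hpf : ∀ᵐ x ∂μ, logPlus (Y x) < ⊤ := ae_lt_top hp hpt
  refine ⟨fun x => (logPlus (Y x)).toReal - (min (logMinus (Y x)) N).toReal,
    hp.ennreal_toReal.sub hm.ennreal_toReal, hpi.sub hmi, ?_, ?_⟩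
  · rw [integral_sub hpi hmi, integral_toReal hp.aemeasurable hpf,
      integral_toReal hm.aemeasurable (ae_lt_top hm hmt), sub_neg]
    exact (ENNReal.toReal_lt_toReal hpt hmt).2 hN
  · filter_upwards [hpf] with x hx
    have hYx : Y x ≠ ⊤ := fun h => hx.ne (logPlus_eq_top_iff.2 h)
    exact (ENNReal.le_ofReal_iff_toReal_le hYx (Real.exp_pos _).le).2
      (toReal_le_exp_logPlus_sub hYx N)

theorem tsum_int_natAbs_le (f : ℕ → ℝ≥0∞) (hf : Antitone f) :
    ∑' t : ℤ, f t.natAbs ≤ 2 * ∑' n, f n := by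
  rw [tsum_of_nat_of_neg_add_one ENNReal.summable ENNReal.summable, two_mul]
  gcongr with n n
  · simp
  · exact hf (by omega)

theorem ae_eventually_abs_le_of_identDistrib {y : ℤ → α → ℝ}
    (hid : ∀ t, IdentDistrib (y t) (y 0) μ μ) [IsProbabilityMeasure μ]
    (hy : Integrable (y 0) μ) {δ : ℝ} (hδ : 0 < δ) :
    ∀ᵐ ω ∂μ, ∀ᶠ t : ℤ in cofinite, |y t ω| ≤ δ * |(t : ℝ)| := by
  have hsum : ∑' j : ℕ, μ {ω | |y 0 ω| / δ ∈ Set.Ioi (j : ℝ)} < ∞ := by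
    let _ : MeasureSpace α := ⟨μ⟩
    exact tsum_prob_mem_Ioi_lt_top (hy.abs.div_const δ) fun ω => by positivity
  have hanti : Antitone fun j : ℕ => μ {ω | |y 0 ω| / δ ∈ Set.Ioi (j : ℝ)} := fun i j hij =>
    measure_mono fun ω (hω : (j : ℝ) < |y 0 ω| / δ) =>
      show (i : ℝ) < |y 0 ω| / δ from (Nat.cast_le.2 hij).trans_lt hω
  have htail : ∑' t : ℤ, μ {ω | |y t ω| / δ ∈ Set.Ioi (t.natAbs : ℝ)} ≠ ∞ := by
    refine ne_top_of_le_ne_top (ENNReal.mul_ne_top (by simp) hsum.ne)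
      ((ENNReal.tsum_le_tsum fun t => le_of_eq ?_).trans (tsum_int_natAbs_le _ hanti))
    exact ((hid t).comp (u := fun z => |z| / δ) (by fun_prop)).measure_mem_eq measurableSet_Ioi
  filter_upwards [ae_finite_setOfPred_mem htail] with ω hω
  filter_upwards [hω.compl_mem_cofinite] with t ht
  simpa [Nat.cast_natAbs, div_le_iff₀' hδ] using ht

theorem subexponential_of_eventually_le {a : ℤ → ℝ} (ha : ∀ t, 0 ≤ a t)
    (h : ∀ δ > 0, ∀ᶠ t : ℤ in cofinite, a t ≤ Real.exp (δ * |(t : ℝ)|)) : Subexponential a := by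
  intro δ hδ
  set s := (show {t : ℤ | ¬ a t ≤ Real.exp (δ * |(t : ℝ)|)}.Finite from h δ hδ).toFinset
  have hs : 0 ≤ ∑ t ∈ s, a t := Finset.sum_nonneg fun t _ => ha t
  refine ⟨1 + ∑ t ∈ s, a t, by positivity, fun t => ?_⟩
  have hexp : 1 ≤ Real.exp (δ * |(t : ℝ)|) := Real.one_le_exp (by positivity)
  by_cases ht : t ∈ s
  · have := Finset.single_le_sum (fun t _ => ha t) ht
    nlinarith
  · have : a t ≤ Real.exp (δ * |(t : ℝ)|) := by simpa [s] using ht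
    nlinarith

theorem ae_subexponential_of_finiteLogPlusMoment [IsProbabilityMeasure μ] {v : ℤ → α → ℝ≥0∞}
    (hid : ∀ t, IdentDistrib (v t) (v 0) μ μ) (h : FiniteLogPlusMoment μ (v 0)) :
    ∀ᵐ ω ∂μ, (∀ t, v t ω ≠ ⊤) ∧ Subexponential fun t => (v t ω).toReal := by
  have hlog : AEMeasurable (fun ω => logPlus (v 0 ω)) μ :=
    measurable_logPlus.comp_aemeasurable (hid 0).aemeasurable_fst
  have hfin : ∀ t, ∀ᵐ ω ∂μ, v t ω ≠ ⊤ := fun t => by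
    refine (hid t).symm.ae_snd (p := (· ≠ ⊤)) (measurableSet_singleton _).compl ?_
    filter_upwards [ae_lt_top' hlog h.ne] with ω hω hω'
    exact hω.ne (logPlus_eq_top_iff.2 hω')
  have hgrowth : ∀ k : ℕ, ∀ᵐ ω ∂μ, ∀ᶠ t : ℤ in cofinite,
      |(logPlus (v t ω)).toReal| ≤ 1 / ((k : ℝ) + 1) * |(t : ℝ)| := fun k =>
    ae_eventually_abs_le_of_identDistrib
      (fun t => (hid t).comp (u := fun z => (logPlus z).toReal) measurable_logPlus.ennreal_toReal)
      (integrable_toReal_of_lintegral_ne_top hlog h.ne) (by positivity)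
  filter_upwards [ae_all_iff.2 hfin, ae_all_iff.2 hgrowth] with ω hω hk
  refine ⟨hω, subexponential_of_eventually_le (fun t => ENNReal.toReal_nonneg) fun δ hδ => ?_⟩
  obtain ⟨k, hkδ⟩ := exists_nat_one_div_lt hδ
  filter_upwards [hk k] with t ht
  calc (v t ω).toReal ≤ Real.exp (logPlus (v t ω)).toReal := toReal_le_exp_logPlus (hω t)
    _ ≤ Real.exp (δ * |(t : ℝ)|) :=
        Real.exp_le_exp.2 ((le_abs_self _).trans (ht.trans (by gcongr)))

theorem exists_subseq_exp_mul_tendsto_zero [IsFiniteMeasure μ] {y : ℕ → α → ℝ}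
    (hid : ∀ n, IdentDistrib (y n) (y 0) μ μ) {ε : ℝ} (hε : 0 < ε) :
    ∃ ns : ℕ → ℕ, StrictMono ns ∧
      ∀ᵐ ω ∂μ, Tendsto (fun k => Real.exp (-ε * ns k) * y (ns k) ω) atTop (𝓝 0) := by
  have hfixed : TendstoInMeasure μ (fun (n : ℕ) ω => Real.exp (-ε * n) * y 0 ω) atTop fun _ => 0 :=
    tendstoInMeasure_of_tendsto_ae
      (fun n => ((hid 0).aemeasurable_fst.const_mul _).aestronglyMeasurable)
      (Eventually.of_forall fun ω => by
        simpa using (tendsto_exp_neg_mul_natCast hε).mul_const (y 0 ω))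
  have hmoving : TendstoInMeasure μ (fun (n : ℕ) ω => Real.exp (-ε * n) * y n ω) atTop
      fun _ => 0 := fun a ha => (hfixed a ha).congr fun n =>
    ((hid n).measure_mem_eq (s := {z : ℝ | a ≤ edist (Real.exp (-ε * n) * z) 0})
      (measurableSet_le measurable_const (by fun_prop))).symm
  obtain ⟨ns, hns, h⟩ := hmoving.exists_seq_tendsto_ae
  exact ⟨ns, hns, h⟩

end LogMoments

theorem sum_range_eq_primitive_sub (f : ℤ → ℝ) (i : ℤ) (n : ℕ) :
    ∑ k ∈ Finset.range n, f (i + k) = primitive f (i + n) - primitive f i := by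
  induction n with
  | zero => simp
  | succ n ih =>
    rw [Finset.sum_range_succ, ih, Nat.cast_succ, ← add_assoc, primitive_add_one]
    ring

-- The sums over the `r` residue classes add up to the full sum, so one is at most the average.
theorem exists_offset_sum_le (f : ℤ → ℝ) {r : ℕ} (hr : 0 < r) (i : ℤ) (m : ℕ) :
    ∃ k < r, ∑ j ∈ Finset.range m, f (i + k + (r * j : ℕ)) ≤
      (primitive f (i + (r * m : ℕ)) - primitive f i) / r := by
  have htotal : ∑ k ∈ Finset.range r, ∑ j ∈ Finset.range m, f (i + k + (r * j : ℕ)) =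
      primitive f (i + (r * m : ℕ)) - primitive f i := by
    rw [Finset.sum_comm]
    induction m with
    | zero => simp
    | succ m ih =>
      rw [Finset.sum_range_succ, ih]
      simp_rw [add_right_comm i _ ((r * m : ℕ) : ℤ)]
      rw [sum_range_eq_primitive_sub, mul_add_one, Nat.cast_add, ← add_assoc]
      ring
  obtain ⟨k, hk, hle⟩ := Finset.exists_le_of_sum_le (s := Finset.range r)
    (f := fun k : ℕ => ∑ j ∈ Finset.range m, f (i + k + (r * j : ℕ)))
    (g := fun _ => (primitive f (i + (r * m : ℕ)) - primitive f i) / r) ⟨0, by simpa using hr⟩ (by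
      rw [htotal, Finset.sum_const, Finset.card_range, nsmul_eq_mul]
      field_simp
      rfl)
  exact ⟨k, Finset.mem_range.1 hk, hle⟩

theorem div_mul_natCast_le (c : ℝ) {r n N : ℕ} (hr : 0 < r) (hnN : n ≤ N) (hN : N ≤ n + 2 * r) :
    c / r * n ≤ c / r * N + 2 * |c| := by
  have hr0 : (0 : ℝ) < r := mod_cast hr
  have hdiff : |(n - N : ℝ)| ≤ 2 * r := by
    have hnN' : (n : ℝ) ≤ N := mod_cast hnN
    have hN' : (N : ℝ) ≤ n + 2 * r := mod_cast hN
    rw [abs_sub_comm, abs_of_nonneg] <;> linarith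
  suffices c / r * (n - N : ℝ) ≤ 2 * |c| by linarith
  calc c / r * (n - N : ℝ) ≤ |c / r| * |(n - N : ℝ)| := (le_abs_self _).trans (abs_mul _ _).le
    _ ≤ |c| / r * (2 * r) := by
      rw [abs_div, abs_of_pos hr0]
      gcongr
    _ = 2 * |c| := by field_simp

theorem primitive_sub_div_le {f : ℤ → ℝ} {c C δ : ℝ} (hδ : 0 ≤ δ)
    (hf : ∀ k : ℤ, |primitive f k - k * c| ≤ C + δ * |(k : ℝ)|) {r : ℕ} (hr : 0 < r) (i : ℤ)
    (n : ℕ) :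
    (primitive f (i + n) - primitive f i) / r ≤
      c / r * n + (2 * |C| + δ * (2 * |(i : ℝ)| + n)) := by
  have hr1 : (1 : ℝ) ≤ r := mod_cast hr
  have hi := neg_le_of_abs_le (hf i)
  have hin := le_of_abs_le (hf (i + n))
  have habs : δ * |((i + n : ℤ) : ℝ)| ≤ δ * (|(i : ℝ)| + n) :=
    mul_le_mul_of_nonneg_left (abs_add_natCast_le i n) hδ
  have hrest : 0 ≤ 2 * |C| + δ * (2 * |(i : ℝ)| + n) := by positivity
  have hcast : ((i + n : ℤ) : ℝ) * c = i * c + n * c := by push_cast; ring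
  rw [div_le_iff₀ (by positivity), add_mul, mul_right_comm, div_mul_cancel₀ _ (by positivity)]
  nlinarith [le_abs_self C, le_mul_of_one_le_right hrest hr1]

/-- `ℓ i n` is a bound for the growth of a cocycle over the `n` steps that start at time `i`;
the Lipschitz constants of iterates are the motivating example. -/
structure SubmultiplicativeCocycle (ℓ : ℤ → ℕ → ℝ) : Prop where
  nonneg : ∀ i n, 0 ≤ ℓ i n
  zero_le : ∀ i, ℓ i 0 ≤ 1
  add_le : ∀ i m n, ℓ i (m + n) ≤ ℓ (i + m) n * ℓ i m

namespace SubmultiplicativeCocycle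

variable {ℓ : ℤ → ℕ → ℝ}

theorem subexponential (hℓ : SubmultiplicativeCocycle ℓ) (h : Subexponential fun i => ℓ i 1)
    (n : ℕ) : Subexponential fun i => ℓ i n := by
  induction n with
  | zero => exact (Subexponential.const 1).mono hℓ.zero_le
  | succ n ih => exact ((h.shift n).mul ih fun i => hℓ.nonneg i n).mono fun i => hℓ.add_le i n 1

theorem block_le_exp (hℓ : SubmultiplicativeCocycle ℓ) {r : ℕ} {f : ℤ → ℝ}
    (hf : ∀ k, ℓ k r ≤ Real.exp (f k)) (i : ℤ) (m : ℕ) :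
    ℓ i (r * m) ≤ Real.exp (∑ j ∈ Finset.range m, f (i + (r * j : ℕ))) := by
  induction m with
  | zero => simpa using hℓ.zero_le i
  | succ m ih =>
    rw [Finset.sum_range_succ, add_comm (∑ j ∈ Finset.range m, _), Real.exp_add, mul_add_one]
    exact (hℓ.add_le _ _ _).trans
      (mul_le_mul (hf _) ih (hℓ.nonneg _ _) (Real.exp_pos _).le)

theorem le_mul_exp_primitive (hℓ : SubmultiplicativeCocycle ℓ) {r : ℕ} (hr : 0 < r) {f : ℤ → ℝ}
    (hf : ∀ k, ℓ k r ≤ Real.exp (f k)) (i : ℤ) (m s : ℕ) :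
    ∃ k < r, ℓ i (r * m + s + r) ≤ ℓ (i + (k + r * m : ℕ)) (r - k + s) *
      Real.exp ((primitive f (i + (r * m : ℕ)) - primitive f i) / r) * ℓ i k := by
  obtain ⟨k, hk, hle⟩ := exists_offset_sum_le f hr i m
  refine ⟨k, hk, ?_⟩
  calc ℓ i (r * m + s + r) = ℓ i (k + r * m + (r - k + s)) := by congr 1; omega
    _ ≤ ℓ (i + (k + r * m : ℕ)) (r - k + s) * ℓ i (k + r * m) := hℓ.add_le _ _ _
    _ ≤ ℓ (i + (k + r * m : ℕ)) (r - k + s) * (ℓ (i + k) (r * m) * ℓ i k) :=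
        mul_le_mul_of_nonneg_left (hℓ.add_le _ _ _) (hℓ.nonneg _ _)
    _ ≤ ℓ (i + (k + r * m : ℕ)) (r - k + s) *
          (Real.exp ((primitive f (i + (r * m : ℕ)) - primitive f i) / r) * ℓ i k) :=
        mul_le_mul_of_nonneg_left (mul_le_mul_of_nonneg_right
          ((hℓ.block_le_exp hf _ m).trans (Real.exp_le_exp.2 hle)) (hℓ.nonneg _ _)) (hℓ.nonneg _ _)
    _ = _ := (mul_assoc _ _ _).symm

theorem exists_le_exp_of_lt (hℓ : SubmultiplicativeCocycle ℓ) (h : Subexponential fun i => ℓ i 1)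
    (N : ℕ) {δ : ℝ} (hδ : 0 < δ) :
    ∃ C > 0, ∀ (i : ℤ), ∀ n < N, ℓ i n ≤ C * Real.exp (δ * |(i : ℝ)|) := by
  obtain ⟨C, hC, hle⟩ := Subexponential.sum (Finset.range N) (hℓ.subexponential h) δ hδ
  exact ⟨C, hC, fun i n hn => (Finset.single_le_sum (f := fun n => ℓ i n)
    (fun n _ => hℓ.nonneg i n) (Finset.mem_range.2 hn)).trans (hle i)⟩

theorem le_of_two_mul_le (hℓ : SubmultiplicativeCocycle ℓ) {r : ℕ} (hr : 0 < r) {f : ℤ → ℝ}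
    (hf : ∀ k, ℓ k r ≤ Real.exp (f k)) {c δ C₁ C₂ : ℝ} (hδ : 0 ≤ δ) (hC₁ : 0 ≤ C₁)
    (hshort : ∀ i, ∀ n < 2 * r, ℓ i n ≤ C₁ * Real.exp (δ * |(i : ℝ)|))
    (hprim : ∀ k : ℤ, |primitive f k - k * c| ≤ C₂ + δ * |(k : ℝ)|) (i : ℤ) {n : ℕ}
    (hn : 2 * r ≤ n) :
    ℓ i n ≤ C₁ ^ 2 *
      Real.exp (c / r * n + 2 * (|C₂| + |c|) + δ * (4 * |(i : ℝ)| + 2 * n)) := by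
  obtain ⟨m, s, hs, rfl⟩ : ∃ m s, s < r ∧ n = r * m + s + r :=
    ⟨(n - r) / r, (n - r) % r, Nat.mod_lt _ hr, by rw [Nat.div_add_mod]; omega⟩
  obtain ⟨k, hk, hle⟩ := hℓ.le_mul_exp_primitive hr hf i m s
  have hend : ℓ (i + (k + r * m : ℕ)) (r - k + s) ≤
      C₁ * Real.exp (δ * (|(i : ℝ)| + (r * m + s + r : ℕ))) := by
    refine (hshort _ _ (by omega)).trans ?_
    have hle : ((k + r * m : ℕ) : ℝ) ≤ (r * m + s + r : ℕ) := mod_cast (by omega)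
    gcongr
    exact (abs_add_natCast_le _ _).trans (by gcongr)
  have hmid := primitive_sub_div_le hδ hprim hr i (r * m)
  have hlength := div_mul_natCast_le c hr (n := r * m) (N := r * m + s + r) (by omega) (by omega)
  calc _ ≤ _ := hle
    _ ≤ C₁ * Real.exp (δ * (|(i : ℝ)| + (r * m + s + r : ℕ))) *
        Real.exp (c / r * (r * m : ℕ) + (2 * |C₂| + δ * (2 * |(i : ℝ)| + (r * m : ℕ)))) *
        (C₁ * Real.exp (δ * |(i : ℝ)|)) := by
      gcongr
      · exact hℓ.nonneg _ _
      · exact hshort i k (by omega)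
    _ = C₁ ^ 2 * Real.exp (δ * (|(i : ℝ)| + (r * m + s + r : ℕ)) +
        (c / r * (r * m : ℕ) + (2 * |C₂| + δ * (2 * |(i : ℝ)| + (r * m : ℕ)))) +
        δ * |(i : ℝ)|) := by
      rw [Real.exp_add (_ + _), Real.exp_add (δ * (_ + _))]
      ring
    _ ≤ _ := by
      gcongr ?_ * Real.exp ?_
      have hrm : δ * (r * m : ℕ) ≤ δ * (r * m + s + r : ℕ) := by
        gcongr
        omega
      linarith

theorem exists_le_exp (hℓ : SubmultiplicativeCocycle ℓ) (h1 : Subexponential fun i => ℓ i 1)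
    {r : ℕ} (hr : 0 < r) {f : ℤ → ℝ} (hf : ∀ k, ℓ k r ≤ Real.exp (f k)) {c : ℝ}
    (hgrow : ∀ δ > 0, ∃ C, ∀ k : ℤ, |primitive f k - k * c| ≤ C + δ * |(k : ℝ)|) {ε δ : ℝ}
    (hε : 0 < ε) (hc : ε < -c / r) (hδ : 0 < δ) :
    ∃ C > 0, ∀ (i : ℤ) (n : ℕ), ℓ i n ≤ C * Real.exp (-ε * n + δ * |(i : ℝ)|) := by
  obtain ⟨η, hη, hηδ, hηε⟩ : ∃ η > 0, 4 * η ≤ δ ∧ 2 * η ≤ -c / r - ε :=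
    ⟨min δ (-c / r - ε) / 4, by have := sub_pos.2 hc; positivity,
      by linarith [min_le_left δ (-c / r - ε)],
      by linarith [min_le_right δ (-c / r - ε), sub_pos.2 hc]⟩
  obtain ⟨C₁, hC₁, hshort⟩ := hℓ.exists_le_exp_of_lt h1 (2 * r) hη
  obtain ⟨C₂, hprim⟩ := hgrow η hη
  refine ⟨max (C₁ * Real.exp (2 * r * ε)) (C₁ ^ 2 * Real.exp (2 * (|C₂| + |c|))),
    lt_max_of_lt_left (by positivity), fun i n => ?_⟩
  have hi : 0 ≤ |(i : ℝ)| := abs_nonneg _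
  rcases lt_or_ge n (2 * r) with hn' | hn'
  · have hnr : (n : ℝ) ≤ 2 * r := mod_cast hn'.le
    refine (hshort i n hn').trans (le_trans ?_ (mul_le_mul_of_nonneg_right (le_max_left _ _)
      (Real.exp_pos _).le))
    rw [mul_assoc, ← Real.exp_add]
    gcongr
    nlinarith
  · refine (hℓ.le_of_two_mul_le hr hf hη.le hC₁.le hshort hprim i hn').trans ?_
    refine le_trans ?_ (mul_le_mul_of_nonneg_right (le_max_right _ _) (Real.exp_pos _).le)
    rw [mul_assoc, ← Real.exp_add]
    gcongr _ * Real.exp ?_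
    have hcr : -c / r = -(c / r) := neg_div _ _
    nlinarith

end SubmultiplicativeCocycle

section AverageContraction

variable {F : Type*} [MetricSpace F] {φ : ℤ → F → F}

theorem lipConst_forwardIterate_ne_top (h : ∀ t, lipConst (φ t) ≠ ⊤) (i : ℤ) (n : ℕ) :
    lipConst (forwardIterate φ i n) ≠ ⊤ := by
  induction n with
  | zero => exact (lipConst_id_le.trans_lt ENNReal.one_lt_top).ne
  | succ n ih =>
    exact ((lipConst_forwardIterate_add_le φ i n 1).trans_lt
      (ENNReal.mul_lt_top (by simpa only [forwardIterate_one] using (h _).lt_top) ih.lt_top)).ne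

theorem submultiplicativeCocycle_lipConst (h : ∀ t, lipConst (φ t) ≠ ⊤) :
    SubmultiplicativeCocycle fun i n => (lipConst (forwardIterate φ i n)).toReal where
  nonneg _ _ := ENNReal.toReal_nonneg
  zero_le _ := ENNReal.toReal_le_of_le_ofReal zero_le_one (by simpa using lipConst_id_le)
  add_le i m n := by
    rw [← ENNReal.toReal_mul]
    exact ENNReal.toReal_mono (ENNReal.mul_ne_top (lipConst_forwardIterate_ne_top h _ _)
      (lipConst_forwardIterate_ne_top h _ _)) (lipConst_forwardIterate_add_le φ i m n)

theorem dist_le_lipConst_mul {f : F → F} (hf : lipConst f ≠ ⊤) (u v : F) :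
    dist (f u) (f v) ≤ (lipConst f).toReal * dist u v := by
  have := ENNReal.toReal_mono (ENNReal.mul_ne_top hf (edist_ne_top u v))
    (edist_le_lipConst_mul f u v)
  rwa [ENNReal.toReal_mul, ← dist_edist, ← dist_edist] at this

theorem contractsExp_of_lipConst_le_exp (h : ∀ t, lipConst (φ t) ≠ ⊤)
    (hsub : Subexponential fun t => (lipConst (φ t)).toReal) {r : ℕ} (hr : 0 < r) {f : ℤ → ℝ}
    (hf : ∀ k, lipConst (forwardIterate φ k r) ≤ ENNReal.ofReal (Real.exp (f k))) {c : ℝ}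
    (hgrow : ∀ δ > 0, ∃ C, ∀ k : ℤ, |primitive f k - k * c| ≤ C + δ * |(k : ℝ)|) {ε : ℝ}
    (hε : 0 < ε) (hc : ε < -c / r) : ContractsExp φ ε := by
  intro δ hδ
  obtain ⟨C, hC, hle⟩ := (submultiplicativeCocycle_lipConst h).exists_le_exp
    (by simpa only [forwardIterate_one] using hsub) hr
    (fun k => ENNReal.toReal_le_of_le_ofReal (Real.exp_pos _).le (hf k)) hgrow hε hc hδ
  exact ⟨C, hC, fun i n u v => (dist_le_lipConst_mul (lipConst_forwardIterate_ne_top h i n)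
    u v).trans (mul_le_mul_of_nonneg_right (hle i n) dist_nonneg)⟩

variable {E : Type*} [MeasurableSpace E] {μ : Measure (ℤ → E)}

theorem identDistrib_comp_shiftBy (hμ : MeasurePreserving shiftSeq μ μ) {β : Type*}
    [MeasurableSpace β] {g : (ℤ → E) → β} (hg : AEMeasurable g μ) (k : ℤ) :
    IdentDistrib (fun x => g (shiftBy k x)) g μ μ := by
  have h := measurePreserving_shiftBy hμ k
  have hg' : AEMeasurable g (μ.map (shiftBy k)) := by rwa [h.map_eq]
  refine ⟨hg'.comp_aemeasurable h.measurable.aemeasurable, hg, ?_⟩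
  rw [← Function.comp_def, ← AEMeasurable.map_map_of_aemeasurable hg' h.measurable.aemeasurable,
    h.map_eq]

theorem ae_contractsExp [IsProbabilityMeasure μ] (hμ : Ergodic shiftSeq μ)
    {Φ : (ℤ → E) → ℤ → F → F}
    (hΦ : ∀ k x t, Φ (shiftBy k x) t = Φ x (t + k))
    (hmeas : ∀ i n, Measurable fun x => lipConst (forwardIterate (Φ x) i n))
    (hlip : FiniteLogPlusMoment μ fun x => lipConst (Φ x 0))
    {r : ℕ} (hr : 1 ≤ r) (hcontr : NegativeLogMean μ fun x => lipConst (pastIterate (Φ x) 0 r)) :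
    ∃ ε > 0, ∀ᵐ x ∂μ, ContractsExp (Φ x) ε := by
  have hiter : ∀ k x i, forwardIterate (Φ (shiftBy k x)) i r = forwardIterate (Φ x) (i + k) r :=
    fun k x i => by rw [funext (hΦ k x), forwardIterate_shift]
  have hmeas1 : Measurable fun x => lipConst (Φ x 0) := by
    simpa only [forwardIterate_one] using hmeas 0 1
  have hcontr' : NegativeLogMean μ fun x => lipConst (forwardIterate (Φ x) 0 r) := by
    have hshift := measurePreserving_shiftBy hμ.toMeasurePreserving (r - 1)
    simp_rw [pastIterate_eq_forwardIterate] at hcontr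
    rw [← hshift.map_eq, negativeLogMean_map_iff hshift.measurable (hmeas _ r)] at hcontr
    simpa only [hiter, zero_sub, neg_add_cancel_comm_assoc, neg_add_eq_sub, sub_add_sub_cancel,
      sub_self, zero_add] using hcontr
  obtain ⟨f, hfm, hfi, hfneg, hfle⟩ := hcontr'.exists_integrable (hmeas 0 r)
  have hrate : 0 < -(∫ x, f x ∂μ) / r := div_pos (neg_pos.2 hfneg) (by positivity)
  refine ⟨-(∫ x, f x ∂μ) / r / 2, half_pos hrate, ?_⟩
  have hsub : ∀ᵐ x ∂μ, (∀ t, lipConst (Φ x t) ≠ ⊤) ∧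
      Subexponential fun t => (lipConst (Φ x t)).toReal :=
    ae_subexponential_of_finiteLogPlusMoment (v := fun t x => lipConst (Φ x t)) (fun t => by
      simpa only [hΦ, zero_add] using
        identDistrib_comp_shiftBy hμ.toMeasurePreserving hmeas1.aemeasurable t) hlip
  have hle : ∀ᵐ x ∂μ, ∀ k, lipConst (forwardIterate (Φ x) k r) ≤
      ENNReal.ofReal (Real.exp (f (shiftBy k x))) := ae_all_iff.2 fun k => by
    simpa only [hiter, zero_add] using (measurePreserving_shiftBy hμ.toMeasurePreserving
      k).quasiMeasurePreserving.ae hfle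
  filter_upwards [hsub, hle, ae_exists_abs_primitive_sub_le hμ hfm hfi] with x hx hxle hgrow
  exact contractsExp_of_lipConst_le_exp hx.1 hx.2 hr hxle hgrow (half_pos hrate)
    (half_lt_self hrate)

end AverageContraction

/-! ### Measurability in spaces of continuous functions -/

section FunctionSpaceMeasurability

theorem measurable_of_measurable_dist {α Y : Type*} [MeasurableSpace α] [PseudoMetricSpace Y]
    [SecondCountableTopology Y] [MeasurableSpace Y] [BorelSpace Y] {f : α → Y}
    (h : ∀ y, Measurable fun a => dist (f a) y) : Measurable f := by
  refine measurable_of_isOpen fun U hU => ?_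
  choose! r hr₀ hr using Metric.isOpen_iff.1 hU
  obtain ⟨T, hT, hTU⟩ := TopologicalSpace.isOpen_iUnion_countable
    (fun y : U => Metric.ball (y : Y) (r y)) fun _ => Metric.isOpen_ball
  have hU' : U = ⋃ y : U, Metric.ball (y : Y) (r y) :=
    Set.Subset.antisymm
      (fun y hy => Set.mem_iUnion.2 ⟨⟨y, hy⟩, Metric.mem_ball_self (hr₀ y hy)⟩)
      (Set.iUnion_subset fun y => hr y y.2)
  rw [hU', ← hTU, Set.preimage_iUnion₂]
  exact MeasurableSet.biUnion hT fun y _ => measurableSet_lt (h y) measurable_const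

theorem measurable_continuousMap_of_eval {α X Y : Type*} [MeasurableSpace α] [TopologicalSpace X]
    [CompactSpace X] [TopologicalSpace.SeparableSpace X] [PseudoMetricSpace Y] [MeasurableSpace Y]
    [BorelSpace Y] [SecondCountableTopology C(X, Y)] {f : α → C(X, Y)}
    (h : ∀ x, Measurable fun a => f a x) : Measurable f := by
  obtain ⟨s, hs, hsd⟩ := TopologicalSpace.exists_countable_dense X
  refine measurable_of_measurable_dist fun g => measurable_of_Iic fun r => ?_
  rcases lt_or_ge r 0 with hr | hr
  · rw [Set.preimage_eq_empty]
    · exact MeasurableSet.empty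
    · rw [Set.disjoint_left]
      rintro _ ha ⟨a, rfl⟩
      exact (hr.trans_le dist_nonneg).not_ge ha
  have hball : (fun a => dist (f a) g) ⁻¹' Set.Iic r =
      ⋂ x ∈ s, {a | dist (f a x) (g x) ≤ r} := by
    ext a
    simp only [Set.mem_preimage, Set.mem_Iic, Set.mem_iInter, Set.mem_ofPred_eq,
      ContinuousMap.dist_le hr]
    have hclosed : IsClosed {x | dist (f a x) (g x) ≤ r} := isClosed_le (by fun_prop) (by fun_prop)
    exact ⟨fun H x _ => H x, fun H x => closure_minimal H hclosed (hsd x)⟩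
  rw [hball]
  exact MeasurableSet.biInter hs fun x _ =>
    (measurableSet_closedBall (x := g x) (ε := r)).preimage (h x)

theorem measurable_clm_of_apply {α V W : Type*} [MeasurableSpace α] [NormedAddCommGroup V]
    [NormedSpace ℝ V] [FiniteDimensional ℝ V] [NormedAddCommGroup W] [NormedSpace ℝ W]
    [SecondCountableTopology W] [MeasurableSpace W] [BorelSpace W] {f : α → V →L[ℝ] W}
    (h : ∀ v, Measurable fun a => f a v) : Measurable f := by
  let e₁ : V ≃L[ℝ] Fin (Module.finrank ℝ V) → ℝ :=
    ContinuousLinearEquiv.ofFinrankEq (Module.finrank_fin_fun ℝ).symm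
  let e₂ := (e₁.arrowCongr (1 : W ≃L[ℝ] W)).trans (ContinuousLinearEquiv.piRing (Fin _))
  have he₂ : Measurable fun a => e₂ (f a) := measurable_pi_lambda _ fun i => h _
  simpa only [Function.comp_def, ContinuousLinearEquiv.symm_apply_apply] using
    e₂.symm.continuous.measurable.comp he₂

end FunctionSpaceMeasurability

section ClosedDifferentiability

variable {V W : Type*} [NormedAddCommGroup V] [NormedSpace ℝ V] [NormedAddCommGroup W]
  [NormedSpace ℝ W] {S : Set V} {f : V → W}

theorem derivOn_eq_of_hasFDerivAt (hS : S ⊆ closure (interior S)) {D : V → V →L[ℝ] W}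
    (hD : ContinuousOn D S) (h : ∀ x ∈ interior S, HasFDerivAt f (D x) x) {x : V} (hx : x ∈ S) :
    derivOn S f x = D x := by
  refine extendFrom_eq (hS hx) ?_
  refine ((hD x hx).mono_left (nhdsWithin_mono x interior_subset)).congr' ?_
  filter_upwards [self_mem_nhdsWithin] with y hy
  exact (h y hy).fderiv.symm

theorem C1On.continuousOn_derivOn (hf : C1On S f) (hS : S ⊆ closure (interior S)) :
    ContinuousOn (derivOn S f) S := by
  obtain ⟨-, D, hD, h⟩ := hf
  exact hD.congr fun x hx => derivOn_eq_of_hasFDerivAt hS hD h hx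

theorem C1On.hasFDerivAt_derivOn (hf : C1On S f) (hS : S ⊆ closure (interior S)) {x : V}
    (hx : x ∈ interior S) : HasFDerivAt f (derivOn S f x) x := by
  obtain ⟨-, D, hD, h⟩ := hf
  rw [derivOn_eq_of_hasFDerivAt hS hD h (interior_subset hx)]
  exact h x hx

theorem C1On.euclidean {n : ℕ} {f : Fin n → V → ℝ} (hf : ∀ j, C1On S (f j)) :
    C1On S fun z => (WithLp.toLp 2 fun j => f j z : Vec n) := by
  choose hc D hD h using hf
  let e := (EuclideanSpace.equiv (Fin n) ℝ).symm.toContinuousLinearMap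
  refine ⟨(PiLp.continuous_toLp 2 _).comp_continuousOn (continuousOn_pi.2 hc),
    fun z => e.comp (ContinuousLinearMap.pi fun j => D j z), ?_, fun x hx => ?_⟩
  · exact continuousOn_const.clm_comp
      ((ContinuousLinearMap.piEquivL ..).continuous.comp_continuousOn (continuousOn_pi.2 hD))
  · exact e.hasFDerivAt.comp x (hasFDerivAt_pi.2 fun j => h j x hx)

theorem c1On_clm (L : V →L[ℝ] W) : C1On S L :=
  ⟨L.continuous.continuousOn, fun _ => L, continuousOn_const, fun _ _ => L.hasFDerivAt⟩

variable {X : Type*} [MeasurableSpace X] [MeasurableSpace W] [BorelSpace W]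
  [SecondCountableTopology W] {F : X → V → W}

theorem measurable_derivOn_apply_of_mem_interior (hS : S ⊆ closure (interior S))
    (hF : ∀ x, C1On S (F x)) (hm : ∀ z ∈ S, Measurable fun x => F x z) {z : V}
    (hz : z ∈ interior S) (v : V) : Measurable fun x => derivOn S (F x) z v := by
  have hc : Tendsto (fun n : ℕ => (n : ℝ) + 1) atTop atTop :=
    tendsto_atTop_add_const_right _ _ tendsto_natCast_atTop_atTop
  have hin : ∀ᶠ n : ℕ in atTop, z + ((n : ℝ) + 1)⁻¹ • v ∈ S := by
    have hlim : Tendsto (fun n : ℕ => z + ((n : ℝ) + 1)⁻¹ • v) atTop (𝓝 (z + (0 : ℝ) • v)) :=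
      tendsto_const_nhds.add ((tendsto_inv_atTop_zero.comp hc).smul_const v)
    rw [zero_smul, add_zero] at hlim
    exact hlim (mem_interior_iff_mem_nhds.1 hz)
  obtain ⟨N, hN⟩ := eventually_atTop.1 hin
  refine measurable_of_tendsto_metrizable (f := fun (n : ℕ) (x : X) =>
    (((n + N : ℕ) : ℝ) + 1) • (F x (z + (((n + N : ℕ) : ℝ) + 1)⁻¹ • v) - F x z)) (fun n =>
      ((hm _ (hN _ (by omega))).sub (hm z (interior_subset hz))).const_smul _)
    (tendsto_pi_nhds.2 fun x => ?_)
  have hquot := ((hF x).hasFDerivAt_derivOn hS hz).lim v (c := fun n : ℕ => (n : ℝ) + 1)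
    (l := atTop) (tendsto_norm_atTop_atTop.comp hc)
  exact hquot.comp (tendsto_add_atTop_nat N)

theorem measurable_derivOn_apply (hS : S ⊆ closure (interior S)) (hF : ∀ x, C1On S (F x))
    (hm : ∀ z ∈ S, Measurable fun x => F x z) {z : V} (hz : z ∈ S) (v : V) :
    Measurable fun x => derivOn S (F x) z v := by
  obtain ⟨w, hw, hlim⟩ := mem_closure_iff_seq_limit.1 (hS hz)
  refine measurable_of_tendsto_metrizable (f := fun n x => derivOn S (F x) (w n) v)
    (fun n => measurable_derivOn_apply_of_mem_interior hS hF hm (hw n) v)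
    (tendsto_pi_nhds.2 fun x => ?_)
  have hD : Tendsto (fun n => derivOn S (F x) (w n)) atTop (𝓝 (derivOn S (F x) z)) :=
    ((hF x).continuousOn_derivOn hS z hz).tendsto.comp
      (tendsto_nhdsWithin_iff.2 ⟨hlim, Eventually.of_forall fun n => interior_subset (hw n)⟩)
  exact ((ContinuousLinearMap.apply ℝ W v).continuous.tendsto _).comp hD

end ClosedDifferentiability

section Orthant

variable (q : ℕ)

theorem isClosed_orthant : IsClosed (orthant q) := by
  simp only [orthant, Set.ofPred_forall]
  exact isClosed_iInter fun j => isClosed_le continuous_const (by fun_prop)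

theorem convex_orthant : Convex ℝ (orthant q) := fun u hu v hv a b ha hb _ j => by
  simpa using add_nonneg (mul_nonneg ha (hu j)) (mul_nonneg hb (hv j))

theorem closure_interior_orthant : closure (interior (orthant q)) = orthant q := by
  have hopen : IsOpen {u : Vec q | ∀ j, 0 < u j} := by
    simp only [Set.ofPred_forall]
    exact isOpen_iInter_of_finite fun j => isOpen_lt continuous_const (by fun_prop)
  rw [(convex_orthant q).closure_interior_eq_closure_of_nonempty_interior,
    (isClosed_orthant q).closure_eq]
  exact ⟨WithLp.toLp 2 fun _ => 1,
    interior_maximal (fun u hu j => (hu j).le) hopen fun _ => one_pos⟩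

end Orthant

/-- The limit as `n → ∞` of the backward iterates `φ_{t-1} ∘ ⋯ ∘ φ_{t-n}(o)`; a junk value where
they diverge. -/
noncomputable def backwardLimit {E : Type*} [TopologicalSpace E] (φ : ℤ → E → E) (o : E) (t : ℤ) :
    E :=
  have : Nonempty E := ⟨o⟩
  limUnder atTop fun n : ℕ => forwardIterate φ (t - n) n o

section BackwardLimit

theorem backwardLimit_shift {E : Type*} [TopologicalSpace E] (φ : ℤ → E → E) (o : E)
    (k t : ℤ) : backwardLimit (fun t => φ (t + k)) o t = backwardLimit φ o (t + k) := by
  simp only [backwardLimit, forwardIterate_shift, sub_add_eq_add_sub]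

variable {E Ω : Type*} [MeasurableSpace E] [MeasurableSpace Ω] {φ : Ω → ℤ → E → E}

theorem measurable_forwardIterate {i : ℤ} {n : ℕ}
    (hφ : ∀ k < i + n, Measurable fun z : E × Ω => φ z.2 k z.1) (o : E) :
    Measurable fun ω => forwardIterate (φ ω) i n o := by
  induction n with
  | zero => exact measurable_const
  | succ n ih =>
    push_cast at hφ
    exact (hφ (i + n) (by omega)).comp ((ih fun k hk => hφ k (by omega)).prodMk measurable_id)

theorem measurable_backwardLimit [MetricSpace E] [CompleteSpace E] [SecondCountableTopology E]
    [BorelSpace E] {t : ℤ}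
    (hφ : ∀ k < t, Measurable fun z : E × Ω => φ z.2 k z.1) (o : E) :
    Measurable fun ω => backwardLimit (φ ω) o t :=
  have : Nonempty E := ⟨o⟩
  (StronglyMeasurable.limUnder fun n : ℕ => (measurable_forwardIterate
    (i := t - n) (n := n) (fun k hk => hφ k (by omega)) o).stronglyMeasurable).measurable

end BackwardLimit

section GraphComp

variable {X V W : Type*} [TopologicalSpace X] [NormedAddCommGroup V] [NormedSpace ℝ V]
  [NormedAddCommGroup W] [NormedSpace ℝ W]

theorem continuous_id_prod :
    Continuous fun e : V →L[ℝ] W => (ContinuousLinearMap.id ℝ V).prod e :=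
  (ContinuousLinearMap.prodₗᵢ ℝ).continuous.comp (continuous_const.prodMk continuous_id)

/-- The family of linear maps `v ↦ A_x(v, e_x v)`: the chain rule for `x ↦ f(x, s(x))`, where `A_x`
is the derivative of `f` at `(x, s(x))` and `e_x` that of `s` at `x`. -/
noncomputable def graphComp (A : C(X, V × W →L[ℝ] W)) (e : C(X, V →L[ℝ] W)) : C(X, V →L[ℝ] W) where
  toFun x := (A x).comp ((ContinuousLinearMap.id ℝ V).prod (e x))
  continuous_toFun := by
    exact A.continuous.clm_comp (continuous_id_prod.comp e.continuous)

theorem graphComp_apply (A : C(X, V × W →L[ℝ] W)) (e : C(X, V →L[ℝ] W)) (x : X) :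
    graphComp A e x = (A x).comp ((ContinuousLinearMap.id ℝ V).prod (e x)) := rfl

theorem continuous_graphComp [LocallyCompactSpace X] :
    Continuous fun z : C(X, V × W →L[ℝ] W) × C(X, V →L[ℝ] W) => graphComp z.1 z.2 := by
  refine ContinuousMap.continuous_of_continuous_uncurry _ ?_
  have hA : Continuous fun y : (C(X, V × W →L[ℝ] W) × C(X, V →L[ℝ] W)) × X => y.1.1 y.2 := by
    fun_prop
  have he : Continuous fun y : (C(X, V × W →L[ℝ] W) × C(X, V →L[ℝ] W)) × X => y.1.2 y.2 := by
    fun_prop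
  exact hA.clm_comp (continuous_id_prod.comp he)

theorem graphComp_sub (A : C(X, V × W →L[ℝ] W)) (e e' : C(X, V →L[ℝ] W)) (x : X) :
    graphComp A e x - graphComp A e' x =
      ((A x).comp (ContinuousLinearMap.inr ℝ V W)).comp (e x - e' x) := by
  refine ContinuousLinearMap.ext fun v => ?_
  change A x (v, e x v) - A x (v, e' x v) = A x (0, e x v - e' x v)
  rw [← map_sub, Prod.mk_sub_mk, sub_self]

end GraphComp

/-- `(x_t, x_{t-1}, …, x_{t-p+1})`. -/
def pathLags (p : ℕ) (x : ℤ → ℝ) (t : ℤ) : Fin p → ℝ := fun i => x (t - (i : ℕ))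

theorem pathLags_shiftBy (p : ℕ) (k : ℤ) (x : ℤ → ℝ) (t : ℤ) :
    pathLags p (shiftBy k x) t = pathLags p x (t + k) := by
  ext i
  simp only [pathLags, shiftBy, sub_add_eq_add_sub]

theorem measurable_pathLags {Ω : Type*} [MeasurableSpace Ω] {Y : Ω → ℤ → ℝ} (p : ℕ) {t : ℤ}
    (hY : ∀ k ≤ t, Measurable fun ω => Y ω k) : Measurable fun ω => pathLags p (Y ω) t :=
  measurable_pi_lambda _ fun _ => hY _ (by omega)

namespace VolatilityFamily

variable {d p q : ℕ} {M : VolatilityFamily d p q} {K : TopologicalSpace.Compacts (Vec d)}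

theorem isClosed_nonnegFun (K : TopologicalSpace.Compacts (Vec d)) (q : ℕ) :
    IsClosed {s : C(K, Vec q) | ∀ θ, s θ ∈ orthant q} := by
  rw [Set.ofPred_forall]
  exact isClosed_iInter fun θ => (isClosed_orthant q).preimage (by fun_prop)

instance instCompleteSpaceNonnegFun : CompleteSpace (NonnegFun K q) :=
  (isClosed_nonnegFun K q).completeSpace_coe

instance instNonemptyNonnegFun : Nonempty (NonnegFun K q) :=
  ⟨constFun K ⟨0, fun _ => le_rfl⟩⟩

theorem continuous_graph :
    Continuous fun z : NonnegFun K q × K => ((z.2 : Vec d), z.1.1 z.2) := by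
  have heval : Continuous fun z : C(K, Vec q) × K => z.1 z.2 := continuous_eval
  exact (continuous_subtype_val.comp continuous_snd).prodMk
    (heval.comp ((continuous_subtype_val.comp continuous_fst).prodMk continuous_snd))

namespace IsRegularOn

theorem prod_subset_closure_interior (hM : M.IsRegularOn K) :
    (K : Set (Vec d)) ×ˢ orthant q ⊆ closure (interior ((K : Set (Vec d)) ×ˢ orthant q)) := by
  rw [interior_prod_eq, closure_prod_eq, hM.closure_interior, closure_interior_orthant]

theorem c1_psi (hM : M.IsRegularOn K) (x : Fin p → ℝ) :
    C1On ((K : Set (Vec d)) ×ˢ orthant q) (M.psi x) := by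
  refine C1On.euclidean fun j => ?_
  by_cases hj : (j : ℕ) = 0
  · simpa only [hj, if_true] using hM.c1 x
  · simp only [hj, if_false]
    exact c1On_clm ((EuclideanSpace.proj (⟨(j : ℕ) - 1, by omega⟩ : Fin q)).comp
      (ContinuousLinearMap.snd ℝ (Vec d) (Vec q)))

theorem measurable_psi (hM : M.IsRegularOn K) {z : Vec d × Vec q}
    (hz : z ∈ (K : Set (Vec d)) ×ˢ orthant q) : Measurable fun x => M.psi x z := by
  refine (WithLp.measurable_toLp 2 _).comp (measurable_pi_lambda _ fun j => ?_)
  by_cases hj : (j : ℕ) = 0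
  · simpa only [hj, if_true] using
      M.measurable z.1 (interior_subset (hM.subset_interior hz.1)) z.2 hz.2
  · simp only [hj, if_false]
    exact measurable_const

theorem continuousOn_derivOn_psi (hM : M.IsRegularOn K) (x : Fin p → ℝ) :
    ContinuousOn (derivOn ((K : Set (Vec d)) ×ˢ orthant q) (M.psi x))
      ((K : Set (Vec d)) ×ˢ orthant q) :=
  (hM.c1_psi x).continuousOn_derivOn hM.prod_subset_closure_interior

/-- The derivative of `(θ, u) ↦ ψ(θ, u)` along the graph of `s`. -/
noncomputable def grad (hM : M.IsRegularOn K) (x : Fin p → ℝ) (s : NonnegFun K q) :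
    C(K, Vec d × Vec q →L[ℝ] Vec q) where
  toFun θ := derivOn ((K : Set (Vec d)) ×ˢ orthant q) (M.psi x) (θ, s.1 θ)
  continuous_toFun := (hM.continuousOn_derivOn_psi x).comp_continuous
    (continuous_graph.comp (Continuous.prodMk_right s)) fun θ => ⟨θ.2, s.2 θ⟩

theorem grad_apply (hM : M.IsRegularOn K) (x : Fin p → ℝ) (s : NonnegFun K q) (θ : K) :
    hM.grad x s θ = derivOn ((K : Set (Vec d)) ×ˢ orthant q) (M.psi x) (θ, s.1 θ) := rfl

theorem continuous_Phi (hM : M.IsRegularOn K) (x : Fin p → ℝ) : Continuous (hM.Phi x) := by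
  refine Continuous.subtype_mk (ContinuousMap.continuous_of_continuous_uncurry _ ?_) _
  exact (hM.c1_psi x).1.comp_continuous continuous_graph fun z => ⟨z.2.2, z.1.2 z.2⟩

theorem continuous_grad (hM : M.IsRegularOn K) (x : Fin p → ℝ) : Continuous (hM.grad x) :=
  ContinuousMap.continuous_of_continuous_uncurry _
    ((hM.continuousOn_derivOn_psi x).comp_continuous continuous_graph
      fun z => ⟨z.2.2, z.1.2 z.2⟩)

theorem measurable_Phi (hM : M.IsRegularOn K) :
    Measurable fun z : NonnegFun K q × (Fin p → ℝ) => hM.Phi z.2 z.1 :=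
  measurable_uncurry_of_continuous_of_measurable hM.continuous_Phi fun s =>
    (measurable_continuousMap_of_eval fun θ => hM.measurable_psi ⟨θ.2, s.2 θ⟩).subtype_mk

theorem measurable_grad (hM : M.IsRegularOn K) :
    Measurable fun z : NonnegFun K q × (Fin p → ℝ) => hM.grad z.2 z.1 := by
  refine measurable_uncurry_of_continuous_of_measurable
    (u := fun (s : NonnegFun K q) (x : Fin p → ℝ) => hM.grad x s) hM.continuous_grad fun s => ?_
  refine measurable_continuousMap_of_eval fun θ => measurable_clm_of_apply fun v => ?_
  exact measurable_derivOn_apply hM.prod_subset_closure_interior hM.c1_psi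
    (fun z hz => hM.measurable_psi hz) ⟨θ.2, s.2 θ⟩ v

attribute [irreducible] IsRegularOn.grad

/-- `Φ_t` as a function of the path of the observations. -/
noncomputable def pathPhi (hM : M.IsRegularOn K) (x : ℤ → ℝ) (t : ℤ) :
    NonnegFun K q → NonnegFun K q :=
  hM.Phi (pathLags p x t)

/-- The action of `Φ_t` on derivatives: where `h_t` has derivative `e`, the function `Φ_t(h_t)` has
derivative `pathStep x h t e`. -/
noncomputable def pathStep (hM : M.IsRegularOn K) (x : ℤ → ℝ) (h : ℤ → NonnegFun K q) (t : ℤ) :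
    C(K, Vec d →L[ℝ] Vec q) → C(K, Vec d →L[ℝ] Vec q) :=
  graphComp (hM.grad (pathLags p x t) (h t))

/-- The solution of `h_{t+1} = Φ_t(h_t)` along the path `x`, as the limit of the backward iterates
of `Φ` started in `o`. -/
noncomputable def limitSol (hM : M.IsRegularOn K) (o : NonnegFun K q) (x : ℤ → ℝ) :
    ℤ → NonnegFun K q :=
  backwardLimit (hM.pathPhi x) o

/-- The derivative of `limitSol`, as the limit of the backward iterates of the derivative recursion
along `limitSol`. -/
noncomputable def limitDeriv (hM : M.IsRegularOn K) (o : NonnegFun K q) (x : ℤ → ℝ) :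
    ℤ → C(K, Vec d →L[ℝ] Vec q) :=
  backwardLimit (hM.pathStep x (hM.limitSol o x)) 0

theorem pathPhi_shiftBy (hM : M.IsRegularOn K) (k : ℤ) (x : ℤ → ℝ) (t : ℤ) :
    hM.pathPhi (shiftBy k x) t = hM.pathPhi x (t + k) := by
  rw [pathPhi, pathLags_shiftBy, pathPhi]

theorem limitSol_shiftBy (hM : M.IsRegularOn K) (o : NonnegFun K q) (k : ℤ) (x : ℤ → ℝ) (t : ℤ) :
    hM.limitSol o (shiftBy k x) t = hM.limitSol o x (t + k) := by
  rw [limitSol, funext (hM.pathPhi_shiftBy k x), backwardLimit_shift, limitSol]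

theorem pathStep_limitSol_shiftBy (hM : M.IsRegularOn K) (o : NonnegFun K q) (k : ℤ) (x : ℤ → ℝ)
    (t : ℤ) : hM.pathStep (shiftBy k x) (hM.limitSol o (shiftBy k x)) t =
      hM.pathStep x (hM.limitSol o x) (t + k) := by
  rw [pathStep, pathLags_shiftBy, limitSol_shiftBy, pathStep]

theorem limitDeriv_shiftBy (hM : M.IsRegularOn K) (o : NonnegFun K q) (k : ℤ) (x : ℤ → ℝ) (t : ℤ) :
    hM.limitDeriv o (shiftBy k x) t = hM.limitDeriv o x (t + k) := by
  rw [limitDeriv, funext (hM.pathStep_limitSol_shiftBy o k x), backwardLimit_shift, limitDeriv]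

section Measurability

variable {Ω : Type*} [MeasurableSpace Ω] {Y : Ω → ℤ → ℝ} {t : ℤ}

theorem measurable_pathPhi (hM : M.IsRegularOn K) (hY : ∀ k ≤ t, Measurable fun ω => Y ω k) :
    Measurable fun z : NonnegFun K q × Ω => hM.pathPhi (Y z.2) t z.1 :=
  hM.measurable_Phi.comp
    (measurable_fst.prodMk ((measurable_pathLags p hY).comp measurable_snd))

theorem measurable_limitSol (hM : M.IsRegularOn K) (o : NonnegFun K q)
    (hY : ∀ k < t, Measurable fun ω => Y ω k) : Measurable fun ω => hM.limitSol o (Y ω) t :=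
  measurable_backwardLimit (fun _ hk => hM.measurable_pathPhi fun _ hj => hY _ (hj.trans_lt hk)) o

theorem measurable_grad_limitSol (hM : M.IsRegularOn K) (o : NonnegFun K q)
    (hY : ∀ k ≤ t, Measurable fun ω => Y ω k) :
    Measurable fun ω => hM.grad (pathLags p (Y ω) t) (hM.limitSol o (Y ω) t) :=
  hM.measurable_grad.comp
    ((hM.measurable_limitSol o fun k hk => hY k hk.le).prodMk (measurable_pathLags p hY))

theorem measurable_limitDeriv (hM : M.IsRegularOn K) (o : NonnegFun K q)
    (hY : ∀ k < t, Measurable fun ω => Y ω k) : Measurable fun ω => hM.limitDeriv o (Y ω) t :=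
  measurable_backwardLimit (φ := fun ω => hM.pathStep (Y ω) (hM.limitSol o (Y ω)))
    (fun _ hk => continuous_graphComp.measurable.comp (((hM.measurable_grad_limitSol o fun _ hj =>
      hY _ (hj.trans_lt hk)).comp measurable_snd).prodMk measurable_fst)) 0

theorem continuous_forwardIterate_pathPhi (hM : M.IsRegularOn K) (x : ℤ → ℝ) (i : ℤ) (n : ℕ) :
    Continuous (forwardIterate (hM.pathPhi x) i n) := by
  induction n with
  | zero => exact continuous_id
  | succ n ih => exact (hM.continuous_Phi _).comp ih

theorem measurable_lipConst_forwardIterate (hM : M.IsRegularOn K) (i : ℤ) (n : ℕ) :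
    Measurable fun x : ℤ → ℝ => lipConst (forwardIterate (hM.pathPhi x) i n) := by
  simp_rw [fun x => lipConst_eq_iSup_of_denseRange
    (TopologicalSpace.denseRange_denseSeq (NonnegFun K q))
    (hM.continuous_forwardIterate_pathPhi x i n)]
  have hmeas (s : NonnegFun K q) : Measurable fun x => forwardIterate (hM.pathPhi x) i n s :=
    measurable_forwardIterate (fun _ _ => hM.measurable_pathPhi fun k _ => measurable_pi_apply k) s
  exact Measurable.iSup fun mn => ((hmeas _).edist (hmeas _)).div_const _

end Measurability

end IsRegularOn

end VolatilityFamily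

/-! ### Differentiation of orbits -/

theorem mapsTo_forwardIterate {E : Type*} {φ : ℤ → E → E} {S : Set E}
    (hφ : ∀ t, Set.MapsTo (φ t) S S) (i : ℤ) (n : ℕ) : Set.MapsTo (forwardIterate φ i n) S S := by
  induction n with
  | zero => exact Set.mapsTo_id S
  | succ n ih => exact (hφ _).comp ih

section IterateDeriv

variable {E : Type*} [NormedAddCommGroup E] [NormedSpace ℝ E]

/-- The derivative at `u` of `forwardIterate φ i n`, where `A t` is the derivative of `φ t`. -/
noncomputable def iterateDeriv (φ : ℤ → E → E) (A : ℤ → E → E →L[ℝ] E) (i : ℤ) : ℕ → E → E →L[ℝ] E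
  | 0, _ => ContinuousLinearMap.id ℝ E
  | n + 1, u => (A (i + n) (forwardIterate φ i n u)).comp (iterateDeriv φ A i n u)

variable {φ : ℤ → E → E} {A : ℤ → E → E →L[ℝ] E} {S : Set E}

theorem hasFDerivWithinAt_forwardIterate (hφ : ∀ t, Set.MapsTo (φ t) S S)
    (hA : ∀ t, ∀ u ∈ S, HasFDerivWithinAt (φ t) (A t u) S u) (i : ℤ) (n : ℕ) {u : E} (hu : u ∈ S) :
    HasFDerivWithinAt (forwardIterate φ i n) (iterateDeriv φ A i n u) S u := by
  induction n with
  | zero => exact hasFDerivWithinAt_id u S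
  | succ n ih =>
    have hmaps := mapsTo_forwardIterate hφ i n
    exact (hA (i + n) _ (hmaps hu)).comp u ih hmaps

theorem continuousOn_iterateDeriv (hφ : ∀ t, Set.MapsTo (φ t) S S)
    (hA : ∀ t, ∀ u ∈ S, HasFDerivWithinAt (φ t) (A t u) S u) (hAc : ∀ t, ContinuousOn (A t) S)
    (i : ℤ) (n : ℕ) : ContinuousOn (iterateDeriv φ A i n) S := by
  induction n with
  | zero => exact continuousOn_const
  | succ n ih =>
    have hF : ContinuousOn (forwardIterate φ i n) S := fun u hu =>
      (hasFDerivWithinAt_forwardIterate hφ hA i n hu).continuousWithinAt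
    exact ((hAc (i + n)).comp hF (mapsTo_forwardIterate hφ i n)).clm_comp ih

theorem norm_le_of_lipschitz_of_subset_closure_interior {F : Type*} [NormedAddCommGroup F]
    [NormedSpace ℝ F] {f : E → F} {J : E → E →L[ℝ] F} (hS : S ⊆ closure (interior S))
    (hJc : ContinuousOn J S) (hJ : ∀ u ∈ S, HasFDerivWithinAt f (J u) S u) {L : ℝ} (hL : 0 ≤ L)
    (hlip : ∀ u ∈ S, ∀ v ∈ S, ‖f u - f v‖ ≤ L * ‖u - v‖) {u : E} (hu : u ∈ S) : ‖J u‖ ≤ L := by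
  have hbound : ∀ v ∈ interior S, ‖J v‖ ≤ L := fun v hv => by
    have hn := mem_interior_iff_mem_nhds.1 hv
    refine ((hJ v (interior_subset hv)).hasFDerivAt hn).le_of_lip' hL ?_
    filter_upwards [hn] with w hw using hlip w hw v (interior_subset hv)
  have := mem_closure_iff_nhdsWithin_neBot.1 (hS hu)
  have hlim : Tendsto (fun v => ‖J v‖) (𝓝[interior S] u) (𝓝 ‖J u‖) :=
    ((hJc u hu).tendsto.mono_left (nhdsWithin_mono u interior_subset)).norm
  exact le_of_tendsto hlim (by filter_upwards [self_mem_nhdsWithin] with v hv using hbound v hv)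

end IterateDeriv

namespace VolatilityFamily

variable {d p q : ℕ} {M : VolatilityFamily d p q} {K : TopologicalSpace.Compacts (Vec d)}

theorem zeroExt_apply (f : K → Vec q) (θ : K) : zeroExt K f θ = f θ := by
  simp [zeroExt]

theorem continuousOn_of_eqOn_coe {W : Type*} [TopologicalSpace W] {f : Vec d → W} {e : K → W}
    (he : Continuous e) (h : ∀ θ : K, f θ = e θ) : ContinuousOn f (K : Set (Vec d)) := by
  rw [continuousOn_iff_continuous_domRestrict]
  exact he.congr fun θ => (h θ).symm

/-- `s` has derivative `e` in the interior of `K`. -/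
def HasDerivInterior (K : TopologicalSpace.Compacts (Vec d)) (s : C(K, Vec q))
    (e : C(K, Vec d →L[ℝ] Vec q)) : Prop :=
  ∀ θ : K, (θ : Vec d) ∈ interior (K : Set (Vec d)) → HasFDerivAt (zeroExt K s) (e θ) θ

namespace HasDerivInterior

variable {s : C(K, Vec q)} {e : C(K, Vec d →L[ℝ] Vec q)}

theorem exists_continuousOn_extension (h : HasDerivInterior K s e) :
    ∃ D : Vec d → Vec d →L[ℝ] Vec q, (∀ θ : K, D θ = e θ) ∧ ContinuousOn D (K : Set (Vec d)) ∧
      ∀ x ∈ interior (K : Set (Vec d)), HasFDerivAt (zeroExt K s) (D x) x := by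
  have hD : ∀ θ : K, Function.extend (Subtype.val : K → Vec d) e 0 θ = e θ := fun θ =>
    Subtype.val_injective.extend_apply _ _ θ
  refine ⟨_, hD, continuousOn_of_eqOn_coe e.continuous hD, fun x hx => ?_⟩
  rw [hD ⟨x, interior_subset hx⟩]
  exact h ⟨x, interior_subset hx⟩ hx

theorem isC1 (h : HasDerivInterior K s e) : IsC1 K s := by
  obtain ⟨D, -, hDc, hD⟩ := h.exists_continuousOn_extension
  exact ⟨continuousOn_of_eqOn_coe s.continuous fun θ => zeroExt_apply _ θ, D, hDc, hD⟩

theorem derivOn_eq (h : HasDerivInterior K s e)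
    (hK : (K : Set (Vec d)) ⊆ closure (interior (K : Set (Vec d)))) (θ : K) :
    derivOn (K : Set (Vec d)) (zeroExt K s) θ = e θ := by
  obtain ⟨D, hDe, hDc, hD⟩ := h.exists_continuousOn_extension
  rw [derivOn_eq_of_hasFDerivAt hK hDc hD θ.2, hDe]

theorem const (c : Vec q) : HasDerivInterior K (ContinuousMap.const K c) 0 := fun θ hθ => by
  refine (hasFDerivAt_const c (θ : Vec d)).congr_of_eventuallyEq ?_
  filter_upwards [mem_interior_iff_mem_nhds.1 hθ] with x hx
  exact zeroExt_apply _ ⟨x, hx⟩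

theorem of_tendsto {sₙ : ℕ → C(K, Vec q)} {eₙ : ℕ → C(K, Vec d →L[ℝ] Vec q)}
    (h : ∀ n, HasDerivInterior K (sₙ n) (eₙ n)) (hs : Tendsto sₙ atTop (𝓝 s))
    (he : Tendsto eₙ atTop (𝓝 e)) : HasDerivInterior K s e := fun θ hθ => by
  choose Dₙ hDe _ hD using fun n => (h n).exists_continuousOn_extension
  let D := Function.extend (Subtype.val : K → Vec d) e 0
  have hDθ : ∀ θ : K, D θ = e θ := fun θ => Subtype.val_injective.extend_apply _ _ θ
  have hunif : TendstoUniformlyOn Dₙ D atTop (interior (K : Set (Vec d))) := by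
    rw [ContinuousMap.tendsto_iff_tendstoUniformly] at he
    intro V hV
    filter_upwards [he V hV] with n hn x hx
    have hx' := hn ⟨x, interior_subset hx⟩
    rwa [← hDe n ⟨x, _⟩, ← hDθ ⟨x, _⟩] at hx'
  rw [← hDθ]
  refine hasFDerivAt_of_tendstoUniformlyOn isOpen_interior hunif hD (fun x hx => ?_) hθ
  have heval : Continuous fun f : C(K, Vec q) => f ⟨x, interior_subset hx⟩ := by fun_prop
  rw [zeroExt_apply s ⟨x, interior_subset hx⟩]
  exact ((heval.tendsto s).comp hs).congr fun n =>
    (zeroExt_apply (sₙ n) ⟨x, interior_subset hx⟩).symm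

end HasDerivInterior

/-- `u ↦ ψ_t(θ, u)` along the path `x`, for a fixed parameter. -/
noncomputable def paramMap (M : VolatilityFamily d p q) (x : ℤ → ℝ) (θ : Vec d) (t : ℤ) :
    Vec q → Vec q :=
  fun u => M.psi (pathLags p x t) (θ, u)

/-- The derivative of `u ↦ ψ_t(θ, u)` along the path `x`, extended to the boundary of
`K × [0, ∞)^q`. -/
noncomputable def paramDeriv (M : VolatilityFamily d p q) (K : TopologicalSpace.Compacts (Vec d))
    (x : ℤ → ℝ) (θ : Vec d) (t : ℤ) (u : Vec q) : Vec q →L[ℝ] Vec q :=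
  (derivOn ((K : Set (Vec d)) ×ˢ orthant q) (M.psi (pathLags p x t)) (θ, u)).comp
    (ContinuousLinearMap.inr ℝ (Vec d) (Vec q))

namespace IsRegularOn

theorem subset_closure_interior (hM : M.IsRegularOn K) :
    (K : Set (Vec d)) ⊆ closure (interior (K : Set (Vec d))) :=
  hM.closure_interior.ge

theorem dense_interior (hM : M.IsRegularOn K) :
    Dense {θ : K | (θ : Vec d) ∈ interior (K : Set (Vec d))} := fun θ => by
  obtain ⟨w, hw, hlim⟩ := mem_closure_iff_seq_limit.1 (hM.subset_closure_interior θ.2)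
  exact mem_closure_iff_seq_limit.2 ⟨fun n => ⟨w n, interior_subset (hw n)⟩, hw,
    tendsto_subtype_rng.2 hlim⟩

/-- `ψ` is differentiable up to the boundary of `[0, ∞)^q`, which is what the chain rule along
`θ ↦ (θ, s(θ))` needs: `s` may take values on that boundary. -/
theorem exists_hasFDerivWithinAt_psi (hM : M.IsRegularOn K) (x : Fin p → ℝ) {θ : Vec d}
    (hθ : θ ∈ interior (K : Set (Vec d))) :
    ∃ U ∈ 𝓝 θ, ∀ u ∈ orthant q, HasFDerivWithinAt (M.psi x)
      (derivOn ((K : Set (Vec d)) ×ˢ orthant q) (M.psi x) (θ, u)) (U ×ˢ orthant q) (θ, u) := by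
  obtain ⟨r, hr, hrK⟩ := Metric.nhds_basis_closedBall.mem_iff.1 (mem_interior_iff_mem_nhds.1 hθ)
  set S := (K : Set (Vec d)) ×ˢ orthant q
  set B := Metric.ball θ r ×ˢ interior (orthant q) with hB
  have hBo : IsOpen B := Metric.isOpen_ball.prod isOpen_interior
  have hBc : closure B = Metric.closedBall θ r ×ˢ orthant q := by
    rw [hB, closure_prod_eq, closure_ball θ hr.ne', closure_interior_orthant]
  have hBS : closure B ⊆ S := hBc.le.trans (Set.prod_mono hrK le_rfl)
  have hder : ∀ z ∈ B, HasFDerivAt (M.psi x) (derivOn S (M.psi x) z) z := fun z hz =>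
    (hM.c1_psi x).hasFDerivAt_derivOn hM.prod_subset_closure_interior
      (interior_maximal (subset_closure.trans hBS) hBo hz)
  refine ⟨Metric.ball θ r, Metric.ball_mem_nhds θ hr, fun u hu => ?_⟩
  have hlim : Tendsto (derivOn S (M.psi x)) (𝓝[B] (θ, u)) (𝓝 (derivOn S (M.psi x) (θ, u))) :=
    (hM.continuousOn_derivOn_psi x (θ, u) ⟨interior_subset hθ, hu⟩).tendsto.mono_left
      (nhdsWithin_mono _ (subset_closure.trans hBS))
  have hclosure := hasFDerivWithinAt_closure_of_tendsto_fderiv (x := (θ, u))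
    (fun z hz => (hder z hz).differentiableAt.differentiableWithinAt)
    ((convex_ball θ r).prod (convex_orthant q).interior) hBo
    (fun z hz => ((hM.c1_psi x).1 z (hBS hz)).mono (subset_closure.trans hBS))
    (hlim.congr' (by filter_upwards [self_mem_nhdsWithin] with z hz using (hder z hz).fderiv.symm))
  exact hclosure.mono (hBc ▸ Set.prod_mono Metric.ball_subset_closedBall le_rfl)

theorem hasDerivInterior_Phi (hM : M.IsRegularOn K) (x : Fin p → ℝ) {s : NonnegFun K q}
    {e : C(K, Vec d →L[ℝ] Vec q)} (h : HasDerivInterior K s.1 e) :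
    HasDerivInterior K (hM.Phi x s).1 (graphComp (hM.grad x s) e) := fun θ hθ => by
  obtain ⟨U, hU, hψ⟩ := hM.exists_hasFDerivWithinAt_psi x hθ
  have hKn := mem_interior_iff_mem_nhds.1 hθ
  have hgraph : HasFDerivAt (fun y => (y, zeroExt K s.1 y))
      ((ContinuousLinearMap.id ℝ (Vec d)).prod (e θ)) (θ : Vec d) :=
    (hasFDerivAt_id (θ : Vec d)).prodMk (h θ hθ)
  have hmaps : ∀ᶠ y in 𝓝 (θ : Vec d), (y, zeroExt K s.1 y) ∈ U ×ˢ orthant q := by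
    filter_upwards [hU, hKn] with y hy hyK
    exact ⟨hy, (zeroExt_apply s.1 ⟨y, hyK⟩).symm ▸ s.2 _⟩
  have hcomp := (hψ (s.1 θ) (s.2 θ)).comp_hasFDerivAt_of_eq (θ : Vec d) hgraph hmaps
    (by rw [zeroExt_apply])
  rw [graphComp_apply, grad_apply]
  refine hcomp.congr_of_eventuallyEq ?_
  filter_upwards [hKn] with y hy
  rw [zeroExt_apply _ ⟨y, hy⟩, Function.comp_apply, zeroExt_apply s.1 ⟨y, hy⟩]
  rfl

section Orbit

variable {x : ℤ → ℝ} {h : ℤ → NonnegFun K q} {i : ℤ}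

theorem hasDerivInterior_orbit (hM : M.IsRegularOn K)
    (hh : ∀ m : ℕ, h (i + m + 1) = hM.pathPhi x (i + m) (h (i + m)))
    {e : C(K, Vec d →L[ℝ] Vec q)} (he : HasDerivInterior K (h i).1 e) (n : ℕ) :
    HasDerivInterior K (h (i + n)).1 (forwardIterate (hM.pathStep x h) i n e) := by
  induction n with
  | zero => simpa using he
  | succ n ih =>
    rw [forwardIterate_succ, Nat.cast_add_one, ← add_assoc, hh]
    exact hM.hasDerivInterior_Phi _ ih

theorem forwardIterate_pathPhi_apply (hM : M.IsRegularOn K) (x : ℤ → ℝ) (i : ℤ) (n : ℕ)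
    (s : NonnegFun K q) (θ : K) :
    (forwardIterate (hM.pathPhi x) i n s).1 θ = forwardIterate (M.paramMap x θ) i n (s.1 θ) := by
  induction n with
  | zero => rfl
  | succ n ih =>
    rw [forwardIterate_succ, forwardIterate_succ, Function.comp_apply, Function.comp_apply, ← ih]
    rfl

theorem mapsTo_paramMap (hM : M.IsRegularOn K) (x : ℤ → ℝ) (θ : K) (t : ℤ) :
    Set.MapsTo (M.paramMap x θ t) (orthant q) (orthant q) := fun u hu =>
  (hM.pathPhi x t (constFun K ⟨u, hu⟩)).2 θ

theorem continuousOn_paramDeriv (hM : M.IsRegularOn K) (x : ℤ → ℝ) (θ : K) (t : ℤ) :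
    ContinuousOn (M.paramDeriv K x θ t) (orthant q) :=
  ((hM.continuousOn_derivOn_psi _).comp (Continuous.prodMk_right (θ : Vec d)).continuousOn
    fun _ hu => ⟨θ.2, hu⟩).clm_comp continuousOn_const

theorem hasFDerivWithinAt_paramMap (hM : M.IsRegularOn K) (x : ℤ → ℝ) {θ : Vec d}
    (hθ : θ ∈ interior (K : Set (Vec d))) (t : ℤ) {u : Vec q} (hu : u ∈ orthant q) :
    HasFDerivWithinAt (M.paramMap x θ t) (M.paramDeriv K x θ t u) (orthant q) u := by
  obtain ⟨U, hU, hψ⟩ := hM.exists_hasFDerivWithinAt_psi (pathLags p x t) hθ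
  exact (hψ u hu).comp u (hasFDerivAt_prodMk_right θ u).hasFDerivWithinAt
    fun v hv => ⟨mem_of_mem_nhds hU, hv⟩

theorem forwardIterate_pathStep_sub (hM : M.IsRegularOn K)
    (hh : ∀ m : ℕ, h (i + m + 1) = hM.pathPhi x (i + m) (h (i + m))) (n : ℕ)
    (e e' : C(K, Vec d →L[ℝ] Vec q)) (θ : K) :
    forwardIterate (hM.pathStep x h) i n e θ - forwardIterate (hM.pathStep x h) i n e' θ =
      (iterateDeriv (M.paramMap x θ) (M.paramDeriv K x θ) i n ((h i).1 θ)).comp (e θ - e' θ) := by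
  induction n with
  | zero => exact (ContinuousLinearMap.id_comp _).symm
  | succ n ih =>
    have horbit : (h (i + n)).1 θ = forwardIterate (M.paramMap x θ) i n ((h i).1 θ) := by
      rw [← hM.forwardIterate_pathPhi_apply, forwardIterate_eq_of_solves hh]
    rw [forwardIterate_succ, iterateDeriv, ContinuousLinearMap.comp_assoc, ← ih, ← horbit]
    refine (graphComp_sub _ _ _ θ).trans ?_
    rw [grad_apply]
    rfl

theorem norm_iterateDeriv_le (hM : M.IsRegularOn K) {n : ℕ} {L : ℝ} (hL₀ : 0 ≤ L)
    (hL : ∀ s s' : NonnegFun K q, dist (forwardIterate (hM.pathPhi x) i n s)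
      (forwardIterate (hM.pathPhi x) i n s') ≤ L * dist s s') {θ : K}
    (hθ : (θ : Vec d) ∈ interior (K : Set (Vec d))) {u : Vec q} (hu : u ∈ orthant q) :
    ‖iterateDeriv (M.paramMap x θ) (M.paramDeriv K x θ) i n u‖ ≤ L := by
  have hφ := hM.mapsTo_paramMap x θ
  have hA := fun t u hu => hM.hasFDerivWithinAt_paramMap x hθ t (u := u) hu
  refine norm_le_of_lipschitz_of_subset_closure_interior (closure_interior_orthant q).ge
    (continuousOn_iterateDeriv hφ hA (hM.continuousOn_paramDeriv x θ) i n)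
    (fun u => hasFDerivWithinAt_forwardIterate hφ hA i n) hL₀ (fun u hu v hv => ?_) hu
  have hconst : dist (constFun K ⟨u, hu⟩) (constFun K ⟨v, hv⟩) ≤ dist u v :=
    (ContinuousMap.dist_le dist_nonneg).2 fun _ => le_rfl
  rw [← dist_eq_norm, ← dist_eq_norm]
  calc dist (forwardIterate (M.paramMap x θ) i n u) (forwardIterate (M.paramMap x θ) i n v)
      = dist ((forwardIterate (hM.pathPhi x) i n (constFun K ⟨u, hu⟩)).1 θ)
          ((forwardIterate (hM.pathPhi x) i n (constFun K ⟨v, hv⟩)).1 θ) := by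
        simp only [hM.forwardIterate_pathPhi_apply]
        rfl
    _ ≤ L * dist (constFun K ⟨u, hu⟩) (constFun K ⟨v, hv⟩) :=
        (ContinuousMap.dist_apply_le_dist θ).trans (hL _ _)
    _ ≤ L * dist u v := mul_le_mul_of_nonneg_left hconst hL₀

/-- The derivative recursion contracts at least as much as the iterates of `Φ`, since its linear
part is the derivative of `u ↦ Φ^{(n)}(u)(θ)`. -/
theorem dist_forwardIterate_pathStep_le (hM : M.IsRegularOn K)
    (hh : ∀ m : ℕ, h (i + m + 1) = hM.pathPhi x (i + m) (h (i + m))) (n : ℕ) {L : ℝ}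
    (hL₀ : 0 ≤ L) (hL : ∀ s s' : NonnegFun K q, dist (forwardIterate (hM.pathPhi x) i n s)
      (forwardIterate (hM.pathPhi x) i n s') ≤ L * dist s s') (e e' : C(K, Vec d →L[ℝ] Vec q)) :
    dist (forwardIterate (hM.pathStep x h) i n e) (forwardIterate (hM.pathStep x h) i n e') ≤
      L * dist e e' := by
  rw [ContinuousMap.dist_le (by positivity)]
  have hclosed : IsClosed {θ : K | dist (forwardIterate (hM.pathStep x h) i n e θ)
      (forwardIterate (hM.pathStep x h) i n e' θ) ≤ L * dist e e'} :=
    isClosed_le (by fun_prop) continuous_const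
  refine fun θ => closure_minimal (fun θ hθ => ?_) hclosed (hM.dense_interior θ)
  rw [Set.mem_ofPred_eq, dist_eq_norm, hM.forwardIterate_pathStep_sub hh]
  refine (ContinuousLinearMap.opNorm_comp_le _ _).trans (mul_le_mul
    (hM.norm_iterateDeriv_le hL₀ hL hθ ((h i).2 θ)) ?_ (norm_nonneg _) hL₀)
  rw [← dist_eq_norm]
  exact ContinuousMap.dist_apply_le_dist θ

end Orbit

end IsRegularOn

end VolatilityFamily

theorem vec_eq_sum_single {n : ℕ} (v : Vec n) :
    v = ∑ k, v k • (EuclideanSpace.single k 1 : Vec n) := by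
  ext i
  simp [Pi.single_apply]

theorem norm_vec_le_sum {n : ℕ} (v : Vec n) : ‖v‖ ≤ ∑ k, |v k| := by
  conv_lhs => rw [vec_eq_sum_single v]
  refine (norm_sum_le _ _).trans_eq (Finset.sum_congr rfl fun k _ => ?_)
  simp [norm_smul]

theorem clm_norm_le_sum {n m : ℕ} (A : Vec n →L[ℝ] Vec m) :
    ‖A‖ ≤ ∑ j, ∑ k, |A (EuclideanSpace.single k 1) j| := by
  refine ContinuousLinearMap.opNorm_le_bound _ (by positivity) fun v => ?_
  have hentry : ∀ j, A v j = ∑ k, v k * A (EuclideanSpace.single k 1) j := fun j => by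
    conv_lhs => rw [vec_eq_sum_single v, map_sum]
    simp
  calc ‖A v‖ ≤ ∑ j, |∑ k, v k * A (EuclideanSpace.single k 1) j| := by
        simpa only [hentry] using norm_vec_le_sum (A v)
    _ ≤ ∑ j, ∑ k, |A (EuclideanSpace.single k 1) j| * ‖v‖ := by
        refine Finset.sum_le_sum fun j _ => (Finset.abs_sum_le_sum_abs _ _).trans ?_
        refine Finset.sum_le_sum fun k _ => ?_
        rw [abs_mul, mul_comm]
        gcongr
        exact PiLp.norm_apply_le v k
    _ = (∑ j, ∑ k, |A (EuclideanSpace.single k 1) j|) * ‖v‖ := by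
        simp_rw [Finset.sum_mul]

/-- The identification of linear maps `ℝᵈ → ℝ^q` with vectors of partial derivatives in
`ℝ^{dq}`. -/
noncomputable def derivEquiv (d q : ℕ) : (Vec d →L[ℝ] Vec q) ≃L[ℝ] DerivVec d q :=
  LinearEquiv.toContinuousLinearEquiv
    { toFun := fun A => WithLp.toLp 2 fun jk => A (EuclideanSpace.single jk.2 1) jk.1
      map_add' := fun A B => by ext jk; simp
      map_smul' := fun c A => by ext jk; simp
      invFun := fun w => ∑ k : Fin d, (ContinuousLinearMap.toSpanSingleton ℝ
        (WithLp.toLp 2 fun j => w (j, k) : Vec q)).comp (EuclideanSpace.proj k)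
      left_inv := fun A => by
        ext v j
        conv_rhs => rw [vec_eq_sum_single v, map_sum]
        simp
      right_inv := fun w => by
        ext jk
        simp }

theorem derivEquiv_apply {d q : ℕ} (A : Vec d →L[ℝ] Vec q) (j : Fin q) (k : Fin d) :
    derivEquiv d q A (j, k) = A (EuclideanSpace.single k 1) j := rfl

namespace VolatilityFamily

variable {d p q : ℕ} {M : VolatilityFamily d p q} {K : TopologicalSpace.Compacts (Vec d)}

theorem graph_single_eq_direction (k : Fin d) (w : Vec q) :
    ((EuclideanSpace.single k 1 : Vec d), w) =
      direction (Sum.inl k) + ∑ i, w i • direction (d := d) (Sum.inr i) := by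
  refine Prod.ext ?_ ?_
  · simp [direction, Prod.fst_sum]
  · simpa only [direction, Sum.elim_inl, Sum.elim_inr, Prod.snd_add, zero_add, Prod.snd_sum,
      Prod.smul_snd] using vec_eq_sum_single w

theorem norm_comp_id_prod_le (T : Vec d × Vec q →L[ℝ] Vec q) (A : Vec d →L[ℝ] Vec q) :
    ‖T.comp ((ContinuousLinearMap.id ℝ (Vec d)).prod A)‖ ≤
      ∑ j, ∑ k : Fin d, |T (direction (Sum.inl k)) j| +
        (∑ j, ∑ k : Fin q, |T (direction (Sum.inr k)) j|) * ‖A‖ := by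
  have hsplit : T.comp ((ContinuousLinearMap.id ℝ (Vec d)).prod A) =
      T.comp (ContinuousLinearMap.inl ℝ (Vec d) (Vec q)) +
        (T.comp (ContinuousLinearMap.inr ℝ (Vec d) (Vec q))).comp A := by
    refine ContinuousLinearMap.ext fun v => ?_
    change T (v, A v) = T (v, 0) + T (0, A v)
    rw [← map_add]
    simp
  rw [hsplit]
  refine (norm_add_le _ _).trans (add_le_add (clm_norm_le_sum _) ?_)
  refine (ContinuousLinearMap.opNorm_comp_le _ _).trans ?_
  gcongr
  exact clm_norm_le_sum _

theorem norm_comp_id_prod_le_of_forall_le {T : Vec d × Vec q →L[ℝ] Vec q} {b : ℝ} (hb : 0 ≤ b)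
    (hT : ∀ j k, |T (direction k) j| ≤ b) (A : Vec d →L[ℝ] Vec q) :
    ‖T.comp ((ContinuousLinearMap.id ℝ (Vec d)).prod A)‖ ≤
      (q * d + q * q : ℕ) * b * (1 + ‖A‖) := by
  have hinl : ∑ j, ∑ k : Fin d, |T (direction (Sum.inl k)) j| ≤ (q * d : ℕ) * b := by
    refine (Finset.sum_le_sum fun j _ => Finset.sum_le_sum fun k _ => hT j (Sum.inl k)).trans ?_
    simp [mul_assoc]
  have hinr : ∑ j, ∑ k : Fin q, |T (direction (Sum.inr k)) j| ≤ (q * q : ℕ) * b := by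
    refine (Finset.sum_le_sum fun j _ => Finset.sum_le_sum fun k _ => hT j (Sum.inr k)).trans ?_
    simp [mul_assoc]
  have h₁ : 0 ≤ (q * d : ℕ) * b * ‖A‖ := by positivity
  have h₂ : 0 ≤ (q * q : ℕ) * b := by positivity
  calc _ ≤ (q * d : ℕ) * b + (q * q : ℕ) * b * ‖A‖ :=
        (norm_comp_id_prod_le T A).trans (by gcongr)
    _ ≤ (q * d + q * q : ℕ) * b * (1 + ‖A‖) := by
        push_cast at h₁ h₂ ⊢
        linarith

namespace IsRegularOn

theorem grad_direction (hM : M.IsRegularOn K) (x : Fin p → ℝ) (s : NonnegFun K q) (θ : K)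
    (j : Fin q) (k : Fin d ⊕ Fin q) :
    hM.grad x s θ (direction k) j = M.dpsi K x j k θ (s.1 θ) := by
  rw [hM.grad_apply, dpsi]

theorem derivEquiv_graphComp_grad (hM : M.IsRegularOn K) (x : Fin p → ℝ) (s : NonnegFun K q)
    (e : C(K, Vec d →L[ℝ] Vec q)) (θ : K) (j : Fin q) (k : Fin d) :
    derivEquiv d q (graphComp (hM.grad x s) e θ) (j, k) =
      M.dpsi K x j (Sum.inl k) θ (s.1 θ) +
        ∑ i : Fin q, M.dpsi K x j (Sum.inr i) θ (s.1 θ) * derivEquiv d q (e θ) (i, k) := by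
  simp_rw [← hM.grad_direction, derivEquiv_apply]
  change hM.grad x s θ (EuclideanSpace.single k 1, e θ (EuclideanSpace.single k 1)) j = _
  rw [graph_single_eq_direction, map_add, map_sum]
  simp [mul_comm]

theorem norm_graphComp_grad_zero_le (hM : M.IsRegularOn K) (x : Fin p → ℝ) (s : NonnegFun K q)
    {a : Fin q → Fin d → ℝ} (ha₀ : ∀ j k, 0 ≤ a j k)
    (ha : ∀ j k, ∀ θ : K, |M.dpsi K x j (Sum.inl k) θ (s.1 θ)| ≤ a j k) :
    ‖graphComp (hM.grad x s) 0‖ ≤ ∑ j, ∑ k, a j k := by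
  have hsum : 0 ≤ ∑ j, ∑ k, a j k :=
    Finset.sum_nonneg fun j _ => Finset.sum_nonneg fun k _ => ha₀ j k
  refine (ContinuousMap.norm_le _ hsum).2 fun θ => (norm_comp_id_prod_le _ _).trans ?_
  simp only [ContinuousMap.zero_apply, norm_zero, mul_zero, add_zero]
  refine Finset.sum_le_sum fun j _ => Finset.sum_le_sum fun k _ => ?_
  rw [hM.grad_direction]
  exact ha j k θ

theorem dist_graphComp_grad_le (hM : M.IsRegularOn K) (x : Fin p → ℝ) (s s' : NonnegFun K q)
    (e : C(K, Vec d →L[ℝ] Vec q)) {c κ : ℝ} (hc : 0 ≤ c) (hκ : 0 ≤ κ)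
    (hH : ∀ (j : Fin q) (k : Fin d ⊕ Fin q), ∀ u ∈ orthant q, ∀ u' ∈ orthant q, ∀ θ ∈ K,
      |M.dpsi K x j k θ u - M.dpsi K x j k θ u'| ≤ c * ‖u - u'‖ ^ κ) :
    dist (graphComp (hM.grad x s) e) (graphComp (hM.grad x s') e) ≤
      (q * d + q * q : ℕ) * (c * dist s s' ^ κ) * (1 + ‖e‖) := by
  refine (ContinuousMap.dist_le (by positivity)).2 fun θ => ?_
  rw [dist_eq_norm, graphComp_apply, graphComp_apply, ← ContinuousLinearMap.sub_comp]
  have hentry : ∀ j k,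
      |(hM.grad x s θ - hM.grad x s' θ) (direction k) j| ≤ c * dist s s' ^ κ := fun j k =>
    calc |(hM.grad x s θ - hM.grad x s' θ) (direction k) j|
        = |M.dpsi K x j k θ (s.1 θ) - M.dpsi K x j k θ (s'.1 θ)| := by
          rw [← hM.grad_direction, ← hM.grad_direction]
          rfl
      _ ≤ c * dist (s.1 θ) (s'.1 θ) ^ κ := by
          rw [dist_eq_norm]
          exact hH j k _ (s.2 θ) _ (s'.2 θ) θ θ.2
      _ ≤ c * dist s s' ^ κ := by
          gcongr
          exact ContinuousMap.dist_apply_le_dist (f := s.1) (g := s'.1) θ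
  refine (norm_comp_id_prod_le_of_forall_le (by positivity) hentry _).trans ?_
  gcongr
  exact e.norm_coe_le_norm θ

end IsRegularOn

end VolatilityFamily

/-! ### Convergence along a path -/

namespace ContractsExp

variable {E : Type*} [MetricSpace E] [CompleteSpace E] {φ : ℤ → E → E} {ε : ℝ} {o : E}

theorem tendsto_backwardLimit (hφ : ContractsExp φ ε) (hε : 0 < ε)
    (ho : Subexponential fun t => dist (φ t o) o) (t : ℤ) :
    Tendsto (fun n : ℕ => forwardIterate φ (t - n) n o) atTop (𝓝 (backwardLimit φ o t)) :=
  tendsto_nhds_limUnder (hφ.exists_tendsto_backward hε ho t)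

theorem backwardLimit_add_one (hφ : ContractsExp φ ε) (hε : 0 < ε)
    (ho : Subexponential fun t => dist (φ t o) o) (t : ℤ) :
    backwardLimit φ o (t + 1) = φ t (backwardLimit φ o t) :=
  hφ.solves_of_tendsto_backward (hφ.tendsto_backwardLimit hε ho) t

theorem subexponential_dist_backwardLimit (hφ : ContractsExp φ ε) (hε : 0 < ε)
    (ho : Subexponential fun t => dist (φ t o) o) :
    Subexponential fun t => dist (backwardLimit φ o t) o :=
  hφ.subexponential_dist_of_tendsto_backward hε ho (hφ.tendsto_backwardLimit hε ho)

end ContractsExp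

/-- The orbit of `o` under `φ` started at time `i`, evaluated at time `t`; it equals `o` for
`t ≤ i`. -/
def orbitFrom {E : Type*} (φ : ℤ → E → E) (o : E) (i t : ℤ) : E :=
  forwardIterate φ i (t - i).toNat o

section OrbitFrom

variable {E : Type*} (φ : ℤ → E → E) (o : E) (i : ℤ)

theorem orbitFrom_self : orbitFrom φ o i i = o := by
  simp [orbitFrom]

theorem orbitFrom_add (n : ℕ) : orbitFrom φ o i (i + n) = forwardIterate φ i n o := by
  simp [orbitFrom]

theorem orbitFrom_succ (n : ℕ) :
    orbitFrom φ o i (i + n + 1) = φ (i + n) (orbitFrom φ o i (i + n)) := by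
  rw [orbitFrom_add, add_assoc, ← Nat.cast_one, ← Nat.cast_add, orbitFrom_add, forwardIterate_succ,
    Function.comp_apply]

theorem orbitFrom_add_succ (m n : ℕ) :
    orbitFrom φ o i (i + m + n + 1) = φ (i + m + n) (orbitFrom φ o i (i + m + n)) := by
  simpa only [Nat.cast_add, ← add_assoc] using orbitFrom_succ φ o i (m + n)

end OrbitFrom

namespace VolatilityFamily.IsRegularOn

variable {d p q : ℕ} {M : VolatilityFamily d p q} {K : TopologicalSpace.Compacts (Vec d)}

/-- The property of a path of the observations that holds almost surely under Condition D.1. -/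
structure IsContractivePath (hM : M.IsRegularOn K) (o : NonnegFun K q) (ε : ℝ) (x : ℤ → ℝ) :
    Prop where
  contractsExp : ContractsExp (hM.pathPhi x) ε
  subexponential_init : Subexponential fun t => dist (hM.pathPhi x t o) o

/-- The property of a path of the observations that holds almost surely under Conditions D.1 and
D.2. -/
structure IsHolderPath (hM : M.IsRegularOn K) (o : NonnegFun K q) (ε κ : ℝ) (x : ℤ → ℝ) : Prop
    extends hM.IsContractivePath o ε x where
  subexponential_pathStep_zero :
    Subexponential fun t => dist (hM.pathStep x (hM.limitSol o x) t 0) 0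
  holder : ∃ c : ℤ → ℝ, Subexponential c ∧ (∀ t, 0 ≤ c t) ∧
    ∀ t (j : Fin q) (k : Fin d ⊕ Fin q), ∀ u ∈ orthant q, ∀ u' ∈ orthant q, ∀ θ ∈ K,
      |M.dpsi K (pathLags p x t) j k θ u - M.dpsi K (pathLags p x t) j k θ u'| ≤
        c t * ‖u - u'‖ ^ κ

variable {hM : M.IsRegularOn K} {o : NonnegFun K q} {ε κ : ℝ} {x : ℤ → ℝ}

namespace IsContractivePath

theorem tendsto_limitSol (hx : hM.IsContractivePath o ε x) (hε : 0 < ε) (t : ℤ) :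
    Tendsto (fun n : ℕ => forwardIterate (hM.pathPhi x) (t - n) n o) atTop
      (𝓝 (hM.limitSol o x t)) :=
  hx.contractsExp.tendsto_backwardLimit hε hx.subexponential_init t

theorem limitSol_add_one (hx : hM.IsContractivePath o ε x) (hε : 0 < ε) (t : ℤ) :
    hM.limitSol o x (t + 1) = hM.pathPhi x t (hM.limitSol o x t) :=
  hx.contractsExp.backwardLimit_add_one hε hx.subexponential_init t

theorem subexponential_dist_limitSol (hx : hM.IsContractivePath o ε x) (hε : 0 < ε) :
    Subexponential fun t => dist (hM.limitSol o x t) o :=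
  hx.contractsExp.subexponential_dist_backwardLimit hε hx.subexponential_init

-- The Lipschitz constants of `Φ` bound the operator norms of its derivatives in `u`.
theorem contractsExp_pathStep (hx : hM.IsContractivePath o ε x) (hε : 0 < ε) :
    ContractsExp (hM.pathStep x (hM.limitSol o x)) ε := fun δ hδ => by
  obtain ⟨C, hC, hCφ⟩ := hx.contractsExp δ hδ
  exact ⟨C, hC, fun i n => hM.dist_forwardIterate_pathStep_le
    (fun _ => hx.limitSol_add_one hε _) n (by positivity) (hCφ i n)⟩

end IsContractivePath

theorem hasDerivInterior_forwardIterate (hM : M.IsRegularOn K) (x : ℤ → ℝ) (ς : orthant q) (i : ℤ)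
    (n : ℕ) : HasDerivInterior K (forwardIterate (hM.pathPhi x) i n (constFun K ς)).1
      (forwardIterate (hM.pathStep x (orbitFrom (hM.pathPhi x) (constFun K ς) i)) i n 0) := by
  rw [← orbitFrom_add]
  refine hM.hasDerivInterior_orbit (orbitFrom_succ _ _ i) ?_ n
  rw [orbitFrom_self]
  exact HasDerivInterior.const _

namespace IsHolderPath

theorem limitDeriv_add_one (hx : hM.IsHolderPath o ε κ x) (hε : 0 < ε) (t : ℤ) :
    hM.limitDeriv o x (t + 1) = hM.pathStep x (hM.limitSol o x) t (hM.limitDeriv o x t) :=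
  (hx.contractsExp_pathStep hε).backwardLimit_add_one
    (o := (0 : C(K, Vec d →L[ℝ] Vec q))) hε hx.subexponential_pathStep_zero t

theorem subexponential_dist_limitDeriv (hx : hM.IsHolderPath o ε κ x) (hε : 0 < ε) :
    Subexponential fun t => dist (hM.limitDeriv o x t) 0 :=
  (hx.contractsExp_pathStep hε).subexponential_dist_backwardLimit
    (o := (0 : C(K, Vec d →L[ℝ] Vec q))) hε hx.subexponential_pathStep_zero

-- The derivative recursion along the orbit of `o` differs from the one along the stationary
-- solution by the Hölder modulus at their exponentially small distance.
theorem exists_dist_pathStep_orbitFrom_le (hx : hM.IsHolderPath o ε κ x) (hε : 0 < ε)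
    (hκ₀ : 0 < κ) (hκ₁ : κ ≤ 1) {δ : ℝ} (hδ : 0 < δ) :
    ∃ C ≥ 0, ∀ (i : ℤ) (m : ℕ),
      dist (hM.pathStep x (orbitFrom (hM.pathPhi x) o i) (i + m) (hM.limitDeriv o x (i + m)))
        (hM.limitDeriv o x (i + m + 1)) ≤ C * Real.exp (-(κ * ε / 2) * m + δ * |(i : ℝ)|) := by
  obtain ⟨c, hc, hc₀, hH⟩ := hx.holder
  set δ' := min (δ / 2) (κ * ε / 2)
  have hδ' : 0 < δ' := lt_min (half_pos hδ) (by positivity)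
  obtain ⟨A, hA, hAb⟩ := hx.contractsExp.exists_dist_forwardIterate_le (hx.limitSol_add_one hε)
    (hx.subexponential_dist_limitSol hε) hδ'
  obtain ⟨B, hB, hBb⟩ :=
    (((Subexponential.const 1).add (hx.subexponential_dist_limitDeriv hε)).mul hc hc₀) δ' hδ'
  refine ⟨(q * d + q * q : ℕ) * B * A ^ κ, by positivity, fun i m => ?_⟩
  have horbit : dist (orbitFrom (hM.pathPhi x) o i (i + m)) (hM.limitSol o x (i + m)) ^ κ ≤
      A ^ κ * Real.exp (κ * (-ε * m + δ' * |(i : ℝ)|)) := by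
    rw [orbitFrom_add, mul_comm κ, Real.exp_mul, ← Real.mul_rpow hA.le (Real.exp_pos _).le]
    exact Real.rpow_le_rpow dist_nonneg (hAb i m) hκ₀.le
  have hcoeff : (1 + dist (hM.limitDeriv o x (i + m)) 0) * c (i + m) ≤
      B * Real.exp (δ' * (|(i : ℝ)| + m)) := by
    refine (hBb (i + m)).trans ?_
    gcongr
    exact abs_add_natCast_le i m
  have hrate : δ' * (|(i : ℝ)| + m) + κ * (-ε * m + δ' * |(i : ℝ)|) ≤
      -(κ * ε / 2) * m + δ * |(i : ℝ)| := by
    have hm : δ' * m ≤ κ * ε / 2 * m := by gcongr; exact min_le_right _ _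
    have hi : δ' * |(i : ℝ)| ≤ δ / 2 * |(i : ℝ)| := by gcongr; exact min_le_left _ _
    have hκi : κ * (δ' * |(i : ℝ)|) ≤ δ' * |(i : ℝ)| :=
      mul_le_of_le_one_left (by positivity) hκ₁
    linarith
  rw [hx.limitDeriv_add_one hε]
  calc _ ≤ (q * d + q * q : ℕ) * ((1 + dist (hM.limitDeriv o x (i + m)) 0) * c (i + m)) *
        dist (orbitFrom (hM.pathPhi x) o i (i + m)) (hM.limitSol o x (i + m)) ^ κ := by
        refine (hM.dist_graphComp_grad_le _ _ _ _ (hc₀ _) hκ₀.le (hH (i + m))).trans_eq ?_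
        rw [dist_eq_norm (hM.limitDeriv o x (i + m)), sub_zero]
        ring
    _ ≤ (q * d + q * q : ℕ) * (B * Real.exp (δ' * (|(i : ℝ)| + m))) *
        (A ^ κ * Real.exp (κ * (-ε * m + δ' * |(i : ℝ)|))) := by gcongr
    _ = (q * d + q * q : ℕ) * B * A ^ κ *
        Real.exp (δ' * (|(i : ℝ)| + m) + κ * (-ε * m + δ' * |(i : ℝ)|)) := by
        rw [Real.exp_add]
        ring
    _ ≤ _ := by gcongr

theorem exists_dist_derivOrbit_le (hx : hM.IsHolderPath o ε κ x) (hε : 0 < ε)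
    (hκ₀ : 0 < κ) (hκ₁ : κ ≤ 1) {δ : ℝ} (hδ : 0 < δ) :
    ∃ C ≥ 0, ∀ (i : ℤ) (n : ℕ),
      dist (forwardIterate (hM.pathStep x (orbitFrom (hM.pathPhi x) o i)) i n 0)
        (hM.limitDeriv o x (i + n)) ≤ C * Real.exp (-(κ * ε / 2 - δ) * n + δ * |(i : ℝ)|) := by
  obtain ⟨C₁, hC₁, hL⟩ := hx.contractsExp (δ / 2) (half_pos hδ)
  obtain ⟨C₂, hC₂, herr⟩ := hx.exists_dist_pathStep_orbitFrom_le hε hκ₀ hκ₁ (half_pos hδ)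
  obtain ⟨C₃, hC₃, hinit⟩ := hx.subexponential_dist_limitDeriv hε (δ / 2) (half_pos hδ)
  refine ⟨C₁ * C₃ + C₁ * C₂ * Real.exp (κ * ε / 2) / (δ / 2), by positivity, fun i n => ?_⟩
  have hbound := dist_forwardIterate_le_exp (hM.pathStep x (orbitFrom (hM.pathPhi x) o i)) i
    (hM.limitDeriv o x) (u := 0) (by nlinarith : κ * ε / 2 ≤ ε) (half_pos hδ) hC₁.le hC₂
    (fun m n => hM.dist_forwardIterate_pathStep_le (orbitFrom_add_succ _ _ i m) n (by positivity)
      (hL (i + m) n))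
    (herr i) ((dist_comm _ _).trans_le (hinit i)) n
  simpa only [mul_div_cancel₀ δ (two_ne_zero' ℝ)] using hbound

theorem tendsto_derivOrbit (hx : hM.IsHolderPath o ε κ x) (hε : 0 < ε) (hκ₀ : 0 < κ)
    (hκ₁ : κ ≤ 1) (t : ℤ) :
    Tendsto (fun n : ℕ =>
      forwardIterate (hM.pathStep x (orbitFrom (hM.pathPhi x) o (t - n))) (t - n) n 0)
      atTop (𝓝 (hM.limitDeriv o x t)) := by
  have hδ : 0 < κ * ε / 8 := by positivity
  obtain ⟨C, hC, hb⟩ := hx.exists_dist_derivOrbit_le hε hκ₀ hκ₁ hδ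
  have hη : 0 < κ * ε / 4 := by positivity
  have hlim := (tendsto_exp_neg_mul_natCast hη).const_mul (C * Real.exp (κ * ε / 8 * |(t : ℝ)|))
  rw [mul_zero] at hlim
  refine (tendsto_iff_dist_tendsto_zero (α := C(K, Vec d →L[ℝ] Vec q))).2
    (squeeze_zero (fun _ => dist_nonneg) (fun n => ?_) hlim)
  have hexp : -(κ * ε / 2 - κ * ε / 8) * n + κ * ε / 8 * |((t - n : ℤ) : ℝ)| ≤
      κ * ε / 8 * |(t : ℝ)| + -(κ * ε / 4) * n := by
    nlinarith [abs_sub_natCast_le t n]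
  rw [mul_assoc, ← Real.exp_add]
  have hbn := hb (t - n) n
  rw [sub_add_cancel] at hbn
  exact hbn.trans (by gcongr)

theorem hasDerivInterior_limitSol {ς : orthant q} (hx : hM.IsHolderPath (constFun K ς) ε κ x)
    (hε : 0 < ε) (hκ₀ : 0 < κ) (hκ₁ : κ ≤ 1) (t : ℤ) :
    HasDerivInterior K (hM.limitSol (constFun K ς) x t).1 (hM.limitDeriv (constFun K ς) x t) :=
  .of_tendsto (fun n : ℕ => hM.hasDerivInterior_forwardIterate x ς (t - n) n)
    ((continuous_subtype_val.tendsto _).comp (hx.tendsto_limitSol hε t))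
    (hx.tendsto_derivOrbit hε hκ₀ hκ₁ t)

end IsHolderPath

end VolatilityFamily.IsRegularOn

/-! ### Stationary sequences and solutions -/

section StationarySequences

variable {Ω E F : Type*} [MeasurableSpace Ω] [MeasurableSpace E] [MeasurableSpace F]
  {P : Measure Ω} {v : ℤ → Ω → E}

theorem measurable_shiftSeq : Measurable (shiftSeq : (ℤ → E) → ℤ → E) := measurable_shiftBy 1

theorem map_eval_processLaw (hv : ∀ t, AEMeasurable (v t) P) (t : ℤ) :
    (processLaw P v).map (fun y => y t) = P.map (v t) :=
  AEMeasurable.map_map_of_aemeasurable (measurable_pi_apply t).aemeasurable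
    (aemeasurable_pi_lambda _ hv)

theorem IsStationarySeq.identDistrib (h : IsStationarySeq P v) (t : ℤ) :
    IdentDistrib (v t) (v 0) P P := by
  have hshift := (identDistrib_comp_shiftBy ⟨measurable_shiftSeq, h.map_shift⟩
    (measurable_pi_apply (0 : ℤ)).aemeasurable t).map_eq
  simp only [shiftBy, zero_add] at hshift
  rw [map_eval_processLaw h.aemeasurable, map_eval_processLaw h.aemeasurable] at hshift
  exact ⟨h.aemeasurable t, h.aemeasurable 0, hshift⟩

theorem IsStationarySeq.comp (h : IsStationarySeq P v) {f : E → F} (hf : Measurable f) :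
    IsStationarySeq P fun t ω => f (v t ω) := by
  have hg : Measurable fun (y : ℤ → E) t => f (y t) :=
    measurable_pi_lambda _ fun t => hf.comp (measurable_pi_apply t)
  have hlaw : processLaw P (fun t ω => f (v t ω)) = (processLaw P v).map fun y t => f (y t) :=
    (AEMeasurable.map_map_of_aemeasurable hg.aemeasurable
      (aemeasurable_pi_lambda _ h.aemeasurable)).symm
  refine ⟨fun t => hf.comp_aemeasurable (h.aemeasurable t), ?_⟩
  rw [hlaw, Measure.map_map measurable_shiftSeq hg]
  conv_rhs => rw [← h.map_shift, Measure.map_map hg measurable_shiftSeq]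
  rfl

theorem IsStationaryErgodicSeq.isStationarySeq (h : IsStationaryErgodicSeq P v) :
    IsStationarySeq P v :=
  ⟨h.aemeasurable, h.ergodic.toMeasurePreserving.map_eq⟩

theorem isStationaryErgodicSeq_factor {ξ : Ω → ℤ → E} (hξ : AEMeasurable ξ P)
    (hμ : Ergodic shiftSeq (P.map ξ)) {G : (ℤ → E) → ℤ → F} (hG : ∀ t, Measurable fun x => G x t)
    (hshift : ∀ x t, G (shiftSeq x) t = G x (t + 1)) :
    IsStationaryErgodicSeq P fun t ω => G (ξ ω) t := by
  have hGm : Measurable G := measurable_pi_lambda _ hG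
  refine ⟨fun t => (hG t).comp_aemeasurable hξ, ?_⟩
  have hlaw : processLaw P (fun t ω => G (ξ ω) t) = (P.map ξ).map G :=
    (AEMeasurable.map_map_of_aemeasurable hGm.aemeasurable hξ).symm
  rw [hlaw]
  exact (hGm.measurePreserving _).ergodic_of_ergodic_semiconj hμ measurable_shiftSeq
    fun x => funext fun t => hshift x t

/-- The random path `ξ`, measurable as a map into the path space, is almost surely the path of the
sequence `X`, and its law is ergodic. It serves to replace functionals of `X` by functions of a
path. -/
structure IsErgodicVersion (P : Measure Ω) (X : ℤ → Ω → E) (ξ : Ω → ℤ → E) : Prop where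
  measurable : Measurable ξ
  ergodic : Ergodic shiftSeq (P.map ξ)
  ae_eq : ∀ᵐ ω ∂P, (fun t => X t ω) = ξ ω

theorem IsStationaryErgodicSeq.isErgodicVersion (h : IsStationaryErgodicSeq P v) {ξ : Ω → ℤ → E}
    (hξ : ∀ t, Measurable fun ω => ξ ω t) (hv : ∀ t, v t =ᵐ[P] fun ω => ξ ω t) :
    IsErgodicVersion P v ξ := by
  have hae : ∀ᵐ ω ∂P, (fun t => v t ω) = ξ ω := (ae_all_iff.2 hv).mono fun ω hω => funext hω
  refine ⟨measurable_pi_lambda _ hξ, ?_, hae⟩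
  rw [← Measure.map_congr hae]
  exact h.ergodic

namespace IsErgodicVersion

variable {ξ : Ω → ℤ → E}

theorem isStationaryErgodicSeq (hξ : IsErgodicVersion P v ξ) {G : (ℤ → E) → ℤ → F}
    (hG : ∀ t, Measurable fun x => G x t) (hshift : ∀ k x t, G (shiftBy k x) t = G x (t + k)) :
    IsStationaryErgodicSeq P fun t ω => G (ξ ω) t :=
  isStationaryErgodicSeq_factor hξ.measurable.aemeasurable hξ.ergodic hG (hshift 1)

theorem ae_subexponential [IsProbabilityMeasure P] (hξ : IsErgodicVersion P v ξ)
    {f : (ℤ → E) → ℝ≥0∞} (hf : Measurable f) (hm : FiniteLogPlusMoment P fun ω => f (ξ ω)) :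
    ∀ᵐ ω ∂P, (∀ t, f (shiftBy t (ξ ω)) ≠ ⊤) ∧
      Subexponential fun t => (f (shiftBy t (ξ ω))).toReal := by
  have hstat := (hξ.isStationaryErgodicSeq (G := fun x t => f (shiftBy t x))
    (fun t => hf.comp (measurable_shiftBy t))
    fun k x t => by rw [shiftBy_shiftBy]).isStationarySeq
  exact ae_subexponential_of_finiteLogPlusMoment hstat.identDistrib
    (by simpa only [shiftBy_zero] using hm)

end IsErgodicVersion

end StationarySequences

theorem ContractsExp.exists_dist_le_of_solves {E : Type*} [PseudoMetricSpace E] {φ : ℤ → E → E}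
    {ε : ℝ} (hφ : ContractsExp φ ε) (hε : 0 < ε) {h h' : ℤ → E} {o : E}
    (hsub : Subexponential fun t => dist (h t) o) (hh : ∀ t, h (t + 1) = φ t (h t))
    (hh' : ∀ t, h' (t + 1) = φ t (h' t)) (t : ℤ) :
    ∃ A B : ℝ, ∀ n : ℕ,
      dist (h' t) (h t) ≤ A * (Real.exp (-(ε / 2) * n) * (dist (h' (t - n)) o + B)) := by
  obtain ⟨C, hC, hCφ⟩ := hφ (ε / 4) (by positivity)
  obtain ⟨C', hC', hCh⟩ := hsub (ε / 4) (by positivity)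
  set c := Real.exp (ε / 4 * |(t : ℝ)|)
  refine ⟨C * c, C' * c, fun n => ?_⟩
  have hexp : 1 ≤ Real.exp (ε / 4 * n) := Real.one_le_exp (by positivity)
  have hgrow : Real.exp (ε / 4 * |((t - n : ℤ) : ℝ)|) ≤ c * Real.exp (ε / 4 * n) := by
    rw [← Real.exp_add, ← mul_add]
    gcongr
    exact abs_sub_natCast_le t n
  have hstart : dist (h' (t - n)) (h (t - n)) ≤
      (dist (h' (t - n)) o + C' * c) * Real.exp (ε / 4 * n) :=
    calc _ ≤ dist (h' (t - n)) o + C' * (c * Real.exp (ε / 4 * n)) :=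
          (dist_triangle_right _ _ o).trans
            (add_le_add le_rfl ((hCh _).trans (mul_le_mul_of_nonneg_left hgrow hC'.le)))
      _ ≤ dist (h' (t - n)) o * Real.exp (ε / 4 * n) + C' * (c * Real.exp (ε / 4 * n)) := by
          gcongr
          exact le_mul_of_one_le_right dist_nonneg hexp
      _ = _ := by ring
  have hcontr := hCφ (t - n) n (h' (t - n)) (h (t - n))
  rw [forwardIterate_eq_of_solves fun _ => hh _, forwardIterate_eq_of_solves fun _ => hh' _,
    sub_add_cancel, Real.exp_add] at hcontr
  have hrate : Real.exp (-(ε / 2) * n) =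
      Real.exp (-ε * n) * Real.exp (ε / 4 * n) * Real.exp (ε / 4 * n) := by
    rw [← Real.exp_add, ← Real.exp_add]
    ring_nf
  calc _ ≤ C * (Real.exp (-ε * n) * (c * Real.exp (ε / 4 * n))) *
        ((dist (h' (t - n)) o + C' * c) * Real.exp (ε / 4 * n)) := hcontr.trans (by gcongr)
    _ = _ := by
        rw [hrate]
        ring

-- A stationary solution need not be subexponential path by path, but it is bounded in probability:
-- along a random subsequence its past values are negligible against the contraction.
theorem ae_eq_of_isStationarySeq {Ω E : Type*} [MeasurableSpace Ω] {P : Measure Ω}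
    [MetricSpace E] [MeasurableSpace E] [OpensMeasurableSpace E] [IsFiniteMeasure P]
    {φ : Ω → ℤ → E → E} {h h' : ℤ → Ω → E} {o : E} {ε : ℝ} (hε : 0 < ε)
    (hstat : IsStationarySeq P h') (hφ : ∀ᵐ ω ∂P, ContractsExp (φ ω) ε)
    (hsub : ∀ᵐ ω ∂P, Subexponential fun t => dist (h t ω) o)
    (hsol : ∀ᵐ ω ∂P, ∀ t, h (t + 1) ω = φ ω t (h t ω))
    (hsol' : ∀ᵐ ω ∂P, ∀ t, h' (t + 1) ω = φ ω t (h' t ω)) (t : ℤ) : h' t =ᵐ[P] h t := by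
  have hdist := hstat.comp (f := fun z => dist z o) (by fun_prop)
  obtain ⟨ns, hns, hlim⟩ := exists_subseq_exp_mul_tendsto_zero
    (y := fun n ω => dist (h' (t - n) ω) o)
    (fun n => (hdist.identDistrib (t - n)).trans (hdist.identDistrib _).symm) (half_pos hε)
  filter_upwards [hφ, hsub, hsol, hsol', hlim] with ω hφ hsub hsol hsol' hlim
  obtain ⟨A, B, hAB⟩ := hφ.exists_dist_le_of_solves (h := fun t => h t ω)
    (h' := fun t => h' t ω) hε hsub hsol hsol' t
  have hexp := (tendsto_exp_neg_mul_natCast (half_pos hε)).comp hns.tendsto_atTop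
  have hzero := (hlim.add (hexp.mul_const B)).const_mul A
  simp only [Function.comp_apply, ← mul_add, zero_mul, add_zero, mul_zero] at hzero
  exact dist_le_zero.1 (ge_of_tendsto' hzero fun k => hAB (ns k))

theorem expFastAS_of_ae_le_exp {Ω : Type*} [MeasurableSpace Ω] {P : Measure Ω}
    {u : ℕ → Ω → ℝ≥0∞} {η : ℝ} (hη : 0 < η)
    (h : ∀ᵐ ω ∂P, ∃ C : ℝ, ∀ n : ℕ, u n ω ≤ ENNReal.ofReal (C * Real.exp (-η * n))) :
    ExpFastAS P u := by
  refine ⟨(Real.exp (η / 2)).toNNReal,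
    Real.one_lt_toNNReal.2 (Real.one_lt_exp_iff.2 (half_pos hη)), ?_⟩
  filter_upwards [h] with ω ⟨C, hu⟩
  have hlim : Tendsto (fun n : ℕ => ENNReal.ofReal (C * Real.exp (-(η / 2) * n))) atTop (𝓝 0) := by
    simpa using
      ENNReal.tendsto_ofReal ((tendsto_exp_neg_mul_natCast (half_pos hη)).const_mul C)
  refine tendsto_of_tendsto_of_tendsto_of_le_of_le tendsto_const_nhds hlim (fun _ => zero_le)
    fun n => ?_
  calc ENNReal.ofReal (Real.exp (η / 2)) ^ n * u n ω
      ≤ ENNReal.ofReal (Real.exp (η / 2 * n)) * ENNReal.ofReal (C * Real.exp (-η * n)) := by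
        rw [← ENNReal.ofReal_pow (Real.exp_pos _).le, ← Real.exp_nat_mul, mul_comm (n : ℝ)]
        exact mul_le_mul_right (hu n) _
    _ = ENNReal.ofReal (C * Real.exp (-(η / 2) * n)) := by
        rw [← ENNReal.ofReal_mul (Real.exp_pos _).le, mul_left_comm, ← Real.exp_add]
        ring_nf

section PastField

variable {Ω : Type*} (Z : ℤ → Ω → ℝ)

theorem pastField_mono : Monotone (pastField Z) := fun _ _ h =>
  iSup_mono fun _ => iSup_mono' fun hk => ⟨hk.trans h, le_rfl⟩

theorem measurable_pastField (t : ℤ) : Measurable[pastField Z t] (Z t) :=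
  measurable_iff_comap_le.2 (le_iSup₂_of_le t le_rfl le_rfl)

variable {Z} in
/-- The filtration `(ℱ_t)` of the noise. -/
def pastFiltration [mΩ : MeasurableSpace Ω] (hZ : ∀ t, Measurable (Z t)) : Filtration ℤ mΩ where
  seq := pastField Z
  mono' := pastField_mono Z
  le' _ := iSup₂_le fun k _ => (hZ k).comap_le

end PastField

namespace VolatilityFamily.IsRegularOn

variable {d p q : ℕ} {M : VolatilityFamily d p q} {K : TopologicalSpace.Compacts (Vec d)}
  {Ω : Type*} [MeasurableSpace Ω] {P : Measure Ω} {X : ℤ → Ω → ℝ} {ξ : Ω → ℤ → ℝ}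

theorem ae_randomPhi_eq (hM : M.IsRegularOn K) (hξ : IsErgodicVersion P X ξ) :
    ∀ᵐ ω ∂P, hM.randomPhi X ω = hM.pathPhi (ξ ω) := by
  filter_upwards [hξ.ae_eq] with ω hω
  rw [← hω]
  rfl

theorem IsContractiveOnAverage.exists_ae_contractsExp [IsProbabilityMeasure P]
    {hM : M.IsRegularOn K} {ς : orthant q} (hΦ : hM.IsContractiveOnAverage P X ς)
    (hξ : IsErgodicVersion P X ξ) :
    ∃ ε > 0, ∀ᵐ ω ∂P, ContractsExp (hM.pathPhi (ξ ω)) ε := by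
  have := Measure.isProbabilityMeasure_map hξ.measurable.aemeasurable (μ := P)
  obtain ⟨r, hr, hcontr⟩ := hΦ.contr
  have hmeas := hM.measurable_lipConst_forwardIterate
  have hlip : FiniteLogPlusMoment (P.map ξ) fun x => lipConst (hM.pathPhi x 0) := by
    refine (finiteLogPlusMoment_map_iff hξ.measurable ?_).2 (hΦ.lip.congr ?_)
    · simpa only [forwardIterate_one] using hmeas 0 1
    · exact (hM.ae_randomPhi_eq hξ).mono fun ω hω => by simp only [hω]
  have hneg : NegativeLogMean (P.map ξ) fun x => lipConst (pastIterate (hM.pathPhi x) 0 r) := by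
    refine (negativeLogMean_map_iff hξ.measurable ?_).2 (hcontr.congr ?_)
    · simpa only [pastIterate_eq_forwardIterate] using hmeas _ r
    · exact (hM.ae_randomPhi_eq hξ).mono fun ω hω => by simp only [hω]
  obtain ⟨ε, hε, hcontracts⟩ := ae_contractsExp hξ.ergodic hM.pathPhi_shiftBy hmeas hlip hr hneg
  exact ⟨ε, hε, ae_of_ae_map hξ.measurable.aemeasurable hcontracts⟩

theorem IsContractiveOnAverage.ae_subexponential_init [IsProbabilityMeasure P]
    {hM : M.IsRegularOn K} {ς : orthant q} (hΦ : hM.IsContractiveOnAverage P X ς)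
    (hξ : IsErgodicVersion P X ξ) :
    ∀ᵐ ω ∂P, Subexponential fun t =>
      dist (hM.pathPhi (ξ ω) t (constFun K ς)) (constFun K ς) := by
  have hmeas : Measurable fun x => ‖(hM.pathPhi x 0 (constFun K ς)).1‖ₑ :=
    continuous_subtype_val.enorm.measurable.comp ((hM.measurable_pathPhi fun k _ =>
      measurable_pi_apply k).comp (measurable_const.prodMk measurable_id))
  have hinit : FiniteLogPlusMoment P fun ω => ‖(hM.pathPhi (ξ ω) 0 (constFun K ς)).1‖ₑ :=
    hΦ.init.congr ((hM.ae_randomPhi_eq hξ).mono fun ω hω => by simp only [hω])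
  filter_upwards [hξ.ae_subexponential hmeas hinit] with ω ⟨_, hω⟩
  refine (hω.add (Subexponential.const ‖(constFun K ς).1‖)).mono fun t => ?_
  rw [pathPhi_shiftBy, zero_add, toReal_enorm]
  exact (Subtype.dist_eq _ _).trans_le (dist_le_norm_add_norm _ _)

theorem IsContractiveOnAverage.exists_ae_isContractivePath [IsProbabilityMeasure P]
    {hM : M.IsRegularOn K} {ς : orthant q} (hΦ : hM.IsContractiveOnAverage P X ς)
    (hξ : IsErgodicVersion P X ξ) :
    ∃ ε > 0, ∀ᵐ ω ∂P, hM.IsContractivePath (constFun K ς) ε (ξ ω) := by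
  obtain ⟨ε, hε, hcontr⟩ := hΦ.exists_ae_contractsExp hξ
  exact ⟨ε, hε, hcontr.mp ((hΦ.ae_subexponential_init hξ).mono fun ω h₁ h₂ => ⟨h₂, h₁⟩)⟩

variable {hM : M.IsRegularOn K} {o : NonnegFun K q} {ε : ℝ}

theorem isStationarySolution_limitSol (hξ : IsErgodicVersion P X ξ) (hε : 0 < ε)
    (hpath : ∀ᵐ ω ∂P, hM.IsContractivePath o ε (ξ ω)) :
    hM.IsStationarySolution P X fun t ω => hM.limitSol o (ξ ω) t where
  stationary := (hξ.isStationaryErgodicSeq (G := hM.limitSol o) (fun _ =>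
    hM.measurable_limitSol o fun k _ => measurable_pi_apply k)
    (hM.limitSol_shiftBy o)).isStationarySeq
  sre t := by
    filter_upwards [hpath, hM.ae_randomPhi_eq hξ] with ω hω hΦω
    rw [hΦω, hω.limitSol_add_one hε]

theorem IsStationarySolution.ae_eq_limitSol [IsProbabilityMeasure P] {h : ℤ → Ω → NonnegFun K q}
    (hh : hM.IsStationarySolution P X h) (hξ : IsErgodicVersion P X ξ) (hε : 0 < ε)
    (hpath : ∀ᵐ ω ∂P, hM.IsContractivePath o ε (ξ ω)) :
    ∀ᵐ ω ∂P, ∀ t, h t ω = hM.limitSol o (ξ ω) t := by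
  refine ae_all_iff.2 (ae_eq_of_isStationarySeq (φ := fun ω => hM.pathPhi (ξ ω))
    (h := fun t ω => hM.limitSol o (ξ ω) t) hε hh.stationary
    (hpath.mono fun ω hω => hω.contractsExp)
    (hpath.mono fun ω hω => hω.subexponential_dist_limitSol hε)
    (hpath.mono fun ω hω => hω.limitSol_add_one hε) ?_)
  filter_upwards [ae_all_iff.2 hh.sre, hM.ae_randomPhi_eq hξ] with ω hω hΦω
  rwa [hΦω] at hω

theorem measurable_supNorm_dpsi (hM : M.IsRegularOn K) (o : NonnegFun K q) (j : Fin q)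
    (k : Fin d ⊕ Fin q) : Measurable fun x : ℤ → ℝ => supNorm K fun θ : K =>
      M.dpsi K (pathLags p x 0) j k θ ((hM.limitSol o x 0).1 θ) := by
  have hlsc : LowerSemicontinuous fun G : C(K, Vec d × Vec q →L[ℝ] Vec q) =>
      supNorm K fun θ : K => G θ (direction k) j := by
    refine lowerSemicontinuous_iSup fun θ => Continuous.lowerSemicontinuous ?_
    have heval : Continuous fun G : C(K, Vec d × Vec q →L[ℝ] Vec q) => G θ := by fun_prop
    exact ((EuclideanSpace.proj j : Vec q →L[ℝ] ℝ).continuous.comp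
      (heval.clm_apply continuous_const)).enorm
  have hgrad : Measurable fun x : ℤ → ℝ => hM.grad (pathLags p x 0) (hM.limitSol o x 0) :=
    hM.measurable_grad_limitSol o fun k _ => measurable_pi_apply k
  simpa only [Function.comp_def, grad_direction] using hlsc.measurable.comp hgrad

theorem abs_dpsi_le_toReal_supNorm {x : Fin p → ℝ} {s : NonnegFun K q} {j : Fin q}
    {k : Fin d ⊕ Fin q} (h : (supNorm K fun θ : K => M.dpsi K x j k θ (s.1 θ)) ≠ ⊤) (θ : K) :
    |M.dpsi K x j k θ (s.1 θ)| ≤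
      (supNorm K fun θ : K => M.dpsi K x j k θ (s.1 θ)).toReal := by
  rw [← Real.norm_eq_abs, ← toReal_enorm]
  exact ENNReal.toReal_mono h (le_iSup (fun θ : K => ‖M.dpsi K x j k θ (s.1 θ)‖ₑ) θ)

theorem ae_subexponential_pathStep_zero [IsProbabilityMeasure P] {h : ℤ → Ω → NonnegFun K q}
    (hξ : IsErgodicVersion P X ξ) (hlim : ∀ᵐ ω ∂P, ∀ t, h t ω = hM.limitSol o (ξ ω) t)
    (hD : M.DerivCondition K P X h) :
    ∀ᵐ ω ∂P, Subexponential fun t => dist (hM.pathStep (ξ ω) (hM.limitSol o (ξ ω)) t 0) 0 := by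
  have hsub : ∀ᵐ ω ∂P, ∀ (j : Fin q) (k : Fin d),
      (∀ t, (supNorm K fun θ : K => M.dpsi K (pathLags p (ξ ω) t) j (Sum.inl k) θ
        ((hM.limitSol o (ξ ω) t).1 θ)) ≠ ⊤) ∧
      Subexponential fun t => (supNorm K fun θ : K => M.dpsi K (pathLags p (ξ ω) t) j (Sum.inl k) θ
        ((hM.limitSol o (ξ ω) t).1 θ)).toReal := by
    refine ae_all_iff.2 fun j => ae_all_iff.2 fun k => ?_
    have hmom := (hD.moment j (Sum.inl k)).congr (Y' := fun ω => supNorm K fun θ : K =>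
      M.dpsi K (pathLags p (ξ ω) 0) j (Sum.inl k) θ ((hM.limitSol o (ξ ω) 0).1 θ)) (by
        filter_upwards [hξ.ae_eq, hlim] with ω hω hlimω
        rw [hlimω, ← hω]
        rfl)
    simpa only [pathLags_shiftBy, limitSol_shiftBy, zero_add] using
      hξ.ae_subexponential (hM.measurable_supNorm_dpsi o j (Sum.inl k)) hmom
  filter_upwards [hsub] with ω hω
  refine (Subexponential.sum Finset.univ fun j =>
    Subexponential.sum Finset.univ fun k => (hω j k).2).mono fun t => ?_
  rw [dist_zero_right (E := C(K, Vec d →L[ℝ] Vec q))]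
  exact hM.norm_graphComp_grad_zero_le _ _ (fun j k => ENNReal.toReal_nonneg)
    fun j k θ => abs_dpsi_le_toReal_supNorm ((hω j k).1 t) θ

theorem exists_ae_isHolderPath [IsProbabilityMeasure P] {h : ℤ → Ω → NonnegFun K q}
    (hξ : IsErgodicVersion P X ξ) (hpath : ∀ᵐ ω ∂P, hM.IsContractivePath o ε (ξ ω))
    (hlim : ∀ᵐ ω ∂P, ∀ t, h t ω = hM.limitSol o (ξ ω) t) (hD : M.DerivCondition K P X h) :
    ∃ κ : ℝ, 0 < κ ∧ κ ≤ 1 ∧ ∀ᵐ ω ∂P, hM.IsHolderPath o ε κ (ξ ω) := by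
  obtain ⟨C, κ, hC, hCm, hκ₀, hκ₁, hH⟩ := hD.holder
  have hsub := ae_subexponential_of_finiteLogPlusMoment
    (hC.comp ENNReal.measurable_ofReal).identDistrib hCm
  refine ⟨κ, hκ₀, hκ₁, ?_⟩
  filter_upwards [hpath, hM.ae_subexponential_pathStep_zero hξ hlim hD, hsub, ae_all_iff.2 hH,
    hξ.ae_eq] with ω hpathω hstep ⟨_, hCω⟩ hHω hω
  refine ⟨hpathω, hstep, _, hCω, fun _ => ENNReal.toReal_nonneg,
    fun t j k u hu u' hu' θ hθ => ?_⟩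
  rw [← hω]
  refine (hHω t j k u hu u' hu' θ hθ).trans ?_
  gcongr
  exact (le_max_left _ _).trans_eq ENNReal.toReal_ofReal'.symm

end VolatilityFamily.IsRegularOn

/-- The identification of continuous functions with values in the linear maps `ℝᵈ → ℝ^q` with
continuous functions with values in `ℝ^{dq}`, by pointwise application of `derivEquiv`. -/
noncomputable def derivFunEquiv {d q : ℕ} (K : TopologicalSpace.Compacts (Vec d)) :
    C(K, Vec d →L[ℝ] Vec q) ≃ₜ C(K, DerivVec d q) :=
  (Homeomorph.refl K).arrowCongr (derivEquiv d q).toHomeomorph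

theorem derivFunEquiv_apply {d q : ℕ} {K : TopologicalSpace.Compacts (Vec d)}
    (e : C(K, Vec d →L[ℝ] Vec q)) (θ : K) : derivFunEquiv K e θ = derivEquiv d q (e θ) := rfl

theorem supNorm_derivEquiv_sub_le {d q : ℕ} {K : TopologicalSpace.Compacts (Vec d)}
    (a b : C(K, Vec d →L[ℝ] Vec q)) :
    (supNorm K fun θ : K => derivEquiv d q (a θ) - derivEquiv d q (b θ)) ≤
      ENNReal.ofReal (‖(derivEquiv d q : (Vec d →L[ℝ] Vec q) →L[ℝ] DerivVec d q)‖ * dist a b) := by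
  refine iSup_le fun θ => ?_
  beta_reduce
  rw [← map_sub, ← ofReal_norm]
  refine ENNReal.ofReal_le_ofReal (((derivEquiv d q :
    (Vec d →L[ℝ] Vec q) →L[ℝ] DerivVec d q).le_opNorm (a θ - b θ)).trans ?_)
  rw [← dist_eq_norm]
  gcongr
  exact ContinuousMap.dist_apply_le_dist θ

namespace VolatilityFamily

theorem HasDerivInterior.firstDeriv_eq {d q : ℕ} {K : TopologicalSpace.Compacts (Vec d)}
    {s : C(K, Vec q)} {e : C(K, Vec d →L[ℝ] Vec q)} (h : HasDerivInterior K s e)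
    (hK : (K : Set (Vec d)) ⊆ closure (interior (K : Set (Vec d)))) (θ : K) :
    firstDeriv K s θ = derivEquiv d q (e θ) := by
  rw [← h.derivOn_eq hK θ]
  rfl

namespace IsRegularOn

variable {d p q : ℕ} {M : VolatilityFamily d p q} {K : TopologicalSpace.Compacts (Vec d)}
  {Ω : Type*}

theorem hHat_eq_forwardIterate (hM : M.IsRegularOn K) (X : ℤ → Ω → ℝ) (ς : orthant q) (n : ℕ)
    (ω : Ω) : hM.hHat X ς n ω = forwardIterate (hM.randomPhi X ω) 0 n (constFun K ς) := by
  induction n with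
  | zero => rfl
  | succ n ih =>
    rw [forwardIterate_succ, Function.comp_apply, ← ih, zero_add]
    rfl

theorem hasDerivInterior_hHat (hM : M.IsRegularOn K) (X : ℤ → Ω → ℝ) (ς : orthant q) (n : ℕ)
    (ω : Ω) {x : ℤ → ℝ} (hx : hM.randomPhi X ω = hM.pathPhi x) :
    HasDerivInterior K (hM.hHat X ς n ω).1
      (forwardIterate (hM.pathStep x (orbitFrom (hM.pathPhi x) (constFun K ς) 0)) 0 n 0) := by
  rw [hHat_eq_forwardIterate, hx]
  exact hM.hasDerivInterior_forwardIterate x ς 0 n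

theorem isC1_hHat (hM : M.IsRegularOn K) (X : ℤ → Ω → ℝ) (ς : orthant q) (n : ℕ) (ω : Ω) :
    IsC1 K (hM.hHat X ς n ω).1 :=
  (hM.hasDerivInterior_hHat X ς n ω (x := fun t => X t ω) rfl).isC1

theorem derivFunEquiv_symm_eq_graphComp_grad_iff (hM : M.IsRegularOn K) (x : Fin p → ℝ)
    (s : NonnegFun K q) (w w' : C(K, DerivVec d q)) :
    (derivFunEquiv K).symm w' = graphComp (hM.grad x s) ((derivFunEquiv K).symm w) ↔
      ∀ (θ : K) (j : Fin q) (k : Fin d), w' θ (j, k) = M.dpsi K x j (Sum.inl k) θ (s.1 θ) +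
        ∑ i : Fin q, M.dpsi K x j (Sum.inr i) θ (s.1 θ) * w θ (i, k) := by
  have hentry : ∀ (θ : K) (j : Fin q) (k : Fin d),
      derivFunEquiv K (graphComp (hM.grad x s) ((derivFunEquiv K).symm w)) θ (j, k) =
        M.dpsi K x j (Sum.inl k) θ (s.1 θ) +
          ∑ i : Fin q, M.dpsi K x j (Sum.inr i) θ (s.1 θ) * w θ (i, k) := fun θ j k => by
    simp only [derivFunEquiv_apply, derivEquiv_graphComp_grad]
    simp only [← derivFunEquiv_apply, Homeomorph.apply_symm_apply]
  simp only [Homeomorph.symm_apply_eq (derivFunEquiv K), ← hentry]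
  exact ⟨fun h θ j k => by rw [h], fun h =>
    ContinuousMap.ext fun θ => PiLp.ext fun jk => h θ jk.1 jk.2⟩

variable [mΩ : MeasurableSpace Ω] {P : Measure Ω} {X : ℤ → Ω → ℝ} {ξ : Ω → ℤ → ℝ}
  {hM : M.IsRegularOn K} {o : NonnegFun K q} {ε κ : ℝ} {h : ℤ → Ω → NonnegFun K q}

theorem solvesDerivSRE_iff (hξ : IsErgodicVersion P X ξ)
    (hlim : ∀ᵐ ω ∂P, ∀ t, h t ω = hM.limitSol o (ξ ω) t) (D : ℤ → Ω → C(K, DerivVec d q)) :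
    M.SolvesDerivSRE K P X h D ↔ ∀ᵐ ω ∂P, ∀ t, (derivFunEquiv K).symm (D (t + 1) ω) =
      hM.pathStep (ξ ω) (hM.limitSol o (ξ ω)) t ((derivFunEquiv K).symm (D t ω)) := by
  rw [SolvesDerivSRE, ← ae_all_iff]
  refine eventually_congr ?_
  filter_upwards [hξ.ae_eq, hlim] with ω hω hlimω
  refine forall_congr' fun t => ?_
  rw [pathStep, derivFunEquiv_symm_eq_graphComp_grad_iff, hlimω, ← hω]
  rfl

theorem measurable_derivFunEquiv_limitDeriv (hM : M.IsRegularOn K) (o : NonnegFun K q)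
    {Y : Ω → ℤ → ℝ} {t : ℤ} (hY : ∀ k < t, Measurable fun ω => Y ω k) :
    Measurable fun ω => derivFunEquiv K (hM.limitDeriv o (Y ω) t) :=
  (derivFunEquiv K).continuous.measurable.comp (hM.measurable_limitDeriv o hY)

theorem isStationaryErgodicSeq_limitDeriv (hM : M.IsRegularOn K) (hξ : IsErgodicVersion P X ξ)
    (o : NonnegFun K q) :
    IsStationaryErgodicSeq P fun t ω => derivFunEquiv K (hM.limitDeriv o (ξ ω) t) :=
  hξ.isStationaryErgodicSeq (G := fun x t => derivFunEquiv K (hM.limitDeriv o x t))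
    (fun _ => hM.measurable_derivFunEquiv_limitDeriv o fun k _ => measurable_pi_apply k)
    fun k x t => congrArg _ (hM.limitDeriv_shiftBy o k x t)

theorem solvesDerivSRE_limitDeriv (hξ : IsErgodicVersion P X ξ) (hε : 0 < ε)
    (hlim : ∀ᵐ ω ∂P, ∀ t, h t ω = hM.limitSol o (ξ ω) t)
    (hpath : ∀ᵐ ω ∂P, hM.IsHolderPath o ε κ (ξ ω)) :
    M.SolvesDerivSRE K P X h fun t ω => derivFunEquiv K (hM.limitDeriv o (ξ ω) t) := by
  rw [solvesDerivSRE_iff hξ hlim]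
  filter_upwards [hpath] with ω hω t
  simp only [Homeomorph.symm_apply_apply]
  exact hω.limitDeriv_add_one hε t

theorem ae_eq_limitDeriv_of_solvesDerivSRE [IsProbabilityMeasure P]
    (hξ : IsErgodicVersion P X ξ) (hε : 0 < ε)
    (hlim : ∀ᵐ ω ∂P, ∀ t, h t ω = hM.limitSol o (ξ ω) t)
    (hpath : ∀ᵐ ω ∂P, hM.IsHolderPath o ε κ (ξ ω)) {D : ℤ → Ω → C(K, DerivVec d q)}
    (hD : IsStationarySeq P D) (hsol : M.SolvesDerivSRE K P X h D) (t : ℤ) :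
    D t =ᵐ[P] fun ω => derivFunEquiv K (hM.limitDeriv o (ξ ω) t) := by
  have huniq := ae_eq_of_isStationarySeq
    (φ := fun ω => hM.pathStep (ξ ω) (hM.limitSol o (ξ ω)))
    (h := fun t ω => hM.limitDeriv o (ξ ω) t) hε
    (hD.comp (derivFunEquiv K).symm.continuous.measurable)
    (hpath.mono fun ω hω => hω.contractsExp_pathStep hε)
    (hpath.mono fun ω hω => hω.subexponential_dist_limitDeriv hε)
    (hpath.mono fun ω hω => hω.limitDeriv_add_one hε)
    ((solvesDerivSRE_iff hξ hlim D).1 hsol) t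
  exact huniq.mono fun ω => ((derivFunEquiv K).symm_apply_eq).1

variable {ς : orthant q}

theorem ae_isC1_and_firstDeriv_eq (hε : 0 < ε) (hκ₀ : 0 < κ) (hκ₁ : κ ≤ 1)
    (hlim : ∀ᵐ ω ∂P, ∀ t, h t ω = hM.limitSol (constFun K ς) (ξ ω) t)
    (hpath : ∀ᵐ ω ∂P, hM.IsHolderPath (constFun K ς) ε κ (ξ ω)) (t : ℤ) :
    ∀ᵐ ω ∂P, IsC1 K (h t ω).1 ∧ ∀ θ, firstDeriv K (h t ω).1 θ =
      derivFunEquiv K (hM.limitDeriv (constFun K ς) (ξ ω) t) θ := by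
  filter_upwards [hlim, hpath] with ω hlimω hω
  have hderiv := hω.hasDerivInterior_limitSol hε hκ₀ hκ₁ t
  rw [hlimω]
  exact ⟨hderiv.isC1, hderiv.firstDeriv_eq hM.subset_closure_interior⟩

theorem expFastAS_supNorm_firstDeriv_hHat_sub (hξ : IsErgodicVersion P X ξ) (hε : 0 < ε)
    (hκ₀ : 0 < κ) (hκ₁ : κ ≤ 1) (hpath : ∀ᵐ ω ∂P, hM.IsHolderPath (constFun K ς) ε κ (ξ ω)) :
    ExpFastAS P fun n ω => supNorm K fun θ => firstDeriv K (hM.hHat X ς n ω).1 θ -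
      derivFunEquiv K (hM.limitDeriv (constFun K ς) (ξ ω) n) θ := by
  have hδ : 0 < κ * ε / 4 := by positivity
  refine expFastAS_of_ae_le_exp hδ ?_
  filter_upwards [hM.ae_randomPhi_eq hξ, hpath] with ω hΦω hω
  obtain ⟨C, _, hbound⟩ := hω.exists_dist_derivOrbit_le hε hκ₀ hκ₁ hδ
  refine ⟨‖(derivEquiv d q : (Vec d →L[ℝ] Vec q) →L[ℝ] DerivVec d q)‖ * C, fun n => ?_⟩
  simp only [(hM.hasDerivInterior_hHat X ς n ω hΦω).firstDeriv_eq hM.subset_closure_interior,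
    derivFunEquiv_apply]
  refine (supNorm_derivEquiv_sub_le _ _).trans (ENNReal.ofReal_le_ofReal ?_)
  have hrate : -(κ * ε / 2 - κ * ε / 4) * n + κ * ε / 4 * |((0 : ℤ) : ℝ)| =
      -(κ * ε / 4) * n := by
    rw [Int.cast_zero, abs_zero]
    ring
  have hbound₀ := hbound 0 n
  rw [zero_add, hrate] at hbound₀
  rw [mul_assoc]
  gcongr

end IsRegularOn

theorem IsSolution.aestronglyMeasurable {d p q : ℕ} {M : VolatilityFamily d p q} {Ω : Type*}
    [MeasurableSpace Ω] {P : Measure Ω} {Z X σ : ℤ → Ω → ℝ} {θ : Vec d}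
    (h : M.IsSolution P Z θ X σ) (t : ℤ) : AEStronglyMeasurable[pastField Z t] (X t) P :=
  ⟨fun ω => σ t ω * Z t ω, Measurable.stronglyMeasurable
    (((h.measurable t).mono (pastField_mono Z (by omega)) le_rfl).mul (measurable_pastField Z t)),
    h.obs t⟩

theorem IsUniqueStationaryErgodicSolution.isStationaryErgodicSeq {d p q : ℕ}
    {M : VolatilityFamily d p q} {Ω : Type*} [MeasurableSpace Ω] {P : Measure Ω}
    {Z X σ : ℤ → Ω → ℝ} {θ : Vec d} (h : M.IsUniqueStationaryErgodicSolution P Z θ X σ) :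
    IsStationaryErgodicSeq P X :=
  isStationaryErgodicSeq_factor (ξ := fun ω t => (X t ω, σ t ω)) (G := fun x t => (x t).1)
    (aemeasurable_pi_lambda _ h.stationaryErgodic.aemeasurable) h.stationaryErgodic.ergodic
    (fun t => measurable_fst.comp (measurable_pi_apply t)) fun _ _ => rfl

end VolatilityFamily

open VolatilityFamily IsRegularOn in
theorem proposition6p1_general {d p q : ℕ} (M : VolatilityFamily d p q)
    {Ω : Type*} [mΩ : MeasurableSpace Ω] (P : Measure Ω) [IsProbabilityMeasure P]
    (ℱ : Filtration ℤ mΩ) (X : ℤ → Ω → ℝ) (hX : IsStationaryErgodicSeq P X)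
    (hadapted : ∀ t, AEStronglyMeasurable[ℱ t] (X t) P)
    (K : TopologicalSpace.Compacts (Vec d)) (hM : M.IsRegularOn K)
    (ς : orthant q) (hΦ : hM.IsContractiveOnAverage P X ς) :
    (∃ h : ℤ → Ω → NonnegFun K q, hM.IsStationarySolution P X h) ∧
    ∀ h : ℤ → Ω → NonnegFun K q, hM.IsStationarySolution P X h → M.DerivCondition K P X h →
      (∀ t ω, IsC1 K (hM.hHat X ς t ω).1) ∧
      ∃ D : ℤ → Ω → C(K, DerivVec d q),
        IsStationaryErgodicSeq P D ∧
        M.SolvesDerivSRE K P X h D ∧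
        (∀ D' : ℤ → Ω → C(K, DerivVec d q), IsStationarySeq P D' →
          M.SolvesDerivSRE K P X h D' → ∀ t, D' t =ᵐ[P] D t) ∧
        (∀ t, Measurable[ℱ (t - 1)] (D t)) ∧
        (∀ t, ∀ᵐ ω ∂P, IsC1 K (h t ω).1 ∧ ∀ θ, firstDeriv K (h t ω).1 θ = D t ω θ) ∧
        ExpFastAS P fun t ω =>
          supNorm K fun θ => firstDeriv K (hM.hHat X ς t ω).1 θ - D (t : ℤ) ω θ := by
  set ξ : Ω → ℤ → ℝ := fun ω t => (hadapted t).mk (X t) ω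
  have hadapted_ξ (t k : ℤ) (hk : k ≤ t) : Measurable[ℱ t] fun ω => ξ ω k :=
    (hadapted k).stronglyMeasurable_mk.measurable.mono (ℱ.mono hk) le_rfl
  have hξ : IsErgodicVersion P X ξ :=
    hX.isErgodicVersion (fun t => (hadapted_ξ t t le_rfl).mono (ℱ.le t) le_rfl)
      fun t => (hadapted t).ae_eq_mk
  obtain ⟨ε, hε, hpath⟩ := hΦ.exists_ae_isContractivePath hξ
  refine ⟨⟨_, isStationarySolution_limitSol hξ hε hpath⟩, fun h hh hD =>
    ⟨fun n ω => hM.isC1_hHat X ς n ω, ?_⟩⟩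
  have hlim := hh.ae_eq_limitSol hξ hε hpath
  obtain ⟨κ, hκ₀, hκ₁, hHolder⟩ := exists_ae_isHolderPath hξ hpath hlim hD
  exact ⟨fun t ω => derivFunEquiv K (hM.limitDeriv (constFun K ς) (ξ ω) t),
    hM.isStationaryErgodicSeq_limitDeriv hξ _,
    solvesDerivSRE_limitDeriv hξ hε hlim hHolder,
    fun D' => ae_eq_limitDeriv_of_solvesDerivSRE hξ hε hlim hHolder,
    fun t => measurable_derivFunEquiv_limitDeriv (mΩ := ℱ (t - 1)) hM _ fun k hk =>
      hadapted_ξ (t - 1) k (by omega),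
    ae_isC1_and_firstDeriv_eq hε hκ₀ hκ₁ hlim hHolder,
    expFastAS_supNorm_firstDeriv_hHat_sub hξ hε hκ₀ hκ₁ hHolder⟩

theorem proposition6p1 {d p q : ℕ} (M : VolatilityFamily d p q)
    {Ω : Type*} [MeasurableSpace Ω] (P : Measure Ω) [IsProbabilityMeasure P]
    (Z X σ : ℤ → Ω → ℝ) (hZ : IsNoise P Z)
    (θ₀ : Vec d) (hθ₀ : θ₀ ∈ M.Θ) (hXσ : M.IsUniqueStationaryErgodicSolution P Z θ₀ X σ)
    (K : TopologicalSpace.Compacts (Vec d)) (hM : M.IsRegularOn K)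
    (ς : orthant q) (hΦ : hM.IsContractiveOnAverage P X ς) :
    (∃ h : ℤ → Ω → NonnegFun K q, hM.IsStationarySolution P X h) ∧
    ∀ h : ℤ → Ω → NonnegFun K q, hM.IsStationarySolution P X h → M.DerivCondition K P X h →
      (∀ t ω, IsC1 K (hM.hHat X ς t ω).1) ∧
      ∃ D : ℤ → Ω → C(K, DerivVec d q),
        IsStationaryErgodicSeq P D ∧
        M.SolvesDerivSRE K P X h D ∧
        (∀ D' : ℤ → Ω → C(K, DerivVec d q), IsStationarySeq P D' →
          M.SolvesDerivSRE K P X h D' → ∀ t, D' t =ᵐ[P] D t) ∧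
        (∀ t, Measurable[pastField Z (t - 1)] (D t)) ∧
        (∀ t, ∀ᵐ ω ∂P, IsC1 K (h t ω).1 ∧ ∀ θ, firstDeriv K (h t ω).1 θ = D t ω θ) ∧
        ExpFastAS P fun t ω =>
          supNorm K fun θ => firstDeriv K (hM.hHat X ς t ω).1 θ - D (t : ℤ) ω θ :=
  proposition6p1_general M P (pastFiltration hZ.measurable) X hXσ.isStationaryErgodicSeq
    hXσ.isSolution.aestronglyMeasurable K hM ς hΦ
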